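/- Fix a smooth function $\eta:\mathbb R\to[0,1]$ with $\eta(\xi)=1$ for $|\xi|\le 1$ and $\eta(\xi)=0$ for $|\xi|\ge 2$. For $d\ge 1$ and $k\in\mathbb Z^d$ put $$\phi_k(\xi)=\prod_{i=1}^d \eta\big(2(\xi_i-k_i)\big),\qquad \psi_k=\frac{\phi_k}{\sum_{l\in\mathbb Z^d}\phi_l},\qquad \Box_k=\mathscr F^{-1}\psi_k\mathscr F,$$ where $\mathscr F$ is the Fourier transform with kernel $(2\pi)^{-d/2}e^{-ix\cdot\xi}$, and write $\langle k\rangle=(1+|k|^2)^{1/2}$. Let $0<p,q,r\le\infty$, $s\in\mathbb R$. The modulation space $M^s_{p,q}(\mathbb R^d)$ is the space of all tempered distributions $f$ on $\mathbb R^d$ with $$\|f\|_{M^s_{p,q}}=\Big(\sum_{k\in\mathbb Z^d}\langle k\rangle^{sq}\|\Box_kf\|_{L^p(\mathbb R^d)}^q\Big)^{1/q}<\infty .$$ For $n\ge2$ write $k=(\bar k,k_n)$ with $\bar k\in\mathbb Z^{n-1}$. The anisotropic modulation space $M^s_{p,q,r}(\mathbb R^n)$ is the space of all tempered distributions $f$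 on $\mathbb R^n$ with $$\|f\|_{M^s_{p,q,r}}=\Big(\sum_{k_n\in\mathbb Z}\Big(\sum_{\bar k\in\mathbb Z^{n-1}}\langle\bar k\rangle^{sq}\|\Box_kf\|_{L^p(\mathbb R^n)}^q\Big)^{r/q}\Big)^{1/r}<\infty .$$ (A sum is replaced by a supremum when the exponent is $\infty$.) For a tempered distribution $f$ on $\mathbb R^n$ and a tempered distribution $g$ on $\mathbb R^{n-1}$, we say that $f(\bar x,0)=g$ if there is a weakly continuous family $(F_t)_{t\in\mathbb R}$ of tempered distributions on $\mathbb R^{n-1}$ with $F_0=g$ and $$\langle f,\Phi\rangle=\int_{\mathbb R}\langle F_t,\Phi(\cdot,t)\rangle\,dt$$ for all Schwartz functions $\Phi$ on $\mathbb R^n$ with bounded support in the last variable. **Theorem.** Let $n\ge2$, $0<p,q\le\infty$, $s\in\mathbb R$, and let $p\wedge q\wedge1=\min(p,q,1)$. Every $f\in M^s_{p,q,p\wedge q\wedge 1}(\mathbb R^n)$ has a unique restriction $f(\bar x,0)$ in the above sense, it lies in $M^s_{p,q}(\mathbb R^{n-1})$, and the linear map $\mathrm{Tr}:f\mapsto f(\bar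 x,0)$ is a retraction from $M^s_{p,q,p\wedge q\wedge1}(\mathbb R^n)$ onto $M^s_{p,q}(\mathbb R^{n-1})$: there is a constant $C$ such that $$\|\mathrm{Tr}f\|_{M^s_{p,q}(\mathbb R^{n-1})}\le C\,\|f\|_{M^s_{p,q,p\wedge q\wedge1}(\mathbb R^n)}\quad\text{for all } f\in M^s_{p,q,p\wedge q\wedge1}(\mathbb R^n),$$ and there is a bounded linear operator $E:M^s_{p,q}(\mathbb R^{n-1})\to M^s_{p,q,p\wedge q\wedge1}(\mathbb R^n)$ such that $\mathrm{Tr}\,E$ is the identity. Moreover, for every smooth $\theta:\mathbb R\to[0,1]$ with $\theta=1$ on $[-1,1]$, $\theta=0$ outside $(-2,2)$ and $(\mathscr F^{-1}\theta)(0)=(2\pi)^{-1/2}\int_{\mathbb R}\theta=1$, the tensor product $(Ef)(x)=(\mathscr F^{-1}\theta)(x_n)\,f(\bar x)$ is such an operator $E$. -/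

import Mathlib

open MeasureTheory
open scoped ENNReal NNReal SchwartzMap ContDiff

noncomputable section

/-! ### Frequency-uniform decomposition -/

/-- A smooth bump function `η : ℝ → [0,1]` with `η = 1` on `|ξ| ≤ 1` and `η = 0` on `|ξ| ≥ 2`. -/
structure IsBump (η : ℝ → ℝ) : Prop where
  smooth : ContDiff ℝ ∞ η
  nonneg : ∀ ξ, 0 ≤ η ξ
  le_one : ∀ ξ, η ξ ≤ 1
  eq_one : ∀ ξ, |ξ| ≤ 1 → η ξ = 1
  eq_zero : ∀ ξ, 2 ≤ |ξ| → η ξ = 0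

/-- `φ_k(ξ) = ∏ᵢ η((ξᵢ - kᵢ) / r)` with `r = 1/2`. -/
def bumpProd {d : ℕ} (η : ℝ → ℝ) (k : Fin d → ℤ) (ξ : EuclideanSpace ℝ (Fin d)) : ℝ :=
  ∏ i, η ((ξ i - k i) / (1 / 2))

/-- The bounded admissible partition of unity `ψ_k = φ_k / ∑_l φ_l`, `k ∈ ℤ^d`. -/
def bapu {d : ℕ} (η : ℝ → ℝ) (k : Fin d → ℤ) (ξ : EuclideanSpace ℝ (Fin d)) : ℝ :=
  bumpProd η k ξ / ∑' l : Fin d → ℤ, bumpProd η l ξ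

/-- The frequency-uniform decomposition operator `□_k = 𝓕⁻¹ ψ_k 𝓕` on tempered distributions,
for the Fourier transform with kernel `e^{-i x·ξ}`. Mathlib's Fourier transform has the kernel
`e^{-2π i x·ξ}`, hence the rescaled symbol `ψ_k(2π ξ)`. -/
def box {d : ℕ} (η : ℝ → ℝ) (k : Fin d → ℤ) :
    𝓢'(EuclideanSpace ℝ (Fin d), ℂ) →L[ℂ] 𝓢'(EuclideanSpace ℝ (Fin d), ℂ) :=
  TemperedDistribution.fourierMultiplierCLM ℂ
    (fun ξ => ((bapu η k ((2 * Real.pi) • ξ) : ℝ) : ℂ))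

/-! ### The `L^p` quasi-norm of a tempered distribution -/

/-- The tempered distribution `u` is given by integration against the function `g`. -/
def IsRepresentedBy {d : ℕ} (u : 𝓢'(EuclideanSpace ℝ (Fin d), ℂ))
    (g : EuclideanSpace ℝ (Fin d) → ℂ) : Prop :=
  AEStronglyMeasurable g volume ∧
    ∀ φ : 𝓢(EuclideanSpace ℝ (Fin d), ℂ),
      Integrable (fun x => φ x * g x) ∧ u φ = ∫ x, φ x * g x

/-- The `L^p` quasi-norm (`0 < p ≤ ∞`) of a tempered distribution: the `L^p` quasi-norm of the
(almost everywhere unique) function that represents it, and `∞` if there is none. -/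
def distLp {d : ℕ} (p : ℝ≥0∞) (u : 𝓢'(EuclideanSpace ℝ (Fin d), ℂ)) : ℝ≥0∞ :=
  ⨅ g : {g : EuclideanSpace ℝ (Fin d) → ℂ // IsRepresentedBy u g}, eLpNorm g.1 p volume

/-! ### Modulation spaces -/

/-- The weight `⟨k⟩^s = (1 + |k|²)^{s/2}`, with the Euclidean length `|k|`. -/
def weight {d : ℕ} (s : ℝ) (k : Fin d → ℤ) : ℝ≥0∞ :=
  ENNReal.ofReal ((1 + ∑ i, (k i : ℝ) ^ 2) ^ (s / 2))

/-- The quasi-norm of `M^s_{p,q}(ℝ^d)`: the `ℓ^q(ℤ^d)` quasi-norm of `⟨k⟩^s ‖□_k f‖_p`. -/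
def modNorm {d : ℕ} (η : ℝ → ℝ) (s : ℝ) (p q : ℝ≥0∞)
    (f : 𝓢'(EuclideanSpace ℝ (Fin d), ℂ)) : ℝ≥0∞ :=
  eLpNorm (fun k : Fin d → ℤ => weight s k * distLp p (box η k f)) q Measure.count

/-- The quasi-norm of the anisotropic modulation space `M^s_{p,q,r}(ℝ^{d+1})`: an `ℓ^q` quasi-norm
in `k̄ ∈ ℤ^d`, with the weight `⟨k̄⟩^s`, inside an `ℓ^r` quasi-norm in the last index `k_n ∈ ℤ`. -/
def anisoNorm {d : ℕ} (η : ℝ → ℝ) (s : ℝ) (p q r : ℝ≥0∞)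
    (f : 𝓢'(EuclideanSpace ℝ (Fin (d + 1)), ℂ)) : ℝ≥0∞ :=
  eLpNorm (fun kn : ℤ =>
    eLpNorm (fun kbar : Fin d → ℤ =>
      weight s kbar * distLp p (box η (Fin.snoc kbar kn : Fin (d + 1) → ℤ) f))
      q Measure.count) r Measure.count

section helpers

variable {d : ℕ} {p : ℝ≥0∞}

lemma distLp_le {u : 𝓢'(EuclideanSpace ℝ (Fin d), ℂ)} {g : EuclideanSpace ℝ (Fin d) → ℂ}
    (h : IsRepresentedBy u g) : distLp p u ≤ eLpNorm g p volume :=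
  iInf_le (fun g : {g : EuclideanSpace ℝ (Fin d) → ℂ // IsRepresentedBy u g} =>
    eLpNorm g.1 p volume) ⟨g, h⟩

lemma IsRepresentedBy.add {u v : 𝓢'(EuclideanSpace ℝ (Fin d), ℂ)}
    {g h : EuclideanSpace ℝ (Fin d) → ℂ} (hu : IsRepresentedBy u g) (hv : IsRepresentedBy v h) :
    IsRepresentedBy (u + v) (g + h) := by
  refine ⟨hu.1.add hv.1, fun φ => ?_⟩
  have hg := hu.2 φ
  have hh := hv.2 φ
  simp only [Pi.add_apply, mul_add]
  refine ⟨hg.1.add hh.1, ?_⟩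
  rw [integral_add hg.1 hh.1, ← hg.2, ← hh.2]
  rfl

lemma IsRepresentedBy.smul {u : 𝓢'(EuclideanSpace ℝ (Fin d), ℂ)}
    {g : EuclideanSpace ℝ (Fin d) → ℂ} (c : ℂ) (hu : IsRepresentedBy u g) :
    IsRepresentedBy (c • u) (c • g) := by
  refine ⟨hu.1.const_smul c, fun φ => ?_⟩
  have hg := hu.2 φ
  have : (fun x => φ x * (c • g) x) = fun x => c * (φ x * g x) := by
    funext x; simp only [Pi.smul_apply, smul_eq_mul]; ring
  rw [this]
  refine ⟨hg.1.const_mul c, ?_⟩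
  rw [integral_const_mul, ← hg.2]
  rfl

lemma distLp_add_le (u v : 𝓢'(EuclideanSpace ℝ (Fin d), ℂ)) :
    distLp p (u + v) ≤ ENNReal.LpAddConst p * (distLp p u + distLp p v) := by
  by_cases h0 : ENNReal.LpAddConst p = 0
  · exfalso
    have : (1 : ℝ≥0∞) ≤ ENNReal.LpAddConst p := by
      unfold ENNReal.LpAddConst
      split_ifs with h
      · have h1 : 1 ≤ p.toReal⁻¹ := by
          apply (one_le_inv₀ (ENNReal.toReal_pos h.1.ne' (h.2.trans ENNReal.one_lt_top).ne)).2
          simpa using ENNReal.toReal_mono ENNReal.one_ne_top h.2.le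
        calc (1 : ℝ≥0∞) = 1 ^ (1 / p.toReal - 1) := by simp
          _ ≤ 2 ^ (1 / p.toReal - 1) := by
            apply ENNReal.rpow_le_rpow one_le_two
            rw [one_div]; linarith
      · exact le_rfl
    rw [h0] at this
    simp at this
  · simp only [distLp, ENNReal.iInf_add, ENNReal.add_iInf]
    rw [ENNReal.mul_iInf_of_ne h0 (ENNReal.LpAddConst_lt_top p).ne]
    refine le_iInf fun g => ?_
    rw [ENNReal.mul_iInf_of_ne h0 (ENNReal.LpAddConst_lt_top p).ne]
    refine le_iInf fun h => ?_
    exact (distLp_le (h.2.add g.2)).trans (eLpNorm_add_le' h.2.1 g.2.1 p)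

lemma distLp_smul_le {c : ℂ} (hc : c ≠ 0) (u : 𝓢'(EuclideanSpace ℝ (Fin d), ℂ)) :
    distLp p (c • u) ≤ ‖c‖ₑ * distLp p u := by
  unfold distLp
  rw [ENNReal.mul_iInf_of_ne (by simpa using hc) (by simp)]
  refine le_iInf fun g => ?_
  exact (distLp_le (g.2.smul c)).trans eLpNorm_const_smul_le

lemma distLp_zero : distLp p (0 : 𝓢'(EuclideanSpace ℝ (Fin d), ℂ)) = 0 := by
  have h : IsRepresentedBy (0 : 𝓢'(EuclideanSpace ℝ (Fin d), ℂ)) 0 :=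
    ⟨aestronglyMeasurable_zero, fun φ => by simp⟩
  exact le_antisymm ((distLp_le h).trans (by simp)) zero_le

/-- Sequence quasi-norms respect bounds of the form `a ≤ K (b + c)`. -/
lemma seqNorm_le_of_le_add {ι : Type*} [Countable ι] [MeasurableSpace ι]
    [MeasurableSingletonClass ι] (q K : ℝ≥0∞) (hK : K ≠ ⊤) {a b c : ι → ℝ≥0∞}
    (h : ∀ i, a i ≤ K * (b i + c i)) :
    eLpNorm a q Measure.count ≤ (K * ENNReal.LpAddConst q) *
      (eLpNorm b q Measure.count + eLpNorm c q Measure.count) := by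
  lift K to ℝ≥0 using hK
  have h1 : eLpNorm a q Measure.count ≤ (K : ℝ≥0∞) * eLpNorm (b + c) q Measure.count := by
    exact eLpNorm_le_nnreal_smul_eLpNorm_of_ae_le_mul'
      (Filter.Eventually.of_forall fun i => by simpa using h i) q
  rw [mul_assoc]
  exact h1.trans (mul_le_mul_right (eLpNorm_add_le' (Measurable.of_discrete.aestronglyMeasurable)
    (Measurable.of_discrete.aestronglyMeasurable) q) _)

lemma seqNorm_le_of_le_mul {ι : Type*} [MeasurableSpace ι] (q K : ℝ≥0∞) (hK : K ≠ ⊤)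
    {a b : ι → ℝ≥0∞} (h : ∀ i, a i ≤ K * b i) :
    eLpNorm a q Measure.count ≤ K * eLpNorm b q Measure.count := by
  lift K to ℝ≥0 using hK
  exact eLpNorm_le_nnreal_smul_eLpNorm_of_ae_le_mul'
    (Filter.Eventually.of_forall fun i => by simpa using h i) q

lemma weighted_add_le (w : ℝ≥0∞) (u v : 𝓢'(EuclideanSpace ℝ (Fin d), ℂ)) :
    w * distLp p (u + v) ≤ ENNReal.LpAddConst p * (w * distLp p u + w * distLp p v) := by
  refine (mul_le_mul_right (distLp_add_le u v) w).trans (le_of_eq ?_)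
  ring

lemma weighted_smul_le (w : ℝ≥0∞) {c : ℂ} (hc : c ≠ 0)
    (u : 𝓢'(EuclideanSpace ℝ (Fin d), ℂ)) :
    w * distLp p (c • u) ≤ ‖c‖ₑ * (w * distLp p u) := by
  refine (mul_le_mul_right (distLp_smul_le hc u) w).trans (le_of_eq ?_)
  ring

end helpers

/-- The modulation space `M^s_{p,q}(ℝ^d)`: all tempered distributions of finite quasi-norm. -/
def modSpace (d : ℕ) (η : ℝ → ℝ) (s : ℝ) (p q : ℝ≥0∞) :
    Submodule ℂ 𝓢'(EuclideanSpace ℝ (Fin d), ℂ) where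
  carrier := {f | modNorm η s p q f < ⊤}
  zero_mem' := by
    simp [modNorm, distLp_zero]
  add_mem' := by
    intro f g hf hg
    refine lt_of_le_of_lt (seqNorm_le_of_le_add q (ENNReal.LpAddConst p) (ENNReal.LpAddConst_lt_top p).ne
      (b := fun k => weight s k * distLp p (box η k f))
      (c := fun k => weight s k * distLp p (box η k g)) fun k => ?_) ?_
    · rw [map_add]
      exact weighted_add_le _ _ _
    · exact ENNReal.mul_lt_top (ENNReal.mul_lt_top (ENNReal.LpAddConst_lt_top p) (ENNReal.LpAddConst_lt_top q))
        (ENNReal.add_lt_top.2 ⟨hf, hg⟩)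
  smul_mem' := by
    intro c f hf
    by_cases hc : c = 0
    · simp [hc, modNorm, distLp_zero]
    refine lt_of_le_of_lt (seqNorm_le_of_le_mul q ‖c‖ₑ (by simp)
      (b := fun k => weight s k * distLp p (box η k f)) fun k => ?_) ?_
    · rw [map_smul]
      exact weighted_smul_le _ hc _
    · exact ENNReal.mul_lt_top (by simp) hf

/-- The anisotropic modulation space `M^s_{p,q,r}(ℝ^{d+1})`. -/
def anisoSpace (d : ℕ) (η : ℝ → ℝ) (s : ℝ) (p q r : ℝ≥0∞) :
    Submodule ℂ 𝓢'(EuclideanSpace ℝ (Fin (d + 1)), ℂ) where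
  carrier := {f | anisoNorm η s p q r f < ⊤}
  zero_mem' := by
    simp [anisoNorm, distLp_zero]
  add_mem' := by
    intro f g hf hg
    have hK := ENNReal.mul_lt_top (ENNReal.LpAddConst_lt_top p) (ENNReal.LpAddConst_lt_top q)
    refine lt_of_le_of_lt (seqNorm_le_of_le_add r (ENNReal.LpAddConst p * ENNReal.LpAddConst q) hK.ne
      fun kn => seqNorm_le_of_le_add q (ENNReal.LpAddConst p) (ENNReal.LpAddConst_lt_top p).ne
      (b := fun k => weight s k * distLp p (box η (Fin.snoc k kn : Fin (d + 1) → ℤ) f))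
      (c := fun k => weight s k * distLp p (box η (Fin.snoc k kn : Fin (d + 1) → ℤ) g))
      fun k => ?_) ?_
    · rw [map_add]
      exact weighted_add_le _ _ _
    · exact ENNReal.mul_lt_top (ENNReal.mul_lt_top hK (ENNReal.LpAddConst_lt_top r))
        (ENNReal.add_lt_top.2 ⟨hf, hg⟩)
  smul_mem' := by
    intro c f hf
    by_cases hc : c = 0
    · simp [hc, anisoNorm, distLp_zero]
    refine lt_of_le_of_lt (seqNorm_le_of_le_mul r ‖c‖ₑ (by simp)
      fun kn => seqNorm_le_of_le_mul q ‖c‖ₑ (by simp)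
      (b := fun k => weight s k * distLp p (box η (Fin.snoc k kn : Fin (d + 1) → ℤ) f))
      fun k => ?_) ?_
    · rw [map_smul]
      exact weighted_smul_le _ hc _
    · exact ENNReal.mul_lt_top (by simp) hf

/-! ### Restriction to hyperplanes -/

/-- The point `(x̄, t)` of `ℝ^{d+1}`, for `x̄ ∈ ℝ^d` and `t ∈ ℝ`. -/
def joinLast {d : ℕ} (t : ℝ) (xbar : EuclideanSpace ℝ (Fin d)) :
    EuclideanSpace ℝ (Fin (d + 1)) :=
  WithLp.toLp 2 (Fin.snoc (fun i => xbar i) t : Fin (d + 1) → ℝ)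

lemma joinLast_isometry {d : ℕ} (t : ℝ) : Isometry (joinLast (d := d) t) := by
  refine Isometry.of_dist_eq fun x y => ?_
  simp [EuclideanSpace.dist_eq, joinLast, Fin.sum_univ_castSucc]

lemma joinLast_temperate {d : ℕ} (t : ℝ) : (joinLast (d := d) t).HasTemperateGrowth := by
  let L : EuclideanSpace ℝ (Fin d) →ₗ[ℝ] EuclideanSpace ℝ (Fin (d + 1)) :=
    { toFun := joinLast 0
      map_add' := fun x y => by
        ext i
        refine Fin.lastCases ?_ (fun j => ?_) i <;> simp [joinLast]
      map_smul' := fun c x => by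
        ext i
        refine Fin.lastCases ?_ (fun j => ?_) i <;> simp [joinLast] }
  have h : joinLast (d := d) t =
      (LinearMap.toContinuousLinearMap L : _ → _) + fun _ => joinLast t 0 := by
    funext x
    ext i
    refine Fin.lastCases ?_ (fun j => ?_) i <;> simp [joinLast, L]
  rw [h]
  exact (ContinuousLinearMap.hasTemperateGrowth _).add (Function.HasTemperateGrowth.const _)

/-- The slice `Φ(·, t)` of a Schwartz function `Φ` on `ℝ^{d+1}`. -/
def slice {d : ℕ} (t : ℝ) (Φ : 𝓢(EuclideanSpace ℝ (Fin (d + 1)), ℂ)) :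
    𝓢(EuclideanSpace ℝ (Fin d), ℂ) :=
  SchwartzMap.compCLMOfAntilipschitz ℂ (joinLast_temperate t) (joinLast_isometry t).antilipschitz Φ

/-- `g = f(·, 0)` for tempered distributions `f` on `ℝ^{d+1}` and `g` on `ℝ^d`: in the last
variable, `f` is a (weakly) continuous function `t ↦ f(·, t) = F t` with values in the tempered
distributions on `ℝ^d`, that is, `⟨f, Φ⟩ = ∫ ⟨F t, Φ(·, t)⟩ dt` for all Schwartz functions `Φ`
with bounded support in the last variable, and `g` is its value at `t = 0`. -/
def HasTrace {d : ℕ} (f : 𝓢'(EuclideanSpace ℝ (Fin (d + 1)), ℂ))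
    (g : 𝓢'(EuclideanSpace ℝ (Fin d), ℂ)) : Prop :=
  ∃ F : ℝ → 𝓢'(EuclideanSpace ℝ (Fin d), ℂ),
    (∀ φ : 𝓢(EuclideanSpace ℝ (Fin d), ℂ), Continuous fun t => F t φ) ∧
    (∀ Φ : 𝓢(EuclideanSpace ℝ (Fin (d + 1)), ℂ),
      (∃ R : ℝ, ∀ x, R < |x (Fin.last d)| → Φ x = 0) → f Φ = ∫ t, F t (slice t Φ)) ∧
    F 0 = g

/-- `G` is the tensor product `a(x_n) g(x̄)` of the integrable function `a : ℝ → ℂ` and the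
tempered distribution `g` on `ℝ^d`. -/
def IsTensor {d : ℕ} (G : 𝓢'(EuclideanSpace ℝ (Fin (d + 1)), ℂ)) (a : ℝ → ℂ)
    (g : 𝓢'(EuclideanSpace ℝ (Fin d), ℂ)) : Prop :=
  ∀ Φ : 𝓢(EuclideanSpace ℝ (Fin (d + 1)), ℂ), G Φ = ∫ t, a t * g (slice t Φ)

/-- The one-dimensional inverse Fourier transform `(2π)^{-1/2} ∫ θ(ξ) e^{i t ξ} dξ`. -/
def invFourier (θ : ℝ → ℝ) (t : ℝ) : ℂ :=
  ((Real.sqrt (2 * Real.pi))⁻¹ : ℂ) * ∫ ξ : ℝ, Complex.exp (Complex.I * t * ξ) * (θ ξ : ℂ)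

/-! ### Retractions -/

/-- Boundedness (equivalently, continuity) of a linear map between quasi-normed spaces. -/
def IsQuasiBounded {X Y : Type*} [AddCommGroup X] [Module ℂ X] [AddCommGroup Y] [Module ℂ Y]
    (NX : X → ℝ≥0∞) (NY : Y → ℝ≥0∞) (T : X →ₗ[ℂ] Y) : Prop :=
  ∃ C : ℝ≥0, ∀ x, NY (T x) ≤ C * NX x

/-- `T` is a retraction from `X` onto `Y`: it is bounded and has a bounded linear right inverse. -/
def IsRetraction {X Y : Type*} [AddCommGroup X] [Module ℂ X] [AddCommGroup Y] [Module ℂ Y]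
    (NX : X → ℝ≥0∞) (NY : Y → ℝ≥0∞) (T : X →ₗ[ℂ] Y) : Prop :=
  IsQuasiBounded NX NY T ∧
    ∃ E : Y →ₗ[ℂ] X, IsQuasiBounded NY NX E ∧ ∀ y, T (E y) = y

end

/-! Each `□_k f` has its frequencies in a cube of fixed size about k, so it is reproduced by
convolution with a kernel whose modulus does not depend on k. If its L^p quasi-norm is finite, it is
a continuous function h_k, bounded pointwise by the weighted averages `wAvg L` of |h_k| with
constants uniform in k. For every p > 0 the p-th power of such an average is controlled by an
average of |h_k|^p; for p ≤ 1 this is the Peetre and Strömberg–Torchinsky device of splitting off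
the power 1 - p of the average itself. Integrating over a hyperplane costs only a constant, because
the weight remains integrable after the last coordinate is dropped. Hence restricting h_k to the
height t is bounded in L^p uniformly in k and t (`exists_wAvg_eLpNorm_le`,
`exists_localized_bounds`).

The trace is the sum of the slices h_k(·, 0). A slice has its frequencies near k̄, so its pairing
with a fixed Schwartz function decays like any prescribed power of k̄, which beats the weight and
the lattice sum. In k_n, summability comes from the embedding of ℓ^r in ℓ^1 for r = p ∧ q ∧ 1. All
bounds are uniform in t, so the slices at all heights form a weakly continuous family, and Fubini's
theorem recovers f from it (`Pieces.exists_family`). Tensor product test functions show that the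
family is unique (`hasTrace_unique`).

For the norm estimate, `□_l` of the trace involves only those k whose k̄ is within 2 of l in each
coordinate, with k_n arbitrary. The sum over k_n is handled by the r-triangle inequality, first in
L^p and then in ℓ^q; this uses r ≤ 1, r ≤ p and r ≤ q (`exists_modNorm_trace_le`).

In the other direction, `□_(k,j)` of a tensor product a ⊗ g is the tensor product of the j-th piece
of a with `□_k g`. If a is band-limited, only finitely many j contribute and the anisotropic norm is
at most a constant times the norm of g (`exists_anisoNorm_tensor_le`); the condition a(0) = 1 makes
tensoring a right inverse.

One technical point precedes all this. `distLp` admits any representing function, about which only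
convergence of its integrals against Schwartz functions is known. `exists_reproducing` replaces it
by a continuous function of polynomial growth that obeys the reproducing formula. -/

namespace ModTrace

/-! ### Polynomial weights and Peetre's inequality -/

section Weights

variable {V : Type*} [NormedAddCommGroup V]

/-- The inhomogeneous weight `1 + ‖x‖`. -/
noncomputable def jb (x : V) : ℝ≥0∞ := ENNReal.ofReal (1 + ‖x‖)

lemma one_le_jb (x : V) : 1 ≤ jb x := by
  rw [jb, ENNReal.one_le_ofReal]; linarith [norm_nonneg x]

lemma jb_ne_top (x : V) : jb x ≠ ⊤ := ENNReal.ofReal_ne_top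

lemma jb_ne_zero (x : V) : jb x ≠ 0 := (zero_lt_one.trans_le (one_le_jb x)).ne'

lemma jb_add_le (x y : V) : jb (x + y) ≤ jb x * jb y := by
  rw [jb, jb, jb, ← ENNReal.ofReal_mul (by positivity)]
  refine ENNReal.ofReal_le_ofReal ?_
  nlinarith [norm_add_le x y, mul_nonneg (norm_nonneg x) (norm_nonneg y)]

lemma jb_neg (x : V) : jb (-x) = jb x := by simp [jb]

lemma jb_sub_comm (x y : V) : jb (x - y) = jb (y - x) := by rw [← jb_neg, neg_sub]

lemma jb_rpow_ne_top (x : V) (r : ℝ) : jb x ^ r ≠ ⊤ := by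
  simp [ENNReal.rpow_eq_top_iff, jb_ne_top, jb_ne_zero]

lemma jb_rpow_ne_zero (x : V) (r : ℝ) : jb x ^ r ≠ 0 := by
  simp [ENNReal.rpow_eq_zero_iff, jb_ne_top, jb_ne_zero]

lemma jb_rpow_neg_le_one (x : V) {L : ℝ} (hL : 0 ≤ L) : jb x ^ (-L) ≤ 1 :=
  (ENNReal.rpow_le_rpow_of_exponent_le (one_le_jb x) (neg_nonpos.2 hL)).trans (by simp)

lemma jb_rpow_neg_anti (x : V) {L M : ℝ} (h : L ≤ M) : jb x ^ (-M) ≤ jb x ^ (-L) :=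
  ENNReal.rpow_le_rpow_of_exponent_le (one_le_jb x) (neg_le_neg h)

/-- Submultiplicativity of the decaying weights. -/
lemma jb_rpow_neg_mul_le (x y z : V) {L : ℝ} (hL : 0 ≤ L) :
    jb (x - y) ^ (-L) * jb (y - z) ^ (-L) ≤ jb (x - z) ^ (-L) := by
  rw [← ENNReal.mul_rpow_of_ne_top (jb_ne_top _) (jb_ne_top _), ENNReal.rpow_neg, ENNReal.rpow_neg]
  refine ENNReal.inv_le_inv.2 (ENNReal.rpow_le_rpow ?_ hL)
  simpa using jb_add_le (x - y) (y - z)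

/-- Peetre's inequality. -/
lemma jb_rpow_neg_le (x y z : V) {L : ℝ} (hL : 0 ≤ L) :
    jb (y - z) ^ (-L) ≤ jb (x - y) ^ L * jb (x - z) ^ (-L) := by
  have h := jb_rpow_neg_mul_le x y z hL
  calc jb (y - z) ^ (-L) = jb (x - y) ^ L * (jb (x - y) ^ (-L) * jb (y - z) ^ (-L)) := by
        rw [← mul_assoc, ← ENNReal.rpow_add _ _ (jb_ne_zero _) (jb_ne_top _)]; simp
    _ ≤ _ := by gcongr

@[fun_prop]
lemma measurable_jb [MeasurableSpace V] [BorelSpace V] : Measurable (jb : V → ℝ≥0∞) := by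
  unfold jb; fun_prop

end Weights

/-! ### Weighted averages and their p-th powers -/

section Averages

variable {V : Type*} [NormedAddCommGroup V] [NormedSpace ℝ V] [FiniteDimensional ℝ V]
  [MeasureSpace V] [BorelSpace V] [(volume : Measure V).IsAddHaarMeasure]

/-- The average of `H` against the weight `(1 + ‖x - y‖) ^ (-L)`. -/
noncomputable def wAvg (L : ℝ) (H : V → ℝ≥0∞) (x : V) : ℝ≥0∞ := ∫⁻ y, jb (x - y) ^ (-L) * H y

lemma lintegral_jb_lt_top {L : ℝ} (hL : Module.finrank ℝ V < L) :
    ∫⁻ x : V, jb x ^ (-L) < ⊤ := by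
  have := finite_integral_one_add_norm (E := V) (μ := volume) hL
  refine lt_of_le_of_lt (lintegral_mono fun x => ?_) this
  rw [jb, ENNReal.ofReal_rpow_of_pos (by positivity)]

lemma lintegral_jb_sub (L : ℝ) (x : V) :
    ∫⁻ y : V, jb (x - y) ^ (-L) = ∫⁻ y : V, jb y ^ (-L) := by
  exact lintegral_sub_left_eq_self (fun y => jb y ^ (-L)) x

/-- Peetre's inequality under the integral sign. It lets the average play the role of a Peetre
maximal function. -/
lemma wAvg_le_mul (L : ℝ) (hL : 0 ≤ L) (H : V → ℝ≥0∞) (x y : V) :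
    wAvg L H y ≤ jb (x - y) ^ L * wAvg L H x := by
  unfold wAvg
  rw [← lintegral_const_mul' _ _ (jb_rpow_ne_top _ _)]
  refine lintegral_mono fun z => ?_
  rw [← mul_assoc]
  gcongr
  exact jb_rpow_neg_le x y z hL

/-- The a priori finiteness needed to divide by a power of the average in the case p ≤ 1. -/
lemma wAvg_lt_top_of_growth {L N : ℝ} (hN : 0 ≤ N) (hL : Module.finrank ℝ V + N < L)
    {H : V → ℝ≥0∞} {C : ℝ≥0∞} (hC : C ≠ ⊤) (hH : ∀ x, H x ≤ C * jb x ^ N) (x : V) :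
    wAvg L H x < ⊤ := by
  have key : ∀ y, jb (x - y) ^ (-L) * H y ≤ (C * jb x ^ N) * jb (x - y) ^ (-(L - N)) := by
    intro y
    have h1 : jb y ≤ jb x * jb (x - y) := by
      have := jb_add_le x (-(x - y))
      rwa [jb_neg, neg_sub, add_sub_cancel] at this
    calc jb (x - y) ^ (-L) * H y ≤ jb (x - y) ^ (-L) * (C * (jb x * jb (x - y)) ^ N) := by
          gcongr
          exact (hH y).trans (by gcongr)
      _ = _ := by
          rw [ENNReal.mul_rpow_of_nonneg _ _ hN, show -(L - N) = -L + N by ring,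
            ENNReal.rpow_add _ _ (jb_ne_zero _) (jb_ne_top _)]
          ring
  refine (lintegral_mono key).trans_lt ?_
  rw [lintegral_const_mul' _ _ (ENNReal.mul_ne_top hC (jb_rpow_ne_top _ _)), lintegral_jb_sub]
  exact ENNReal.mul_lt_top (ENNReal.mul_lt_top hC.lt_top (jb_rpow_ne_top _ _).lt_top)
    (lintegral_jb_lt_top (by linarith))

/-- By the self-bound on `H` and Peetre's inequality, the integrand of the average at x is at most
`A * wAvg L H x` everywhere. Writing the integrand as its power 1 - p times its power p, the first
factor leaves the integral and is divided out; this is where the average must be finite. -/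
lemma wAvg_rpow_le_of_le_one {p : ℝ} (hp : 0 < p) (hp1 : p ≤ 1) {L : ℝ} (hL : 0 ≤ L)
    {A : ℝ≥0∞} (hA : A ≠ ⊤) {H : V → ℝ≥0∞} (hH : ∀ y, H y ≤ A * wAvg L H y) (x : V)
    (hx : wAvg L H x ≠ ⊤) :
    wAvg L H x ^ p ≤ A ^ (1 - p) * ∫⁻ y, jb (x - y) ^ (-(L * p)) * H y ^ p := by
  have h1p : 0 ≤ 1 - p := by linarith
  have h1 : ∀ y, jb (x - y) ^ (-L) * H y ≤ A * wAvg L H x := by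
    intro y
    calc jb (x - y) ^ (-L) * H y
        ≤ jb (x - y) ^ (-L) * (A * (jb (x - y) ^ L * wAvg L H x)) := by
          gcongr; exact (hH y).trans (by gcongr; exact wAvg_le_mul L hL H x y)
      _ = (jb (x - y) ^ (-L) * jb (x - y) ^ L) * (A * wAvg L H x) := by ring
      _ = _ := by rw [← ENNReal.rpow_add _ _ (jb_ne_zero _) (jb_ne_top _)]; simp
  have h2 : wAvg L H x ≤
      (A * wAvg L H x) ^ (1 - p) * ∫⁻ y, jb (x - y) ^ (-(L * p)) * H y ^ p := by
    rw [← lintegral_const_mul' _ _ (ENNReal.rpow_ne_top_of_nonneg h1p (ENNReal.mul_ne_top hA hx))]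
    conv_lhs => rw [wAvg]
    refine lintegral_mono fun y => ?_
    calc jb (x - y) ^ (-L) * H y
        = (jb (x - y) ^ (-L) * H y) ^ (1 - p) * (jb (x - y) ^ (-L) * H y) ^ p := by
          rw [← ENNReal.rpow_add_of_nonneg _ _ h1p hp.le]; simp
      _ ≤ (A * wAvg L H x) ^ (1 - p) * (jb (x - y) ^ (-(L * p)) * H y ^ p) := by
          rw [ENNReal.mul_rpow_of_nonneg (jb (x - y) ^ (-L)) _ hp.le, ← ENNReal.rpow_mul, neg_mul]
          exact mul_le_mul_left (ENNReal.rpow_le_rpow (h1 y) h1p) _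
  rcases eq_or_ne (wAvg L H x) 0 with h0 | h0
  · rw [h0, ENNReal.zero_rpow_of_pos hp]; exact zero_le
  rw [ENNReal.mul_rpow_of_nonneg _ _ h1p, mul_comm (A ^ _), mul_assoc] at h2
  have h3 : wAvg L H x ^ (1 - p) * wAvg L H x ^ p = wAvg L H x := by
    rw [← ENNReal.rpow_add_of_nonneg _ _ h1p hp.le]; simp
  rw [← ENNReal.mul_le_mul_iff_right (a := wAvg L H x ^ (1 - p)), h3]
  · exact h2
  · simp [h0, hx]
  · simp [hx, h1p.not_gt, h0]

/-- Hölder's inequality with the weight distributed over the two conjugate exponents. -/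
lemma wAvg_rpow_le_of_one_le {p : ℝ} (hp1 : 1 ≤ p) (L : ℝ) {H : V → ℝ≥0∞} (hm : Measurable H)
    (x : V) :
    wAvg L H x ^ p ≤ (∫⁻ y : V, jb y ^ (-L)) ^ (p - 1) * ∫⁻ y, jb (x - y) ^ (-L) * H y ^ p := by
  rcases hp1.eq_or_lt with rfl | hp
  · simp [wAvg]
  have hpq := Real.HolderConjugate.conjExponent hp
  set q := p.conjExponent with hq
  have hmj : Measurable fun y => jb (x - y) := measurable_jb.comp (by fun_prop)
  have h := ENNReal.lintegral_mul_le_Lp_mul_Lq volume hpq.symm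
    (f := fun y => (jb (x - y) ^ (-L)) ^ (1 / q)) (g := fun y => (jb (x - y) ^ (-L)) ^ (1 / p) * H y)
    (((hmj.pow_const _).pow_const _).aemeasurable)
    (((hmj.pow_const _).pow_const _).mul hm).aemeasurable
  have e1 : (∫⁻ y, ((fun y => (jb (x - y) ^ (-L)) ^ (1 / q)) *
      fun y => (jb (x - y) ^ (-L)) ^ (1 / p) * H y) y) = wAvg L H x := by
    refine lintegral_congr fun y => ?_
    simp only [Pi.mul_apply]
    rw [← mul_assoc, ← ENNReal.rpow_add _ _ (jb_rpow_ne_zero _ _) (jb_rpow_ne_top _ _)]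
    have : 1 / q + 1 / p = 1 := by simpa [one_div] using hpq.symm.inv_add_inv_eq_one
    rw [this, ENNReal.rpow_one]
  have e2 : (∫⁻ y, ((jb (x - y) ^ (-L)) ^ (1 / q)) ^ q) = ∫⁻ y : V, jb y ^ (-L) := by
    rw [← lintegral_jb_sub L x]
    refine lintegral_congr fun y => ?_
    rw [← ENNReal.rpow_mul, one_div, inv_mul_cancel₀ hpq.symm.ne_zero, ENNReal.rpow_one]
  have e3 : (∫⁻ y, ((jb (x - y) ^ (-L)) ^ (1 / p) * H y) ^ p) =
      ∫⁻ y, jb (x - y) ^ (-L) * H y ^ p := by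
    refine lintegral_congr fun y => ?_
    rw [ENNReal.mul_rpow_of_nonneg _ _ hpq.nonneg, ← ENNReal.rpow_mul, one_div,
      inv_mul_cancel₀ hpq.ne_zero, ENNReal.rpow_one]
  rw [e1, e2, e3] at h
  refine (ENNReal.rpow_le_rpow h hpq.nonneg).trans (le_of_eq ?_)
  rw [ENNReal.mul_rpow_of_nonneg _ _ hpq.nonneg, ← ENNReal.rpow_mul, ← ENNReal.rpow_mul]
  congr 2
  · have := hpq.div_conj_eq_sub_one
    rw [← this]; ring
  · rw [one_div, inv_mul_cancel₀ hpq.ne_zero, ENNReal.rpow_one]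

/-- Pointwise control of weighted averages by `p`-th power averages, for all `0 < p < ∞`. -/
lemma exists_wAvg_rpow_le {p : ℝ} (hp : 0 < p) {D L : ℝ} (hD : Module.finrank ℝ V < D)
    (hDL : D ≤ L) (hDLp : D ≤ L * p) (A : ℝ≥0) :
    ∃ C : ℝ≥0, ∀ H : V → ℝ≥0∞, Measurable H → (∀ y, H y ≤ A * wAvg L H y) →
      (∀ x, wAvg L H x ≠ ⊤) →
      ∀ x, wAvg L H x ^ p ≤ C * ∫⁻ y, jb (x - y) ^ (-D) * H y ^ p := by
  have hL0 : 0 ≤ L := (Nat.cast_nonneg _).trans (hD.le.trans hDL)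
  rcases le_total p 1 with hp1 | hp1
  · have hfin : (A : ℝ≥0∞) ^ (1 - p) ≠ ⊤ :=
      ENNReal.rpow_ne_top_of_nonneg (by linarith) ENNReal.coe_ne_top
    refine ⟨((A : ℝ≥0∞) ^ (1 - p)).toNNReal, fun H _ hH hx x => ?_⟩
    rw [ENNReal.coe_toNNReal hfin]
    refine (wAvg_rpow_le_of_le_one hp hp1 hL0 ENNReal.coe_ne_top hH x (hx x)).trans ?_
    exact mul_le_mul_right (lintegral_mono fun y => mul_le_mul_left (jb_rpow_neg_anti _ hDLp) _) _
  · have hfin : (∫⁻ y : V, jb y ^ (-L)) ^ (p - 1) ≠ ⊤ :=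
      ENNReal.rpow_ne_top_of_nonneg (by linarith) (lintegral_jb_lt_top (hD.trans_le hDL)).ne
    refine ⟨((∫⁻ y : V, jb y ^ (-L)) ^ (p - 1)).toNNReal, fun H hm _ _ x => ?_⟩
    rw [ENNReal.coe_toNNReal hfin]
    refine (wAvg_rpow_le_of_one_le hp1 L hm x).trans ?_
    exact mul_le_mul_right (lintegral_mono fun y => mul_le_mul_left (jb_rpow_neg_anti _ hDL) _) _

/-- `H` has at most polynomial growth. -/
def Tempered (H : V → ℝ≥0∞) : Prop :=
  ∃ (C : ℝ≥0) (N : ℕ), ∀ x, H x ≤ C * jb x ^ (N : ℝ)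

/-- The decay `L` used here depends on the growth order of `H`, so the bound `B` is only
qualitative. It serves to replace that growth order by 0 afterwards, which makes the later constants
uniform. -/
lemma bounded_of_lintegral_rpow {p : ℝ} (hp : 0 < p) {A : ℕ → ℝ≥0} {H : V → ℝ≥0∞}
    (hm : Measurable H) (ht : Tempered H) (hH : ∀ (L : ℕ) y, H y ≤ A L * wAvg L H y)
    (hfin : ∫⁻ y, H y ^ p ≠ ⊤) : ∃ B : ℝ≥0, ∀ y, H y ≤ B := by
  obtain ⟨C₀, N, hN⟩ := ht
  set D : ℝ := Module.finrank ℝ V + 1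
  -- `L ≥ D` and `L * p ≥ D` serve the power estimate; `L > dim + N` makes the average of a function
  -- of growth order `N` finite.
  obtain ⟨L, hL⟩ := exists_nat_gt (max (max D (D / p)) (Module.finrank ℝ V + N))
  simp only [max_lt_iff] at hL
  have hw : ∀ x, wAvg L H x ≠ ⊤ := fun x =>
    (wAvg_lt_top_of_growth (Nat.cast_nonneg N) hL.2 ENNReal.coe_ne_top hN x).ne
  obtain ⟨C, hC⟩ := exists_wAvg_rpow_le (V := V) hp (lt_add_one _) hL.1.1.le
    ((div_le_iff₀ hp).1 hL.1.2.le) (A L)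
  have hB : A L * (C * ∫⁻ y, H y ^ p) ^ (1 / p) ≠ ⊤ :=
    ENNReal.mul_ne_top ENNReal.coe_ne_top (ENNReal.rpow_ne_top_of_nonneg (by positivity)
      (ENNReal.mul_ne_top ENNReal.coe_ne_top hfin))
  refine ⟨(A L * (C * ∫⁻ y, H y ^ p) ^ (1 / p)).toNNReal, fun x => ?_⟩
  rw [ENNReal.coe_toNNReal hB]
  refine (hH L x).trans ?_
  gcongr
  rw [one_div, ENNReal.le_rpow_inv_iff hp]
  refine (hC H hm (hH L) hw x).trans ?_
  gcongr with y
  calc _ ≤ 1 * H y ^ p := by gcongr; exact jb_rpow_neg_le_one _ (by positivity)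
    _ = _ := one_mul _

end Averages

/-! ### Coordinates on hyperplanes and averages on slices -/

section Slices

variable {d : ℕ}

/-- The first `d` coordinates of a point of `ℝ^{d+1}`. -/
noncomputable def initE (y : EuclideanSpace ℝ (Fin (d + 1))) : EuclideanSpace ℝ (Fin d) :=
  WithLp.toLp 2 fun i => y i.castSucc

@[simp] lemma initE_apply (y : EuclideanSpace ℝ (Fin (d + 1))) (i : Fin d) :
    initE y i = y i.castSucc := rfl

@[simp] lemma joinLast_castSucc (t : ℝ) (x : EuclideanSpace ℝ (Fin d)) (i : Fin d) :
    joinLast t x i.castSucc = x i := by simp [joinLast]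

@[simp] lemma joinLast_last (t : ℝ) (x : EuclideanSpace ℝ (Fin d)) :
    joinLast t x (Fin.last d) = t := by simp [joinLast]

@[simp] lemma initE_joinLast (t : ℝ) (x : EuclideanSpace ℝ (Fin d)) : initE (joinLast t x) = x := by
  ext i; simp

@[simp] lemma joinLast_initE (y : EuclideanSpace ℝ (Fin (d + 1))) :
    joinLast (y (Fin.last d)) (initE y) = y := by
  ext i; refine Fin.lastCases ?_ (fun j => ?_) i <;> simp

lemma norm_initE_le (y : EuclideanSpace ℝ (Fin (d + 1))) : ‖initE y‖ ≤ ‖y‖ := by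
  rw [EuclideanSpace.norm_eq, EuclideanSpace.norm_eq, Fin.sum_univ_castSucc]
  exact Real.sqrt_le_sqrt (by simp only [initE_apply]; linarith [sq_nonneg ‖y (Fin.last d)‖])

lemma initE_sub (x y : EuclideanSpace ℝ (Fin (d + 1))) : initE (x - y) = initE x - initE y := by
  ext i; simp

lemma jb_initE_le (y : EuclideanSpace ℝ (Fin (d + 1))) : jb (initE y) ≤ jb y :=
  ENNReal.ofReal_le_ofReal (by linarith [norm_initE_le y])

@[fun_prop] lemma continuous_joinLast :
    Continuous fun z : ℝ × EuclideanSpace ℝ (Fin d) => joinLast z.1 z.2 := by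
  unfold joinLast
  refine (PiLp.continuous_toLp 2 _).comp (continuous_pi fun i => ?_)
  refine Fin.lastCases ?_ (fun j => ?_) i
  · simpa using continuous_fst
  · simpa using (by fun_prop : Continuous fun z : ℝ × EuclideanSpace ℝ (Fin d) => z.2 j)

@[fun_prop] lemma continuous_initE : Continuous (initE (d := d)) := by
  unfold initE
  exact (PiLp.continuous_toLp 2 _).comp (continuous_pi fun i => by fun_prop)

/-- Tonelli's theorem: for fixed y, dropping the last coordinate only increases the decaying weight,
and what remains is a translate of a fixed function on the hyperplane. -/
lemma lintegral_wAvg_slice_le (D : ℝ) (hD : 0 ≤ D) (G : EuclideanSpace ℝ (Fin (d + 1)) → ℝ≥0∞)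
    (hG : Measurable G) (t : ℝ) :
    ∫⁻ x : EuclideanSpace ℝ (Fin d), wAvg D G (joinLast t x) ≤
      (∫⁻ x : EuclideanSpace ℝ (Fin d), jb x ^ (-D)) * ∫⁻ y, G y := by
  unfold wAvg
  have hjoin : Measurable fun x : EuclideanSpace ℝ (Fin d) => joinLast t x :=
    (joinLast_isometry t).continuous.measurable
  rw [lintegral_lintegral_swap, ← lintegral_const_mul _ hG]
  · refine lintegral_mono fun y => ?_
    have hm : Measurable fun x : EuclideanSpace ℝ (Fin d) => jb (joinLast t x - y) ^ (-D) :=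
      (measurable_jb.comp (hjoin.sub_const y)).pow_const _
    change ∫⁻ x : EuclideanSpace ℝ (Fin d), jb (joinLast t x - y) ^ (-D) * G y ≤ _
    rw [lintegral_mul_const _ hm]
    gcongr ?_ * _
    rw [← lintegral_jb_sub D (initE y)]
    refine lintegral_mono fun x => ?_
    rw [ENNReal.rpow_neg, ENNReal.rpow_neg, jb_sub_comm (initE y)]
    refine ENNReal.inv_le_inv.2 (ENNReal.rpow_le_rpow ?_ hD)
    simpa [initE_sub] using jb_initE_le (joinLast t x - y)
  · refine Measurable.aemeasurable (Measurable.mul (Measurable.pow_const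
      (measurable_jb.comp (Measurable.sub ?_ measurable_snd)) _) (hG.comp measurable_snd))
    exact hjoin.comp measurable_fst

/-- The core of the trace estimate. `L` and `C` depend on the self-bound constants `A` only, not on
`H`, so they are the same for all frequency cubes. -/
lemma exists_wAvg_eLpNorm_le {p : ℝ≥0∞} (hp : 0 < p) (A : ℕ → ℝ≥0) :
    ∃ (L : ℕ) (C : ℝ≥0), ∀ H : EuclideanSpace ℝ (Fin (d + 1)) → ℝ≥0∞, Measurable H → Tempered H →
      (∀ (L : ℕ) y, H y ≤ A L * wAvg L H y) → eLpNorm H p volume ≠ ⊤ →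
      (∀ x, wAvg L H x ≤ C * eLpNorm H p volume) ∧
      ∀ t, eLpNorm (fun x => wAvg L H (joinLast t x)) p volume ≤ C * eLpNorm H p volume := by
  rcases eq_or_ne p ⊤ with rfl | hpt
  · set L : ℕ := Module.finrank ℝ (EuclideanSpace ℝ (Fin (d + 1))) + 1
    have hfin : ∫⁻ y : EuclideanSpace ℝ (Fin (d + 1)), jb y ^ (-(L : ℝ)) < ⊤ :=
      lintegral_jb_lt_top (by simp [L])
    refine ⟨L, (∫⁻ y : EuclideanSpace ℝ (Fin (d + 1)), jb y ^ (-(L : ℝ))).toNNReal,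
      fun H _ _ _ _ => ?_⟩
    rw [ENNReal.coe_toNNReal hfin.ne]
    have key : ∀ x, wAvg L H x ≤ (∫⁻ y : EuclideanSpace ℝ (Fin (d + 1)), jb y ^ (-(L : ℝ))) *
        eLpNorm H ⊤ volume := by
      intro x
      rw [← lintegral_jb_sub _ x, ← lintegral_mul_const]
      · refine lintegral_mono_ae ?_
        filter_upwards [enorm_ae_le_eLpNormEssSup H volume] with y hy
        rw [eLpNorm_exponent_top]
        exact mul_le_mul_right hy _
      · exact (measurable_jb.comp (by fun_prop)).pow_const _
    refine ⟨key, fun t => ?_⟩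
    rw [eLpNorm_exponent_top]
    exact essSup_le_of_ae_le _ (Filter.Eventually.of_forall fun x => key _)
  set P := p.toReal
  have hP : 0 < P := ENNReal.toReal_pos hp.ne' hpt
  set D : ℝ := Module.finrank ℝ (EuclideanSpace ℝ (Fin (d + 1))) + 1
  have hD0 : 0 ≤ D := by positivity
  obtain ⟨L, hL⟩ := exists_nat_gt (max (max D (D / P))
    (Module.finrank ℝ (EuclideanSpace ℝ (Fin (d + 1))) + (0 : ℕ)))
  simp only [max_lt_iff] at hL
  obtain ⟨C, hC⟩ := exists_wAvg_rpow_le (V := EuclideanSpace ℝ (Fin (d + 1))) hP (lt_add_one _)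
    hL.1.1.le ((div_le_iff₀ hP).1 hL.1.2.le) (A L)
  have hK : ∫⁻ x : EuclideanSpace ℝ (Fin d), jb x ^ (-D) < ⊤ :=
    lintegral_jb_lt_top (by simp [D]; linarith)
  obtain ⟨K, hK'⟩ : ∃ K : ℝ≥0, (K : ℝ≥0∞) = ∫⁻ x : EuclideanSpace ℝ (Fin d), jb x ^ (-D) :=
    ⟨_, ENNReal.coe_toNNReal hK.ne⟩
  -- `C` serves the pointwise bound and `C * K` the slice bound; both are proved for P-th powers.
  set C' : ℝ≥0 := (max C (C * K)) ^ (1 / P)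
  have hC' : (C' : ℝ≥0∞) ^ P = max (C : ℝ≥0∞) (C * K) := by
    rw [← ENNReal.coe_rpow_of_nonneg _ hP.le, ← NNReal.rpow_mul, one_div, inv_mul_cancel₀ hP.ne']
    simp
  have hnorm : ∀ {E : Type} [MeasureSpace E] (H : E → ℝ≥0∞),
      eLpNorm H p volume ^ P = ∫⁻ y, H y ^ P := by
    intro E _ H
    rw [eLpNorm_eq_lintegral_rpow_enorm_toReal hp.ne' hpt, one_div, ENNReal.rpow_inv_rpow hP.ne']
    simp [P]
  refine ⟨L, C', fun H hm ht hH hfin => ?_⟩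
  have hfin' : ∫⁻ y, H y ^ P ≠ ⊤ := by
    rw [← hnorm]; exact ENNReal.rpow_ne_top_of_nonneg hP.le hfin
  -- Boundedness allows growth order 0 in the finiteness of the averages, so the `L` fixed above
  -- works for every `H`.
  obtain ⟨B, hB⟩ := bounded_of_lintegral_rpow hP hm ht hH hfin'
  have hw : ∀ x, wAvg L H x ≠ ⊤ := fun x =>
    (wAvg_lt_top_of_growth (N := (0 : ℕ)) (by simp) hL.2 (ENNReal.coe_ne_top (r := B))
      (by simpa using hB) x).ne
  have hpt' := hC H hm (hH L) hw
  refine ⟨fun x => ?_, fun t => ?_⟩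
  · rw [← ENNReal.rpow_le_rpow_iff hP, ENNReal.mul_rpow_of_nonneg _ _ hP.le, hnorm, hC']
    refine (hpt' x).trans (mul_le_mul' (le_max_left _ _) (lintegral_mono fun y => ?_))
    exact (mul_le_mul_left (jb_rpow_neg_le_one _ hD0) _).trans (one_mul _).le
  · rw [← ENNReal.rpow_le_rpow_iff hP, ENNReal.mul_rpow_of_nonneg _ _ hP.le, hnorm, hnorm, hC']
    calc _ ≤ ∫⁻ x : EuclideanSpace ℝ (Fin d), C * wAvg D (fun y => H y ^ P) (joinLast t x) :=
          lintegral_mono fun x => hpt' _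
      _ ≤ C * (K * ∫⁻ y, H y ^ P) := by
          rw [lintegral_const_mul' _ _ ENNReal.coe_ne_top, hK']
          gcongr
          exact lintegral_wAvg_slice_le D hD0 _ (hm.pow_const _) t
      _ ≤ _ := by
          rw [← mul_assoc]
          gcongr
          exact le_max_right _ _

end Slices

/-! ### Fourier multipliers as convolutions -/

section Kernels

open FourierTransform

variable {V : Type*} [NormedAddCommGroup V] [InnerProductSpace ℝ V] [FiniteDimensional ℝ V]
  [MeasurableSpace V] [BorelSpace V]

/-- The transpose `Φ ↦ 𝓕 (m · 𝓕⁻¹ Φ)` of the Fourier multiplier with symbol `m`. -/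
noncomputable def dualMul (m : V → ℂ) : 𝓢(V, ℂ) →L[ℂ] 𝓢(V, ℂ) :=
  fourierCLM ℂ 𝓢(V, ℂ) ∘L SchwartzMap.smulLeftCLM ℂ m ∘L fourierInvCLM ℂ 𝓢(V, ℂ)

lemma dualMul_eq (m : V → ℂ) (Φ : 𝓢(V, ℂ)) :
    dualMul m Φ = 𝓕 (SchwartzMap.smulLeftCLM ℂ m (𝓕⁻ Φ)) := rfl

lemma dualMul_dualMul {m₁ m₂ : V → ℂ} (h₁ : m₁.HasTemperateGrowth) (h₂ : m₂.HasTemperateGrowth)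
    (Φ : 𝓢(V, ℂ)) : dualMul m₁ (dualMul m₂ Φ) = dualMul (m₁ * m₂) Φ := by
  simp [dualMul_eq, SchwartzMap.smulLeftCLM_smulLeftCLM_apply h₁ h₂]

lemma fourierInv_fourierInv_apply (Φ : 𝓢(V, ℂ)) (x : V) : 𝓕⁻ (𝓕⁻ Φ) x = Φ (-x) := by
  rw [SchwartzMap.fourierInv_coe, Real.fourierInv_eq_fourier_neg, ← SchwartzMap.fourier_coe,
    FourierTransform.fourier_fourierInv_eq]

/-- The convolution kernel of the Fourier multiplier with symbol `M`. -/
noncomputable def symKernel (M : 𝓢(V, ℂ)) : 𝓢(V, ℂ) := 𝓕⁻ M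

/-- The transposed multiplier is a convolution with the reflected kernel. -/
lemma dualMul_apply (M Φ : 𝓢(V, ℂ)) (y : V) :
    dualMul M Φ y = ∫ x, symKernel M (x - y) * Φ x := by
  rw [symKernel]
  have h1 : dualMul M Φ y = 𝓕⁻ (SchwartzMap.smulLeftCLM ℂ M (𝓕⁻ Φ)) (-y) := by
    rw [dualMul_eq, SchwartzMap.fourier_coe, SchwartzMap.fourierInv_coe,
      Real.fourierInv_eq_fourier_neg, neg_neg]
  have h2 : 𝓕⁻ (SchwartzMap.smulLeftCLM ℂ M (𝓕⁻ Φ)) =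
      SchwartzMap.convolution (ContinuousLinearMap.mul ℂ ℂ) (𝓕⁻ M) (𝓕⁻ (𝓕⁻ Φ)) := by
    apply (fourierEquiv ℂ 𝓢(V, ℂ) (F := 𝓢(V, ℂ))).injective
    simp only [fourierEquiv_apply, SchwartzMap.fourier_convolution,
      FourierTransform.fourier_fourierInv_eq]
    ext x
    simp [SchwartzMap.smulLeftCLM_apply_apply M.hasTemperateGrowth]
  rw [h1, h2, SchwartzMap.convolution_apply, convolution_def]
  simp only [ContinuousLinearMap.mul_apply', fourierInv_fourierInv_apply]
  rw [← integral_sub_right_eq_self _ y]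
  refine integral_congr_ae (Filter.Eventually.of_forall fun x => ?_)
  simp only
  congr 2
  abel

lemma exists_enorm_le_jb (K : 𝓢(V, ℂ)) (L : ℕ) :
    ∃ C : ℝ≥0, ∀ x, ‖K x‖ₑ ≤ C * jb x ^ (-(L : ℝ)) := by
  set S := 2 ^ L * ((Finset.Iic (L, 0)).sup fun m => SchwartzMap.seminorm ℝ m.1 m.2) K
  refine ⟨S.toNNReal, fun x => ?_⟩
  have h := SchwartzMap.one_add_le_sup_seminorm_apply (𝕜 := ℝ) (m := (L, 0)) le_rfl le_rfl K x
  rw [norm_iteratedFDeriv_zero] at h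
  have hpos : 0 < (1 + ‖x‖) ^ L := by positivity
  have h2 : ‖K x‖ ≤ S * ((1 + ‖x‖) ^ L)⁻¹ := by
    rw [← div_eq_mul_inv, le_div_iff₀ hpos, mul_comm]; exact h
  have hS : 0 ≤ S := le_trans (by positivity) h
  rw [← ofReal_norm]
  refine (ENNReal.ofReal_le_ofReal h2).trans (le_of_eq ?_)
  rw [ENNReal.ofReal_mul hS, ENNReal.ofReal_inv_of_pos hpos, ENNReal.rpow_neg,
    ENNReal.rpow_natCast, jb, ENNReal.ofReal_pow (by positivity)]
  rfl

/-- The convolution `K * h`. -/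
noncomputable def kconv (K : 𝓢(V, ℂ)) (h : V → ℂ) (x : V) : ℂ := ∫ y, K (x - y) * h y

/-- Fubini's theorem for the convolution. Joint integrability is a hypothesis because it is obtained
in two ways: from polynomial growth of g, or from Schwartz majorants when no growth is known. -/
lemma integral_dualMul_eq_of_integrable {M Φ : 𝓢(V, ℂ)} {g : V → ℂ}
    (hI : Integrable (fun z : V × V => Φ z.1 * symKernel M (z.1 - z.2) * g z.2)
      (volume.prod volume)) :
    Integrable (fun x => Φ x * kconv (symKernel M) g x) ∧
      ∫ y, dualMul M Φ y * g y = ∫ x, Φ x * kconv (symKernel M) g x := by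
  have e1 : ∀ x, ∫ y, Φ x * symKernel M (x - y) * g y = Φ x * kconv (symKernel M) g x := by
    intro x
    rw [kconv, ← integral_const_mul]
    simp only [mul_assoc]
  have e2 : ∀ y, ∫ x, Φ x * symKernel M (x - y) * g y = dualMul M Φ y * g y := by
    intro y
    rw [dualMul_apply, ← integral_mul_const]
    refine integral_congr_ae (Filter.Eventually.of_forall fun x => ?_)
    simp only
    ring
  refine ⟨?_, ?_⟩
  · have := hI.integral_prod_left
    simpa only [e1] using this
  · simp only [← e1, ← e2]
    exact (integral_integral_swap hI).symm

lemma integrable_of_tempered {Φ : 𝓢(V, ℂ)} {h : V → ℂ} (hm : AEStronglyMeasurable h volume)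
    (ht : Tempered fun x => ‖h x‖ₑ) : Integrable fun x => Φ x * h x := by
  obtain ⟨C, N, hN⟩ := ht
  obtain ⟨C', hC'⟩ := exists_enorm_le_jb Φ (N + (Module.finrank ℝ V + 1))
  refine ⟨Φ.continuous.aestronglyMeasurable.mul hm, ?_⟩
  have hfin := lintegral_jb_lt_top (V := V) (L := (Module.finrank ℝ V + 1 : ℕ))
    (by push_cast; linarith)
  refine lt_of_le_of_lt (lintegral_mono (g := fun x => (C * C') *
    jb x ^ (-((Module.finrank ℝ V + 1 : ℕ) : ℝ))) fun x => ?_) ?_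
  · rw [enorm_mul]
    calc _ ≤ (C' * jb x ^ (-((N + (Module.finrank ℝ V + 1) : ℕ) : ℝ))) * (C * jb x ^ (N : ℝ)) :=
          mul_le_mul' (hC' x) (hN x)
      _ = C * C' * (jb x ^ (-((N + (Module.finrank ℝ V + 1) : ℕ) : ℝ)) * jb x ^ (N : ℝ)) := by ring
      _ = _ := by
          rw [← ENNReal.rpow_add _ _ (jb_ne_zero _) (jb_ne_top _)]
          congr 2
          push_cast; ring
  · rw [lintegral_const_mul' _ _ (by simp [ENNReal.mul_eq_top])]
    exact ENNReal.mul_lt_top (by simp [ENNReal.mul_lt_top]) hfin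

lemma integrable_prod_of_tempered {K Φ : 𝓢(V, ℂ)} {h : V → ℂ}
    (hm : AEStronglyMeasurable h volume) (ht : Tempered fun x => ‖h x‖ₑ) :
    Integrable (fun z : V × V => Φ z.1 * K (z.1 - z.2) * h z.2) (volume.prod volume) := by
  obtain ⟨C, N, hN⟩ := ht
  set D := Module.finrank ℝ V + 1
  obtain ⟨C₁, hC₁⟩ := exists_enorm_le_jb K (N + D)
  -- Peetre's inequality moves the decay of K from x - y to y at the price `jb x ^ (N + D)`; these
  -- extra orders of Φ pay for it and leave `jb x ^ (-D)`.
  obtain ⟨C₂, hC₂⟩ := exists_enorm_le_jb Φ (N + D + D)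
  have hfin := lintegral_jb_lt_top (V := V) (L := D) (by simp [D])
  have hmeas : AEStronglyMeasurable (fun z : V × V => Φ z.1 * K (z.1 - z.2) * h z.2)
      (volume.prod volume) :=
    (by fun_prop : Continuous fun z : V × V => Φ z.1 * K (z.1 - z.2)).aestronglyMeasurable.mul
      hm.comp_snd
  refine ⟨hmeas, lt_of_le_of_lt (lintegral_mono (g := fun z : V × V => (C * C₁ * C₂ * jb z.1 ^ (-(D : ℝ))) *
    jb z.2 ^ (-(D : ℝ))) fun z => ?_) ?_⟩
  · obtain ⟨x, y⟩ := z
    simp only [enorm_mul]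
    have h1 : jb (x - y) ^ (-((N + D : ℕ) : ℝ)) ≤
        jb x ^ ((N + D : ℕ) : ℝ) * jb y ^ (-((N + D : ℕ) : ℝ)) := by
      have := jb_rpow_neg_le (L := ((N + D : ℕ) : ℝ)) (0 : V) x y (by positivity)
      simpa [jb_neg] using this
    calc ‖Φ x‖ₑ * ‖K (x - y)‖ₑ * ‖h y‖ₑ
        ≤ (C₂ * jb x ^ (-((N + D + D : ℕ) : ℝ))) *
          (C₁ * (jb x ^ ((N + D : ℕ) : ℝ) * jb y ^ (-((N + D : ℕ) : ℝ)))) * (C * jb y ^ (N : ℝ)) := by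
          gcongr
          · exact hC₂ x
          · exact (hC₁ _).trans (by gcongr)
          · exact hN y
      _ = _ := by
          rw [show jb x ^ (-(D : ℝ)) = jb x ^ (-((N + D + D : ℕ) : ℝ)) * jb x ^ ((N + D : ℕ) : ℝ) by
              rw [← ENNReal.rpow_add _ _ (jb_ne_zero _) (jb_ne_top _)]; congr 1; push_cast; ring,
            show jb y ^ (-(D : ℝ)) = jb y ^ (-((N + D : ℕ) : ℝ)) * jb y ^ (N : ℝ) by
              rw [← ENNReal.rpow_add _ _ (jb_ne_zero _) (jb_ne_top _)]; congr 1; push_cast; ring]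
          ring
  · rw [lintegral_prod _ (by fun_prop)]
    simp only
    have : ∀ x : V, ∫⁻ y : V, (C * C₁ * C₂ * jb x ^ (-(D : ℝ))) * jb y ^ (-(D : ℝ)) =
        (C * C₁ * C₂ * ∫⁻ y : V, jb y ^ (-(D : ℝ))) * jb x ^ (-(D : ℝ)) := by
      intro x
      rw [lintegral_const_mul _ (by fun_prop)]
      ring
    rw [lintegral_congr this, lintegral_const_mul _ (by fun_prop)]
    exact ENNReal.mul_lt_top (ENNReal.mul_lt_top (by simp [ENNReal.mul_lt_top]) hfin) hfin

end Kernels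

/-! ### Bump functions, Schwartz majorants and factorized kernels -/

section Bumps

variable {V : Type*} [NormedAddCommGroup V] [InnerProductSpace ℝ V] [FiniteDimensional ℝ V]
  [MeasurableSpace V] [BorelSpace V]

/-- A real-valued smooth compactly supported function as a complex Schwartz function. -/
noncomputable def bumpSchwartz (b : V → ℝ) (hb : ContDiff ℝ ∞ b) (hc : HasCompactSupport b) :
    𝓢(V, ℂ) :=
  HasCompactSupport.toSchwartzMap (f := fun x => (b x : ℂ))
    (hc.comp_left (g := ((↑) : ℝ → ℂ)) Complex.ofReal_zero)
    (Complex.ofRealCLM.contDiff.comp hb)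

@[simp] lemma bumpSchwartz_apply (b : V → ℝ) (hb : ContDiff ℝ ∞ b) (hc : HasCompactSupport b)
    (x : V) : bumpSchwartz b hb hc x = (b x : ℂ) := rfl

lemma locallyIntegrable_of_forall_bump {g : V → ℂ}
    (h : ∀ b : V → ℝ, ContDiff ℝ ∞ b → HasCompactSupport b →
      Integrable fun x => (b x : ℂ) * g x) : LocallyIntegrable g := by
  intro x
  let b : ContDiffBump x := ⟨1, 2, one_pos, one_lt_two⟩
  refine ⟨Metric.ball x 1, Metric.ball_mem_nhds x one_pos, ?_⟩
  have h1 := (h b b.contDiff b.hasCompactSupport).integrableOn (s := Metric.ball x 1)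
  refine h1.congr_fun (fun y hy => ?_) measurableSet_ball
  simp [b.one_of_mem_closedBall (Metric.ball_subset_closedBall hy)]

/-- Writes a bump as a product of two bumps, the form required by `exists_majorant_of_mul`. -/
lemma exists_bump_eq_one {b : V → ℝ} (hc : HasCompactSupport b) :
    ∃ c : V → ℝ, ContDiff ℝ ∞ c ∧ HasCompactSupport c ∧ ∀ x, c x * b x = b x := by
  obtain ⟨R, hR⟩ := hc.isBounded.subset_closedBall (0 : V)
  let c : ContDiffBump (0 : V) :=
    ⟨max R 1, max R 1 + 1, lt_max_of_lt_right one_pos, lt_add_one _⟩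
  refine ⟨c, c.contDiff, c.hasCompactSupport, fun x => ?_⟩
  by_cases hx : x ∈ tsupport b
  · rw [c.one_of_mem_closedBall, one_mul]
    exact Metric.closedBall_subset_closedBall (le_max_left _ _) (hR hx)
  · rw [image_eq_zero_of_notMem_tsupport hx, mul_zero]

/-- The modulus of a Schwartz function need not be smooth, but |K₁|² + |K₂|² is Schwartz and
dominates |K₁ K₂|. -/
lemma exists_majorant_of_mul {K K₁ K₂ : 𝓢(V, ℂ)} (hK : ∀ x, K x = K₁ x * K₂ x) :
    ∃ W : 𝓢(V, ℂ), ∀ x, W x = (‖W x‖ : ℂ) ∧ ‖K x‖ ≤ ‖W x‖ := by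
  let conj : 𝓢(V, ℂ) → 𝓢(V, ℂ) := SchwartzMap.postcompCLM (Complex.conjCLE : ℂ →L[ℝ] ℂ)
  let W := SchwartzMap.smulLeftCLM ℂ K₁ (conj K₁) + SchwartzMap.smulLeftCLM ℂ K₂ (conj K₂)
  have hW : ∀ x, W x = ((‖K₁ x‖ ^ 2 + ‖K₂ x‖ ^ 2 : ℝ) : ℂ) := by
    intro x
    have : W x = K₁ x * (starRingEnd ℂ) (K₁ x) + K₂ x * (starRingEnd ℂ) (K₂ x) := by
      simp [W, conj, SchwartzMap.smulLeftCLM_apply_apply K₁.hasTemperateGrowth,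
        SchwartzMap.smulLeftCLM_apply_apply K₂.hasTemperateGrowth]
    rw [this, Complex.mul_conj, Complex.mul_conj, Complex.normSq_eq_norm_sq,
      Complex.normSq_eq_norm_sq]
    push_cast; ring
  have hn : ∀ x, ‖W x‖ = ‖K₁ x‖ ^ 2 + ‖K₂ x‖ ^ 2 := fun x => by
    rw [hW, Complex.norm_real, Real.norm_of_nonneg (by positivity)]
  refine ⟨W, fun x => ⟨by rw [hn, hW], ?_⟩⟩
  rw [hn, hK, norm_mul]
  nlinarith [sq_nonneg (‖K₁ x‖ - ‖K₂ x‖), sq_nonneg (‖K₁ x‖), sq_nonneg (‖K₂ x‖)]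

-- Nonnegative majorants turn the inner integral of the absolute value into a Schwartz function of
-- y, namely `dualMul (𝓕 W) U`, times |g(y)|. Integrability against Schwartz functions is then
-- enough for Fubini's theorem, without any growth bound on g.
open FourierTransform in
lemma integrable_prod_of_majorant {K Φ : 𝓢(V, ℂ)} {W U : 𝓢(V, ℂ)}
    (hW : ∀ x, W x = (‖W x‖ : ℂ) ∧ ‖K x‖ ≤ ‖W x‖) (hU : ∀ x, U x = (‖U x‖ : ℂ) ∧ ‖Φ x‖ ≤ ‖U x‖)
    {g : V → ℂ} (hm : AEStronglyMeasurable g volume)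
    (hg : ∀ Ψ : 𝓢(V, ℂ), Integrable fun x => Ψ x * g x) :
    Integrable (fun z : V × V => Φ z.1 * K (z.1 - z.2) * g z.2) (volume.prod volume) := by
  have hbig : Integrable (fun z : V × V => U z.1 * W (z.1 - z.2) * g z.2)
      (volume.prod volume) := by
    have hmeas : AEStronglyMeasurable (fun z : V × V => U z.1 * W (z.1 - z.2) * g z.2)
        (volume.prod volume) :=
      (by fun_prop : Continuous fun z : V × V => U z.1 * W (z.1 - z.2)).aestronglyMeasurable.mul
        hm.comp_snd
    rw [integrable_prod_iff' hmeas]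
    refine ⟨Filter.Eventually.of_forall fun y => ?_, ?_⟩
    · have ht : Tempered fun x => ‖W (x - y)‖ₑ := ?_
      · exact (integrable_of_tempered (Φ := U)
          (by fun_prop : Continuous fun x => W (x - y)).aestronglyMeasurable ht).mul_const (g y)
      obtain ⟨C, hC⟩ := exists_enorm_le_jb W 0
      exact ⟨C, 0, fun x => by simpa using hC (x - y)⟩
    · have hS := (hg (dualMul (𝓕 W : 𝓢(V, ℂ)) U)).norm
      refine hS.congr (Filter.Eventually.of_forall fun y => ?_)
      simp only [norm_mul]
      rw [integral_mul_const]
      congr 1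
      rw [dualMul_apply, symKernel, FourierTransform.fourierInv_fourier_eq]
      have : ∀ x, W (x - y) * U x = ((‖U x‖ * ‖W (x - y)‖ : ℝ) : ℂ) := fun x => by
        conv_lhs => rw [(hW (x - y)).1, (hU x).1]
        push_cast; ring
      simp only [this]
      rw [integral_complex_ofReal, Complex.norm_real, Real.norm_of_nonneg]
      exact integral_nonneg fun x => by positivity
  refine hbig.mono ?_ (Filter.Eventually.of_forall fun z => ?_)
  · exact (by fun_prop : Continuous fun z : V × V =>
      Φ z.1 * K (z.1 - z.2)).aestronglyMeasurable.mul hm.comp_snd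
  · simp only [norm_mul]
    gcongr
    · exact (hU _).2
    · exact (hW _).2

-- The symbol is the convolution of a bump equal to 1 on the ball of radius `R + 1` with a
-- normalized bump of radius 1. It is therefore 1 on the ball of radius `R`, and its kernel is the
-- product of the two kernels.
open FourierTransform in
lemma exists_factorized_symbol (R : ℝ) (hR : 0 < R) :
    ∃ M K₁ K₂ : 𝓢(V, ℂ), (∀ ξ, ‖ξ‖ ≤ R → M ξ = 1) ∧ ∀ x, symKernel M x = K₁ x * K₂ x := by
  let c : ContDiffBump (0 : V) := ⟨R + 1, R + 2, by linarith, by linarith⟩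
  let b : ContDiffBump (0 : V) := ⟨1 / 2, 1, by norm_num, by norm_num⟩
  let m₁ := bumpSchwartz c c.contDiff c.hasCompactSupport
  let m₂ := bumpSchwartz (b.normed volume) b.contDiff_normed b.hasCompactSupport_normed
  refine ⟨SchwartzMap.convolution (ContinuousLinearMap.mul ℂ ℂ) m₁ m₂, symKernel m₁, symKernel m₂,
    fun ξ hξ => ?_, fun x => ?_⟩
  · rw [SchwartzMap.convolution_apply, convolution_def]
    have : ∀ t, (ContinuousLinearMap.mul ℂ ℂ) (m₁ t) (m₂ (ξ - t)) =
        ((b.normed volume (ξ - t) : ℝ) : ℂ) := by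
      intro t
      simp only [ContinuousLinearMap.mul_apply', m₁, m₂, bumpSchwartz_apply]
      by_cases ht : ξ - t ∈ Function.support (b.normed volume)
      · rw [b.support_normed_eq, mem_ball_zero_iff] at ht
        rw [c.one_of_mem_closedBall, Complex.ofReal_one, one_mul]
        rw [mem_closedBall_zero_iff]
        have : ‖t‖ ≤ ‖ξ‖ + ‖ξ - t‖ := by
          have := norm_sub_le ξ (ξ - t)
          simpa using this
        have h1 : ‖ξ - t‖ < 1 := ht
        change ‖t‖ ≤ R + 1
        linarith
      · rw [Function.notMem_support.1 ht]; simp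
    simp only [this]
    rw [integral_complex_ofReal, integral_sub_left_eq_self (fun t => b.normed volume t) volume ξ,
      b.integral_normed, Complex.ofReal_one]
  · simp only [symKernel]
    have e : ∀ Ψ : 𝓢(V, ℂ), (𝓕⁻ Ψ : 𝓢(V, ℂ)) x = (𝓕 Ψ : 𝓢(V, ℂ)) (-x) := fun Ψ => by
      rw [SchwartzMap.fourierInv_coe, Real.fourierInv_eq_fourier_neg, SchwartzMap.fourier_coe]
    rw [e, e, e, SchwartzMap.fourier_convolution]
    simp

end Bumps

/-! ### Continuity and polynomial growth of convolutions -/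

section Continuity

variable {V : Type*} [NormedAddCommGroup V] [InnerProductSpace ℝ V] [FiniteDimensional ℝ V]
  [MeasurableSpace V] [BorelSpace V]

lemma continuous_kconv (K : 𝓢(V, ℂ)) {h : V → ℂ} (hm : AEStronglyMeasurable h volume)
    (ht : Tempered fun x => ‖h x‖ₑ) : Continuous (kconv K h) := by
  obtain ⟨C, N, hN⟩ := ht
  set D := Module.finrank ℝ V + 1
  obtain ⟨C₁, hC₁⟩ := exists_enorm_le_jb K (N + D)
  have hfin := lintegral_jb_lt_top (V := V) (L := D) (by simp [D])
  rw [continuous_iff_continuousAt]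
  intro x₀
  -- On the unit ball about x₀ the weight `jb x` is at most `2 * jb x₀`, so Peetre's inequality
  -- yields a dominating function independent of x.
  set B : ℝ≥0∞ := C₁ * (jb x₀ * ENNReal.ofReal 2) ^ ((N + D : ℕ) : ℝ) * C
  have hB : B ≠ ⊤ := by
    simp only [B]
    refine ENNReal.mul_ne_top (ENNReal.mul_ne_top (by simp) ?_) (by simp)
    exact ENNReal.rpow_ne_top_of_nonneg (by positivity)
      (ENNReal.mul_ne_top (jb_ne_top _) ENNReal.ofReal_ne_top)
  have hbound : ∀ x ∈ Metric.ball x₀ 1, ∀ y, ‖K (x - y) * h y‖ₑ ≤ B * jb y ^ (-(D : ℝ)) := by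
    intro x hx y
    have hx2 : jb x ≤ jb x₀ * ENNReal.ofReal 2 := by
      have h1 : jb (x - x₀) ≤ ENNReal.ofReal 2 := by
        refine ENNReal.ofReal_le_ofReal ?_
        rw [mem_ball_iff_norm] at hx; linarith
      calc jb x = jb (x₀ + (x - x₀)) := by simp
        _ ≤ _ := (jb_add_le _ _).trans (by gcongr)
    have h1 : jb (x - y) ^ (-((N + D : ℕ) : ℝ)) ≤
        jb x ^ ((N + D : ℕ) : ℝ) * jb y ^ (-((N + D : ℕ) : ℝ)) := by
      have := jb_rpow_neg_le (L := ((N + D : ℕ) : ℝ)) (0 : V) x y (by positivity)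
      simpa [jb_neg] using this
    calc ‖K (x - y) * h y‖ₑ
        ≤ (C₁ * ((jb x₀ * ENNReal.ofReal 2) ^ ((N + D : ℕ) : ℝ) * jb y ^ (-((N + D : ℕ) : ℝ)))) *
            (C * jb y ^ (N : ℝ)) := by
          rw [enorm_mul]
          gcongr
          · exact (hC₁ _).trans (by gcongr; exact h1.trans (by gcongr))
          · exact hN y
      _ = B * (jb y ^ (-((N + D : ℕ) : ℝ)) * jb y ^ (N : ℝ)) := by ring
      _ = B * jb y ^ (-(D : ℝ)) := by
          rw [← ENNReal.rpow_add _ _ (jb_ne_zero _) (jb_ne_top _)]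
          congr 2; push_cast; ring
  have hcts : ∀ᵐ y : V, ContinuousAt (fun x => K (x - y) * h y) x₀ :=
    Filter.Eventually.of_forall fun y => by fun_prop
  refine continuousAt_of_dominated (bound := fun y => (B * jb y ^ (-(D : ℝ))).toReal)
    (Filter.Eventually.of_forall fun x => ?_) ?_ ?_ hcts
  · exact (by fun_prop : Continuous fun y => K (x - y)).aestronglyMeasurable.mul hm
  · filter_upwards [Metric.ball_mem_nhds x₀ one_pos] with x hx
    refine Filter.Eventually.of_forall fun y => ?_
    rw [← toReal_enorm]
    exact ENNReal.toReal_mono (ENNReal.mul_ne_top hB (jb_rpow_ne_top _ _)) (hbound x hx y)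
  · refine integrable_toReal_of_lintegral_ne_top (by fun_prop) ?_
    rw [lintegral_const_mul' _ _ hB]
    exact (ENNReal.mul_lt_top hB.lt_top hfin).ne

/-- The reflected and translated function `y ↦ K (x - y)`. -/
noncomputable def reflTranslate (K : 𝓢(V, ℂ)) (x : V) : 𝓢(V, ℂ) :=
  SchwartzMap.compSubConstCLM ℂ x
    (SchwartzMap.compCLMOfContinuousLinearEquiv ℂ (ContinuousLinearEquiv.neg ℝ) K)

@[simp] lemma reflTranslate_apply (K : 𝓢(V, ℂ)) (x y : V) :
    reflTranslate K x y = K (x - y) := by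
  simp [reflTranslate]

lemma seminorm_compSubConst_le (Ψ : 𝓢(V, ℂ)) (m : ℕ × ℕ) :
    ∃ C : ℝ, 0 ≤ C ∧ ∀ x, SchwartzMap.seminorm ℂ m.1 m.2 (SchwartzMap.compSubConstCLM ℂ x Ψ) ≤
      C * (1 + ‖x‖) ^ m.1 := by
  set C := 2 ^ m.1 * ((Finset.Iic m).sup fun m => SchwartzMap.seminorm ℂ m.1 m.2) Ψ
  have hC : 0 ≤ C := by positivity
  refine ⟨C, hC, fun x => SchwartzMap.seminorm_le_bound ℂ _ _ _ (by positivity) fun y => ?_⟩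
  have h1 : iteratedFDeriv ℝ m.2 (SchwartzMap.compSubConstCLM ℂ x Ψ) y =
      iteratedFDeriv ℝ m.2 Ψ (y - x) := by
    have : ⇑(SchwartzMap.compSubConstCLM ℂ x Ψ) = fun y => Ψ (y - x) := by
      ext y; simp
    rw [this, iteratedFDeriv_comp_sub]
  have h2 := SchwartzMap.one_add_le_sup_seminorm_apply (𝕜 := ℂ) (m := m) le_rfl le_rfl Ψ (y - x)
  have h3 : ‖y‖ ≤ (1 + ‖y - x‖) * (1 + ‖x‖) := by
    have := norm_add_le (y - x) x
    rw [sub_add_cancel] at this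
    nlinarith [norm_nonneg (y - x), norm_nonneg x, mul_nonneg (norm_nonneg (y - x)) (norm_nonneg x)]
  rw [h1]
  calc ‖y‖ ^ m.1 * ‖iteratedFDeriv ℝ m.2 Ψ (y - x)‖
      ≤ ((1 + ‖y - x‖) * (1 + ‖x‖)) ^ m.1 * ‖iteratedFDeriv ℝ m.2 Ψ (y - x)‖ := by gcongr
    _ = ((1 + ‖y - x‖) ^ m.1 * ‖iteratedFDeriv ℝ m.2 Ψ (y - x)‖) * (1 + ‖x‖) ^ m.1 := by
        rw [mul_pow]; ring
    _ ≤ C * (1 + ‖x‖) ^ m.1 := by gcongr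

lemma exists_bound_distribution (u : 𝓢'(V, ℂ)) :
    ∃ (s : Finset (ℕ × ℕ)) (C : ℝ≥0), ∀ Φ : 𝓢(V, ℂ),
      ‖u Φ‖ ≤ C * s.sup (schwartzSeminormFamily ℂ V ℂ) Φ := by
  have hc : Continuous fun Φ : 𝓢(V, ℂ) => u Φ :=
    ContinuousLinearMap.continuous (u : 𝓢(V, ℂ) →L[ℂ] ℂ)
  let q : Seminorm ℂ 𝓢(V, ℂ) := (normSeminorm ℂ ℂ).comp (u : 𝓢(V, ℂ) →L[ℂ] ℂ).toLinearMap
  obtain ⟨s, C, _, h⟩ := Seminorm.bound_of_continuous (schwartz_withSeminorms ℂ V ℂ) q hc.norm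
  exact ⟨s, C, fun Φ => h Φ⟩

/-- A distribution is bounded by finitely many seminorms, and translation by x enlarges each of them
polynomially in x at most. Thus `kconv K h` has polynomial growth even if nothing is known about the
growth of h. -/
lemma tempered_apply_reflTranslate (u : 𝓢'(V, ℂ)) (K : 𝓢(V, ℂ)) :
    Tempered fun x => ‖u (reflTranslate K x)‖ₑ := by
  obtain ⟨s, C, hu⟩ := exists_bound_distribution u
  choose B hB hBle using fun m => seminorm_compSubConst_le
    (SchwartzMap.compCLMOfContinuousLinearEquiv ℂ (ContinuousLinearEquiv.neg ℝ) K) m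
  set N := s.sup fun m => m.1
  refine ⟨C * (∑ m ∈ s, B m).toNNReal, N, fun x => ?_⟩
  have h1 : s.sup (schwartzSeminormFamily ℂ V ℂ) (reflTranslate K x) ≤
      (∑ m ∈ s, B m) * (1 + ‖x‖) ^ N := by
    refine Seminorm.finset_sup_apply_le
      (mul_nonneg (Finset.sum_nonneg fun m _ => hB m) (by positivity)) fun m hm => ?_
    refine (hBle m x).trans (mul_le_mul (Finset.single_le_sum (fun m _ => hB m) hm) ?_
      (by positivity) (Finset.sum_nonneg fun m _ => hB m))
    exact pow_le_pow_right₀ (by linarith [norm_nonneg x])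
      (Finset.le_sup (f := fun m : ℕ × ℕ => m.1) hm)
  simp only
  rw [← ofReal_norm]
  refine (ENNReal.ofReal_le_ofReal ((hu _).trans (mul_le_mul_of_nonneg_left h1 C.coe_nonneg))).trans_eq ?_
  rw [ENNReal.ofReal_mul C.coe_nonneg, ENNReal.ofReal_mul (Finset.sum_nonneg fun m _ => hB m),
    ENNReal.rpow_natCast, jb, ENNReal.ofReal_pow (by positivity), ENNReal.coe_mul, mul_assoc]
  rw [ENNReal.ofReal_coe_nnreal]
  rfl

end Continuity

/-! ### Functions representing a tempered distribution -/

section Representers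

variable {d : ℕ}

lemma _root_.IsRepresentedBy.congr_ae {u : 𝓢'(EuclideanSpace ℝ (Fin d), ℂ)}
    {g h : EuclideanSpace ℝ (Fin d) → ℂ} (hu : IsRepresentedBy u g) (hgh : g =ᵐ[volume] h) :
    IsRepresentedBy u h := by
  refine ⟨hu.1.congr hgh, fun φ => ?_⟩
  have he : (fun x => φ x * g x) =ᵐ[volume] fun x => φ x * h x :=
    hgh.mono fun x hx => by simp only [hx]
  exact ⟨(hu.2 φ).1.congr he, (hu.2 φ).2.trans (integral_congr_ae he)⟩

lemma ae_eq_of_forall_bump {g h : EuclideanSpace ℝ (Fin d) → ℂ}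
    (hg : ∀ b : EuclideanSpace ℝ (Fin d) → ℝ, ContDiff ℝ ∞ b → HasCompactSupport b →
      Integrable (fun x => (b x : ℂ) * g x) ∧ Integrable (fun x => (b x : ℂ) * h x) ∧
      ∫ x, (b x : ℂ) * g x = ∫ x, (b x : ℂ) * h x) : g =ᵐ[volume] h := by
  refine ae_eq_of_integral_contDiff_smul_eq
    (locallyIntegrable_of_forall_bump fun b h1 h2 => (hg b h1 h2).1)
    (locallyIntegrable_of_forall_bump fun b h1 h2 => (hg b h1 h2).2.1) fun b h1 h2 => ?_
  simpa only [Complex.real_smul] using (hg b h1 h2).2.2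

lemma _root_.IsRepresentedBy.ae_unique {u : 𝓢'(EuclideanSpace ℝ (Fin d), ℂ)}
    {g h : EuclideanSpace ℝ (Fin d) → ℂ} (hg : IsRepresentedBy u g) (hh : IsRepresentedBy u h) :
    g =ᵐ[volume] h := by
  refine ae_eq_of_forall_bump fun b hb hc => ?_
  have h1 := hg.2 (bumpSchwartz b hb hc)
  have h2 := hh.2 (bumpSchwartz b hb hc)
  exact ⟨h1.1, h2.1, h1.2.symm.trans h2.2⟩

lemma distLp_eq {u : 𝓢'(EuclideanSpace ℝ (Fin d), ℂ)} {g : EuclideanSpace ℝ (Fin d) → ℂ}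
    (hg : IsRepresentedBy u g) (p : ℝ≥0∞) : distLp p u = eLpNorm g p volume :=
  le_antisymm (distLp_le hg) (le_iInf fun h => (eLpNorm_congr_ae (hg.ae_unique h.2)).le)

lemma exists_isRepresentedBy {u : 𝓢'(EuclideanSpace ℝ (Fin d), ℂ)} {p : ℝ≥0∞}
    (h : distLp p u ≠ ⊤) : ∃ g, IsRepresentedBy u g := by
  by_contra! hne
  refine h ?_
  have : IsEmpty {g : EuclideanSpace ℝ (Fin d) → ℂ // IsRepresentedBy u g} :=
    ⟨fun g => hne g.1 g.2⟩
  simp [distLp]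

/-- If `h` represents `u` and is tempered then the convolution of `h` with the kernel of a symbol
represents the corresponding multiplier of `u`. -/
lemma isRepresentedBy_kconv {u v : 𝓢'(EuclideanSpace ℝ (Fin d), ℂ)}
    {h : EuclideanSpace ℝ (Fin d) → ℂ} (hu : IsRepresentedBy u h) (ht : Tempered fun x => ‖h x‖ₑ)
    {M : 𝓢(EuclideanSpace ℝ (Fin d), ℂ)} (hv : ∀ Φ, v Φ = u (dualMul M Φ)) :
    IsRepresentedBy v (kconv (symKernel M) h) := by
  refine ⟨(continuous_kconv _ hu.1 ht).aestronglyMeasurable, fun Φ => ?_⟩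
  have h1 := integral_dualMul_eq_of_integrable (M := M) (Φ := Φ)
    (integrable_prod_of_tempered hu.1 ht)
  exact ⟨h1.1, by rw [hv, (hu.2 _).2, h1.2]⟩

lemma kconv_eq_apply {u : 𝓢'(EuclideanSpace ℝ (Fin d), ℂ)}
    {h : EuclideanSpace ℝ (Fin d) → ℂ} (hu : IsRepresentedBy u h)
    (K : 𝓢(EuclideanSpace ℝ (Fin d), ℂ)) (x : EuclideanSpace ℝ (Fin d)) :
    kconv K h x = u (reflTranslate K x) := by
  rw [(hu.2 _).2]; simp [kconv]

lemma tempered_kconv {u : 𝓢'(EuclideanSpace ℝ (Fin d), ℂ)}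
    {h : EuclideanSpace ℝ (Fin d) → ℂ} (hu : IsRepresentedBy u h)
    (K : 𝓢(EuclideanSpace ℝ (Fin d), ℂ)) : Tempered fun x => ‖kconv K h x‖ₑ := by
  simp only [kconv_eq_apply hu]
  exact tempered_apply_reflTranslate u K

/-- Both sides are tested against a bump b. The kernel is a product by hypothesis and b = c b is one
too, so both have Schwartz majorants and Fubini's theorem applies. -/
lemma ae_eq_kconv_of_factorized {u : 𝓢'(EuclideanSpace ℝ (Fin d), ℂ)}
    {g : EuclideanSpace ℝ (Fin d) → ℂ} (hu : IsRepresentedBy u g)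
    {M K₁ K₂ : 𝓢(EuclideanSpace ℝ (Fin d), ℂ)} (hK : ∀ x, symKernel M x = K₁ x * K₂ x)
    (hM : ∀ Φ, u (dualMul M Φ) = u Φ) : g =ᵐ[volume] kconv (symKernel M) g := by
  refine ae_eq_of_forall_bump fun b hb hc => ?_
  obtain ⟨c, hcs, hcc, hcb⟩ := exists_bump_eq_one hc
  obtain ⟨W, hW⟩ := exists_majorant_of_mul hK
  obtain ⟨U, hU⟩ := exists_majorant_of_mul (K := bumpSchwartz b hb hc)
    (K₁ := bumpSchwartz c hcs hcc) (K₂ := bumpSchwartz b hb hc)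
    (fun x => by simp only [bumpSchwartz_apply]; rw [← Complex.ofReal_mul, hcb])
  have h1 := integral_dualMul_eq_of_integrable
    (integrable_prod_of_majorant hW hU hu.1 fun Ψ => (hu.2 Ψ).1)
  have h2 := hu.2 (bumpSchwartz b hb hc)
  refine ⟨h2.1, h1.1, ?_⟩
  have h3 := (hu.2 (dualMul M (bumpSchwartz b hb hc))).2
  rw [hM, h2.2, h1.2] at h3
  exact h3

/-- A band-limited tempered distribution which is represented by some function is represented by
a continuous function of polynomial growth that is reproduced by every kernel whose symbol acts
trivially. -/
lemma exists_reproducing {u : 𝓢'(EuclideanSpace ℝ (Fin d), ℂ)}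
    {g : EuclideanSpace ℝ (Fin d) → ℂ} (hu : IsRepresentedBy u g)
    {M K₁ K₂ M' : 𝓢(EuclideanSpace ℝ (Fin d), ℂ)} (hK : ∀ x, symKernel M x = K₁ x * K₂ x)
    (hM : ∀ Φ, u (dualMul M Φ) = u Φ) (hM' : ∀ Φ, u (dualMul M' Φ) = u Φ) :
    ∃ h, IsRepresentedBy u h ∧ Continuous h ∧ (Tempered fun x => ‖h x‖ₑ) ∧
      ∀ x, h x = kconv (symKernel M') h x := by
  -- Two convolutions are needed: the factorized kernel produces a representing function of
  -- polynomial growth, and only then may the arbitrary symbol `M'` be applied.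
  have h1 : IsRepresentedBy u (kconv (symKernel M) g) :=
    hu.congr_ae (ae_eq_kconv_of_factorized hu hK hM)
  have ht1 := tempered_kconv hu (symKernel M)
  have h2 := isRepresentedBy_kconv h1 ht1 (fun Φ => (hM' Φ).symm)
  refine ⟨_, h2, continuous_kconv _ h1.1 ht1, tempered_kconv h1 _, fun x => ?_⟩
  refine integral_congr_ae ?_
  filter_upwards [h1.ae_unique h2] with y hy
  rw [← hy]

end Representers

/-! ### The partition of unity as a product of one-dimensional profiles -/

section OneDimensional

variable {η : ℝ → ℝ}

/-- The `1`-periodic function `∑_j η(2(t - j))`. -/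
noncomputable def perSum (η : ℝ → ℝ) (t : ℝ) : ℝ := ∑' j : ℤ, η ((t - j) / (1 / 2))

/-- The one-dimensional profile of the partition of unity. -/
noncomputable def thin (η : ℝ → ℝ) (t : ℝ) : ℝ := η (t / (1 / 2)) / perSum η t

lemma abs_lt_one_of_bump_ne_zero (hη : IsBump η) {t : ℝ} (h : η (t / (1 / 2)) ≠ 0) : |t| < 1 := by
  by_contra! h1
  refine h (hη.eq_zero _ ?_)
  rw [abs_div, abs_of_pos (by norm_num : (0 : ℝ) < 1 / 2)]
  linarith

/-- A finite set of integers containing all those at distance less than `2` from `t`. -/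
noncomputable def nearInts (t : ℝ) : Finset ℤ := Finset.Ioo (⌊t⌋ - 3) (⌊t⌋ + 4)

lemma mem_nearInts {t : ℝ} {j : ℤ} (h : |t - j| < 2) : j ∈ nearInts t := by
  rw [abs_lt] at h
  have h1 := Int.floor_le t
  have h2 := Int.lt_floor_add_one t
  rw [nearInts, Finset.mem_Ioo]
  constructor
  · have : (⌊t⌋ : ℝ) - 3 < j := by linarith
    exact_mod_cast this
  · have : (j : ℝ) < ⌊t⌋ + 4 := by linarith
    exact_mod_cast this

lemma perSum_eq_sum (hη : IsBump η) {t : ℝ} {s : Finset ℤ} (hs : ∀ j : ℤ, |t - j| < 1 → j ∈ s) :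
    perSum η t = ∑ j ∈ s, η ((t - j) / (1 / 2)) :=
  tsum_eq_sum fun j hj => by
    by_contra h
    exact hj (hs j (abs_lt_one_of_bump_ne_zero hη h))

lemma contDiff_perSum (hη : IsBump η) : ContDiff ℝ ∞ (perSum η) := by
  rw [contDiff_iff_contDiffAt]
  intro t₀
  have h1 : ContDiff ℝ ∞ fun t : ℝ => ∑ j ∈ nearInts t₀, η ((t - j) / (1 / 2)) :=
    ContDiff.sum fun j _ => hη.smooth.comp ((contDiff_id.sub contDiff_const).div_const _)
  refine h1.contDiffAt.congr_of_eventuallyEq ?_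
  filter_upwards [Metric.ball_mem_nhds t₀ one_pos] with t ht
  refine perSum_eq_sum hη fun j hj => mem_nearInts ?_
  rw [Metric.mem_ball, Real.dist_eq, abs_sub_comm] at ht
  calc |t₀ - j| ≤ |t₀ - t| + |t - j| := abs_sub_le _ _ _
    _ < 2 := by linarith

lemma perSum_pos (hη : IsBump η) (t : ℝ) : 0 < perSum η t := by
  rw [perSum_eq_sum hη (s := nearInts t) fun j hj => mem_nearInts (by linarith)]
  refine Finset.sum_pos' (fun j _ => hη.nonneg _) ⟨round t, ?_, ?_⟩
  · exact mem_nearInts (by linarith [abs_sub_round t])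
  · rw [hη.eq_one]
    · exact one_pos
    · rw [abs_div, abs_of_pos (by norm_num : (0 : ℝ) < 1 / 2)]
      linarith [abs_sub_round t]

lemma perSum_sub_int (t : ℝ) (j : ℤ) : perSum η (t - j) = perSum η t := by
  unfold perSum
  rw [← (Equiv.addRight j).tsum_eq fun i : ℤ => η ((t - i) / (1 / 2))]
  refine tsum_congr fun i => ?_
  simp only [Equiv.coe_addRight]
  congr 2
  push_cast; ring

lemma contDiff_thin (hη : IsBump η) : ContDiff ℝ ∞ (thin η) :=
  (hη.smooth.comp (contDiff_id.div_const _)).div (contDiff_perSum hη) fun t => (perSum_pos hη t).ne'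

lemma thin_eq_zero (hη : IsBump η) {t : ℝ} (ht : 1 ≤ |t|) : thin η t = 0 := by
  rw [thin, div_eq_zero_iff]
  left
  by_contra h
  linarith [abs_lt_one_of_bump_ne_zero hη h]

lemma sum_thin (hη : IsBump η) {t : ℝ} {s : Finset ℤ} (hs : ∀ j : ℤ, |t - j| < 1 → j ∈ s) :
    ∑ j ∈ s, thin η (t - j) = 1 := by
  simp only [thin, perSum_sub_int]
  rw [← Finset.sum_div, ← perSum_eq_sum hη hs, div_self (perSum_pos hη t).ne']

/-- The normalizing sum factors over the coordinates and each factor is 1-periodic. So the symbols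
are lattice translates of a single product, which is the source of all uniformity in k. -/
lemma bapu_eq_prod (hη : IsBump η) {d : ℕ} (k : Fin d → ℤ) (ξ : EuclideanSpace ℝ (Fin d)) :
    bapu η k ξ = ∏ i, thin η (ξ i - k i) := by
  have h1 : ∑' l : Fin d → ℤ, bumpProd η l ξ = ∏ i, perSum η (ξ i) := by
    rw [tsum_eq_sum (s := Fintype.piFinset fun i => nearInts (ξ i))]
    · simp only [bumpProd]
      rw [← Finset.prod_univ_sum (fun i => nearInts (ξ i)) fun i j => η ((ξ i - j) / (1 / 2))]
      refine Finset.prod_congr rfl fun i _ => (perSum_eq_sum hη fun j hj => ?_).symm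
      exact mem_nearInts (by linarith)
    · intro l hl
      rw [Fintype.mem_piFinset] at hl
      push Not at hl
      obtain ⟨i, hi⟩ := hl
      refine Finset.prod_eq_zero (Finset.mem_univ i) ?_
      by_contra h
      exact hi (mem_nearInts (by linarith [abs_lt_one_of_bump_ne_zero hη h]))
  rw [bapu, h1, bumpProd, ← Finset.prod_div_distrib]
  simp only [thin, perSum_sub_int]

end OneDimensional

/-! ### Cutoffs on the line and product symbols -/

/-- A smooth compactly supported function on the line. -/
structure Cutoff where
  toFun : ℝ → ℝ
  smooth : ContDiff ℝ ∞ toFun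
  compact : HasCompactSupport toFun

/-- The function `τ ↦ ρ(2πτ - j)`. -/
noncomputable def Cutoff.dilate (ρ : ℝ → ℝ) (hρ : ContDiff ℝ ∞ ρ) (R : ℝ)
    (hR : ∀ t, R ≤ |t| → ρ t = 0) (j : ℝ) : Cutoff where
  toFun τ := ρ (2 * Real.pi * τ - j)
  smooth := hρ.comp ((contDiff_const.mul contDiff_id).sub contDiff_const)
  compact := by
    refine HasCompactSupport.of_support_subset_isCompact
      (isCompact_closedBall (0 : ℝ) ((|R| + |j|) / (2 * Real.pi))) fun τ hτ => ?_
    rw [mem_closedBall_zero_iff, Real.norm_eq_abs, le_div_iff₀ (by positivity)]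
    have h : |2 * Real.pi * τ - j| < R := by
      by_contra! h
      exact hτ (hR _ h)
    have h2 : |2 * Real.pi * τ| ≤ |2 * Real.pi * τ - j| + |j| := by
      simpa using abs_add_le (2 * Real.pi * τ - j) j
    rw [abs_mul, abs_of_pos (by positivity : 0 < 2 * Real.pi)] at h2
    nlinarith [le_abs_self R]

/-- The symbols of the frequency-uniform decomposition in one variable. -/
noncomputable def thinC {η : ℝ → ℝ} (hη : IsBump η) (j : ℤ) : Cutoff :=
  Cutoff.dilate (thin η) (contDiff_thin hη) 1 (fun _ h => thin_eq_zero hη h) j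

/-- A cutoff which is `1` on the support of `thinC`. -/
noncomputable def fatC {η : ℝ → ℝ} (hη : IsBump η) (j : ℤ) : Cutoff :=
  Cutoff.dilate η hη.smooth 2 (fun _ h => hη.eq_zero _ h) j

section Products

variable {d : ℕ}

lemma contDiff_prodCutoff (ρ : Fin d → Cutoff) :
    ContDiff ℝ ∞ fun ξ : EuclideanSpace ℝ (Fin d) => ∏ i, (ρ i).toFun (ξ i) :=
  contDiff_prod fun i _ => (ρ i).smooth.comp (by fun_prop)

lemma hasCompactSupport_prodCutoff (ρ : Fin d → Cutoff) :
    HasCompactSupport fun ξ : EuclideanSpace ℝ (Fin d) => ∏ i, (ρ i).toFun (ξ i) := by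
  have hK : IsCompact ((WithLp.toLp 2 : (Fin d → ℝ) → EuclideanSpace ℝ (Fin d)) ''
      Set.univ.pi fun i => tsupport (ρ i).toFun) :=
    (isCompact_univ_pi fun i => (ρ i).compact.isCompact).image (PiLp.continuous_toLp 2 _)
  refine HasCompactSupport.of_support_subset_isCompact hK fun ξ hξ => ?_
  refine ⟨fun i => ξ i, fun i _ => subset_tsupport _ ?_, rfl⟩
  exact fun h => hξ (Finset.prod_eq_zero (Finset.mem_univ i) h)

/-- The product symbol `∏ i, ρ_i(ξ_i)` as a Schwartz function. -/
noncomputable def prodSymbol (ρ : Fin d → Cutoff) : 𝓢(EuclideanSpace ℝ (Fin d), ℂ) :=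
  bumpSchwartz _ (contDiff_prodCutoff ρ) (hasCompactSupport_prodCutoff ρ)

lemma prodSymbol_apply (ρ : Fin d → Cutoff) (ξ : EuclideanSpace ℝ (Fin d)) :
    prodSymbol ρ ξ = ((∏ i, (ρ i).toFun (ξ i) : ℝ) : ℂ) := rfl

/-- The factor 2π between the two normalizations of the Fourier transform is absorbed in
`Cutoff.dilate`. -/
lemma box_apply {η : ℝ → ℝ} (hη : IsBump η) (k : Fin d → ℤ)
    (f : 𝓢'(EuclideanSpace ℝ (Fin d), ℂ)) (Φ : 𝓢(EuclideanSpace ℝ (Fin d), ℂ)) :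
    box η k f Φ = f (dualMul (prodSymbol fun i => thinC hη (k i)) Φ) := by
  rw [box, TemperedDistribution.fourierMultiplierCLM_apply_apply, dualMul_eq]
  congr 4
  funext ξ
  rw [bapu_eq_prod hη, prodSymbol_apply]
  simp [thinC, Cutoff.dilate]

lemma thin_mul_fat {η : ℝ → ℝ} (hη : IsBump η) (j : ℤ) (τ : ℝ) :
    (thinC hη j).toFun τ * (fatC hη j).toFun τ = (thinC hη j).toFun τ := by
  simp only [thinC, fatC, Cutoff.dilate]
  by_cases h : 1 ≤ |2 * Real.pi * τ - j|
  · rw [thin_eq_zero hη h, zero_mul]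
  · rw [hη.eq_one _ (le_of_not_ge h), mul_one]

/-- The half-widths of the two supports are 1 and 2, so centres at distance 3 separate them. -/
lemma thin_mul_fat_eq_zero {η : ℝ → ℝ} (hη : IsBump η) {j l : ℤ} (h : 3 ≤ |j - l|) (τ : ℝ) :
    (thinC hη j).toFun τ * (fatC hη l).toFun τ = 0 := by
  simp only [thinC, fatC, Cutoff.dilate]
  by_cases h1 : 1 ≤ |2 * Real.pi * τ - j|
  · rw [thin_eq_zero hη h1, zero_mul]
  by_cases h2 : 2 ≤ |2 * Real.pi * τ - l|
  · rw [hη.eq_zero _ h2, mul_zero]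
  exfalso
  have h3 : (3 : ℝ) ≤ |(j : ℝ) - l| := by exact_mod_cast h
  have h4 := abs_sub_le (j : ℝ) (2 * Real.pi * τ) l
  rw [abs_sub_comm (j : ℝ) (2 * Real.pi * τ)] at h4
  linarith

lemma prodSymbol_thin_mul_fat {η : ℝ → ℝ} (hη : IsBump η) (k : Fin d → ℤ)
    (ξ : EuclideanSpace ℝ (Fin d)) :
    prodSymbol (fun i => thinC hη (k i)) ξ * prodSymbol (fun i => fatC hη (k i)) ξ =
      prodSymbol (fun i => thinC hη (k i)) ξ := by
  simp only [prodSymbol_apply, ← Complex.ofReal_mul, ← Finset.prod_mul_distrib, thin_mul_fat]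

lemma prodSymbol_thin_mul_fat_eq_zero {η : ℝ → ℝ} (hη : IsBump η) {k l : Fin d → ℤ}
    (h : ∃ i, 3 ≤ |k i - l i|) (ξ : EuclideanSpace ℝ (Fin d)) :
    prodSymbol (fun i => thinC hη (k i)) ξ * prodSymbol (fun i => fatC hη (l i)) ξ = 0 := by
  obtain ⟨i, hi⟩ := h
  simp only [prodSymbol_apply, ← Complex.ofReal_mul, ← Finset.prod_mul_distrib]
  rw [Finset.prod_eq_zero (Finset.mem_univ i) (thin_mul_fat_eq_zero hη hi _), Complex.ofReal_zero]

end Products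

/-! ### Lebesgue measure on the product of a hyperplane and a line -/

section JoinMeasure

variable {d : ℕ}

/-- The identification of `ℝ^d × ℝ` with `ℝ^{d+1}`. -/
noncomputable def joinEquiv (d : ℕ) :
    (EuclideanSpace ℝ (Fin d) × ℝ) ≃ᵐ EuclideanSpace ℝ (Fin (d + 1)) where
  toFun z := joinLast z.2 z.1
  invFun y := (initE y, y (Fin.last d))
  left_inv z := by simp
  right_inv y := by simp
  measurable_toFun := (continuous_joinLast.comp continuous_swap).measurable
  measurable_invFun := (by fun_prop : Continuous fun y : EuclideanSpace ℝ (Fin (d + 1)) =>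
    (initE y, y (Fin.last d))).measurable

@[simp] lemma joinEquiv_apply (z : EuclideanSpace ℝ (Fin d) × ℝ) :
    joinEquiv d z = joinLast z.2 z.1 := rfl

lemma measurePreserving_joinEquiv (d : ℕ) : MeasurePreserving (joinEquiv d)
    ((volume : Measure (EuclideanSpace ℝ (Fin d))).prod volume) volume := by
  have h1 : MeasurePreserving (Prod.map (WithLp.ofLp : EuclideanSpace ℝ (Fin d) → _) (id : ℝ → ℝ))
      (volume.prod volume) (volume.prod volume) :=
    (PiLp.volume_preserving_ofLp (Fin d)).prod (MeasurePreserving.id _)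
  have h2 : MeasurePreserving (Prod.swap : (Fin d → ℝ) × ℝ → ℝ × (Fin d → ℝ))
      (volume.prod volume) (volume.prod volume) := Measure.measurePreserving_swap
  have h3 := (volume_preserving_piFinSuccAbove (fun _ : Fin (d + 1) => ℝ) (Fin.last d)).symm
  have h4 := PiLp.volume_preserving_toLp (Fin (d + 1))
  have h := h4.comp (h3.comp (h2.comp h1))
  refine (congrArg (fun F => MeasurePreserving F (volume.prod volume) volume) ?_).mp h
  funext z
  ext i
  refine Fin.lastCases ?_ (fun j => ?_) i <;> simp [MeasurableEquiv.piFinSuccAbove]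

lemma integral_joinLast {G : Type*} [NormedAddCommGroup G] [NormedSpace ℝ G]
    (f : EuclideanSpace ℝ (Fin (d + 1)) → G) :
    ∫ y, f y = ∫ z : EuclideanSpace ℝ (Fin d) × ℝ, f (joinLast z.2 z.1) :=
  ((measurePreserving_joinEquiv d).integral_comp' f).symm

lemma integrable_joinLast_iff {G : Type*} [NormedAddCommGroup G]
    {f : EuclideanSpace ℝ (Fin (d + 1)) → G} :
    Integrable (fun z : EuclideanSpace ℝ (Fin d) × ℝ => f (joinLast z.2 z.1))
      (volume.prod volume) ↔ Integrable f :=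
  (measurePreserving_joinEquiv d).integrable_comp_emb (joinEquiv d).measurableEmbedding

lemma inner_joinLast (s t : ℝ) (x y : EuclideanSpace ℝ (Fin d)) :
    inner ℝ (joinLast s x) (joinLast t y) = inner ℝ x y + s * t := by
  simp [PiLp.inner_apply, Fin.sum_univ_castSucc, mul_comm]

end JoinMeasure

/-! ### Tensor structure and uniform decay of the kernels -/

section SplitKernels

open FourierTransform

variable {d : ℕ}

/-- A cutoff as a Schwartz function on the line. -/
noncomputable def Cutoff.schwartz (ρ : Cutoff) : 𝓢(ℝ, ℂ) :=
  bumpSchwartz ρ.toFun ρ.smooth ρ.compact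

lemma symKernel_eq_integral {V : Type*} [NormedAddCommGroup V] [InnerProductSpace ℝ V]
    [FiniteDimensional ℝ V] [MeasurableSpace V] [BorelSpace V] (M : 𝓢(V, ℂ)) (x : V) :
    symKernel M x = ∫ ξ, (Real.fourierChar (inner ℝ ξ x) : ℂ) * M ξ := by
  rw [symKernel, SchwartzMap.fourierInv_coe, Real.fourierInv_eq]
  rfl

lemma symKernel_snoc (ρ : Fin d → Cutoff) (σ : Cutoff) (t : ℝ) (x : EuclideanSpace ℝ (Fin d)) :
    symKernel (prodSymbol (Fin.snoc ρ σ : Fin (d + 1) → Cutoff)) (joinLast t x) =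
      symKernel (prodSymbol ρ) x * symKernel σ.schwartz t := by
  rw [symKernel_eq_integral, symKernel_eq_integral, symKernel_eq_integral, integral_joinLast,
    ← integral_prod_mul]
  refine integral_congr_ae (Filter.Eventually.of_forall fun z => ?_)
  simp only [inner_joinLast, prodSymbol_apply, Fin.prod_univ_castSucc, Fin.snoc_castSucc,
    Fin.snoc_last, joinLast_castSucc, joinLast_last, AddChar.map_add_eq_mul, Circle.coe_mul,
    Complex.ofReal_mul]
  have : σ.schwartz z.2 = (σ.toFun z.2 : ℂ) := rfl
  have h2 : (inner ℝ z.2 t : ℝ) = z.2 * t := by simp [mul_comm]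
  rw [this, h2]
  ring

/-- Translating a symbol multiplies its kernel by a unimodular character; hence kernel bounds do not
depend on the lattice point. -/
lemma norm_symKernel_modulate {V : Type*} [NormedAddCommGroup V] [InnerProductSpace ℝ V]
    [FiniteDimensional ℝ V] [MeasurableSpace V] [BorelSpace V] {M M' : 𝓢(V, ℂ)} {κ : V}
    (h : ∀ ξ, M ξ = M' (ξ - κ)) (x : V) : ‖symKernel M x‖ = ‖symKernel M' x‖ := by
  rw [symKernel_eq_integral, symKernel_eq_integral]
  have : ∫ ξ, (Real.fourierChar (inner ℝ ξ x) : ℂ) * M ξ =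
      (Real.fourierChar (inner ℝ κ x) : ℂ) *
        ∫ ξ, (Real.fourierChar (inner ℝ ξ x) : ℂ) * M' ξ := by
    rw [← integral_const_mul, ← integral_sub_right_eq_self
      (fun ξ => (Real.fourierChar (inner ℝ κ x) : ℂ) *
        ((Real.fourierChar (inner ℝ ξ x) : ℂ) * M' ξ)) κ]
    refine integral_congr_ae (Filter.Eventually.of_forall fun ξ => ?_)
    simp only [h, ← mul_assoc, ← Circle.coe_mul, ← AddChar.map_add_eq_mul, ← inner_add_left,
      add_sub_cancel]
  rw [this, norm_mul, Circle.norm_coe, one_mul]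

lemma prodSymbol_dilate_eq {ρ : ℝ → ℝ} (hρ : ContDiff ℝ ∞ ρ) {R : ℝ}
    (hR : ∀ t, R ≤ |t| → ρ t = 0) (k : Fin d → ℤ) (ξ : EuclideanSpace ℝ (Fin d)) :
    prodSymbol (fun i => Cutoff.dilate ρ hρ R hR (k i)) ξ =
      prodSymbol (fun _ => Cutoff.dilate ρ hρ R hR 0)
        (ξ - WithLp.toLp 2 fun i => (k i : ℝ) / (2 * Real.pi)) := by
  simp only [prodSymbol_apply, Cutoff.dilate]
  congr 1
  refine Finset.prod_congr rfl fun i _ => ?_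
  congr 1
  simp only [PiLp.sub_apply, sub_zero]
  field_simp

lemma exists_symKernel_dilate_le {ρ : ℝ → ℝ} (hρ : ContDiff ℝ ∞ ρ) {R : ℝ}
    (hR : ∀ t, R ≤ |t| → ρ t = 0) (d : ℕ) :
    ∃ C : ℕ → ℝ≥0, ∀ (L : ℕ) (k : Fin d → ℤ) (x : EuclideanSpace ℝ (Fin d)),
      ‖symKernel (prodSymbol fun i => Cutoff.dilate ρ hρ R hR (k i)) x‖ₑ ≤
        C L * jb x ^ (-(L : ℝ)) := by
  choose C hC using fun L : ℕ => exists_enorm_le_jb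
    (symKernel (prodSymbol fun _ : Fin d => Cutoff.dilate ρ hρ R hR 0)) L
  refine ⟨C, fun L k x => ?_⟩
  rw [← ofReal_norm, norm_symKernel_modulate (prodSymbol_dilate_eq hρ hR k), ofReal_norm]
  exact hC L x

/-- Kernels of symbols with vanishing product have vanishing convolution. -/
lemma integral_symKernel_mul {V : Type*} [NormedAddCommGroup V] [InnerProductSpace ℝ V]
    [FiniteDimensional ℝ V] [MeasurableSpace V] [BorelSpace V] {M₁ M₂ M : 𝓢(V, ℂ)}
    (h : ∀ ξ, M₁ ξ * M₂ ξ = M ξ) (x z : V) :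
    ∫ y, symKernel M₁ (x - y) * symKernel M₂ (y - z) = symKernel M (x - z) := by
  have h1 : SchwartzMap.convolution (ContinuousLinearMap.mul ℂ ℂ) (symKernel M₂) (symKernel M₁) =
      symKernel M := by
    apply (fourierEquiv ℂ 𝓢(V, ℂ) (F := 𝓢(V, ℂ))).injective
    simp only [fourierEquiv_apply, SchwartzMap.fourier_convolution, symKernel,
      FourierTransform.fourier_fourierInv_eq]
    ext ξ
    simpa [mul_comm] using h ξ
  rw [← h1, SchwartzMap.convolution_apply, convolution_def, ← integral_add_right_eq_self _ z]
  refine integral_congr_ae (Filter.Eventually.of_forall fun y => ?_)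
  simp only [ContinuousLinearMap.mul_apply', add_sub_cancel_right]
  rw [mul_comm]
  congr 2
  abel

end SplitKernels

/-! ### Summation over the frequency lattice -/

section LatticeSums

/-- The square `1 + |k|²` of the weight of a lattice point. -/
noncomputable def latSq {d : ℕ} (k : Fin d → ℤ) : ℝ := 1 + ∑ i, (k i : ℝ) ^ 2

lemma one_le_latSq {d : ℕ} (k : Fin d → ℤ) : 1 ≤ latSq k := by
  have : 0 ≤ ∑ i, (k i : ℝ) ^ 2 := Finset.sum_nonneg fun i _ => sq_nonneg _
  unfold latSq; linarith

lemma latSq_pos {d : ℕ} (k : Fin d → ℤ) : 0 < latSq k := zero_lt_one.trans_le (one_le_latSq k)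

lemma summable_prod_of_nonneg {f : ℤ → ℝ} (hf : Summable f) (h0 : ∀ j, 0 ≤ f j) (d : ℕ) :
    Summable fun k : Fin d → ℤ => ∏ i, f (k i) := by
  induction d with
  | zero => exact (hasSum_fintype _).summable
  | succ d ih =>
    rw [← (Fin.consEquiv fun _ => ℤ).summable_iff]
    have := hf.mul_of_nonneg ih h0 fun k => Finset.prod_nonneg fun i _ => h0 _
    refine this.congr fun z => ?_
    simp [Fin.prod_univ_succ, Fin.consEquiv]

/-- Each factor 1 + k_i² is at most `latSq k`, so the d-th power dominates a product of
one-dimensional summable terms. -/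
lemma summable_latSq (d : ℕ) : Summable fun k : Fin d → ℤ => (latSq k ^ d)⁻¹ := by
  have h1 : Summable fun j : ℤ => (1 + (j : ℝ) ^ 2)⁻¹ := by
    have h2 : Summable fun j : ℤ => 1 / (j : ℝ) ^ 2 :=
      Real.summable_one_div_int_pow.2 one_lt_two
    refine Summable.of_norm_bounded_eventually h2 ?_
    have : ({0}ᶜ : Set ℤ) ∈ Filter.cofinite := (Set.finite_singleton 0).compl_mem_cofinite
    filter_upwards [this] with j hj
    have hj' : (0 : ℝ) < (j : ℝ) ^ 2 := by
      have : (j : ℝ) ≠ 0 := by exact_mod_cast hj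
      positivity
    rw [Real.norm_of_nonneg (by positivity), one_div]
    exact inv_anti₀ hj' (by linarith)
  refine (summable_prod_of_nonneg h1 (fun j => by positivity) d).of_nonneg_of_le
    (fun k => by have := latSq_pos k; positivity) fun k => ?_
  rw [Finset.prod_inv_distrib]
  refine inv_anti₀ (Finset.prod_pos fun i _ => by positivity) ?_
  calc ∏ i, (1 + (k i : ℝ) ^ 2) ≤ ∏ _i : Fin d, latSq k := by
        refine Finset.prod_le_prod (fun i _ => by positivity) fun i _ => ?_
        have := Finset.single_le_sum (f := fun i => (k i : ℝ) ^ 2) (fun i _ => sq_nonneg _)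
          (Finset.mem_univ i)
        unfold latSq; linarith
    _ = latSq k ^ d := by simp

end LatticeSums

/-! ### Rapid decay of Schwartz functions along the frequency decomposition -/

section Decay

open FourierTransform

variable {d : ℕ} {ρ : ℝ → ℝ} (hρ : ContDiff ℝ ∞ ρ) {R : ℝ} (hR : ∀ t, R ≤ |t| → ρ t = 0)

/-- The symbol `∏ i, ρ(2πξ_i - k_i)`. -/
noncomputable def latSymbol (k : Fin d → ℤ) : 𝓢(EuclideanSpace ℝ (Fin d), ℂ) :=
  prodSymbol fun i => Cutoff.dilate ρ hρ R hR (k i)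

lemma latSymbol_apply (k : Fin d → ℤ) (ξ : EuclideanSpace ℝ (Fin d)) :
    latSymbol hρ hR k ξ = ((∏ i, ρ (2 * Real.pi * ξ i - k i) : ℝ) : ℂ) := rfl

lemma tsupport_latSymbol_subset (k : Fin d → ℤ) :
    tsupport (latSymbol hρ hR k) ⊆ {ξ | ∀ i, |2 * Real.pi * ξ i - k i| ≤ R} := by
  refine closure_minimal (fun ξ hξ i => ?_) ?_
  · by_contra! h
    refine hξ ?_
    rw [latSymbol_apply, Finset.prod_eq_zero (Finset.mem_univ i) (hR _ h.le), Complex.ofReal_zero]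
  · simp only [Set.ofPred_forall]
    exact isClosed_iInter fun i => isClosed_le (by fun_prop) continuous_const

lemma latSq_le_of_mem {k : Fin d → ℤ} {ξ : EuclideanSpace ℝ (Fin d)}
    (h : ∀ i, |2 * Real.pi * ξ i - k i| ≤ R) :
    latSq k ≤ (1 + d * (|R| + 2 * Real.pi) ^ 2) * (1 + ‖ξ‖) ^ 2 := by
  have h1 : ∀ i, (k i : ℝ) ^ 2 ≤ (|R| + 2 * Real.pi) ^ 2 * (1 + ‖ξ‖) ^ 2 := by
    intro i
    rw [← mul_pow, ← sq_abs]
    refine pow_le_pow_left₀ (abs_nonneg _) ?_ 2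
    have h2 : |(k i : ℝ)| ≤ |2 * Real.pi * ξ i - k i| + |2 * Real.pi * ξ i| := by
      have := abs_sub_le (k i : ℝ) (2 * Real.pi * ξ i) 0
      rw [sub_zero, sub_zero, abs_sub_comm] at this
      exact this
    have h3 : |ξ i| ≤ ‖ξ‖ := by simpa using PiLp.norm_apply_le ξ i
    rw [abs_mul, abs_of_pos (by positivity : 0 < 2 * Real.pi)] at h2
    nlinarith [h i, le_abs_self R, abs_nonneg R, norm_nonneg ξ, Real.pi_pos,
      mul_nonneg (abs_nonneg R) (norm_nonneg ξ), mul_le_mul_of_nonneg_left h3 Real.pi_pos.le]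
  have h4 : (1 : ℝ) ≤ (1 + ‖ξ‖) ^ 2 := one_le_pow₀ (by linarith [norm_nonneg ξ])
  have h5 := Finset.sum_le_sum fun i (_ : i ∈ Finset.univ) => h1 i
  simp only [Finset.sum_const, Finset.card_univ, Fintype.card_fin, nsmul_eq_mul] at h5
  unfold latSq
  nlinarith

/-- On the support of the symbol `latSq k` is at most a constant times (1 + ‖ξ‖)², so the factor
`latSq k ^ M` costs 2M powers of ‖ξ‖, which ψ supplies. The symbols are translates of one function,
so their derivatives are bounded uniformly in k, and Leibniz' rule applies. -/
lemma exists_seminorm_latSymbol_le (M a b : ℕ) : ∃ C : ℝ, 0 ≤ C ∧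
    ∀ (k : Fin d → ℤ) (ψ : 𝓢(EuclideanSpace ℝ (Fin d), ℂ)),
      latSq k ^ M * SchwartzMap.seminorm ℂ a b (SchwartzMap.smulLeftCLM ℂ (latSymbol hρ hR k) ψ) ≤
        C * ((Finset.Iic (a + 2 * M, b)).sup
          (schwartzSeminormFamily ℂ (EuclideanSpace ℝ (Fin d)) ℂ)) ψ := by
  set M₀ : 𝓢(EuclideanSpace ℝ (Fin d), ℂ) := prodSymbol fun _ => Cutoff.dilate ρ hρ R hR 0
  set B : ℕ → ℝ := fun i => SchwartzMap.seminorm ℂ 0 i M₀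
  have hB : ∀ i (k : Fin d → ℤ) ξ, ‖iteratedFDeriv ℝ i (latSymbol hρ hR k) ξ‖ ≤ B i := by
    intro i k ξ
    have : ⇑(latSymbol hρ hR k) =
        fun ξ => M₀ (ξ - WithLp.toLp 2 fun i => (k i : ℝ) / (2 * Real.pi)) := by
      ext ξ; exact prodSymbol_dilate_eq hρ hR k ξ
    rw [this, iteratedFDeriv_comp_sub]
    exact SchwartzMap.norm_iteratedFDeriv_le_seminorm ℂ M₀ i _
  set C₀ : ℝ := 1 + d * (|R| + 2 * Real.pi) ^ 2
  have hC₀ : 0 ≤ C₀ := by positivity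
  have hB0 : ∀ i, 0 ≤ B i := fun i => apply_nonneg _ _
  set C : ℝ := C₀ ^ M * ∑ i ∈ Finset.range (b + 1), (b.choose i : ℝ) * B i * 2 ^ (a + 2 * M)
  have hC : 0 ≤ C := mul_nonneg (by positivity) (Finset.sum_nonneg fun i _ =>
    mul_nonneg (mul_nonneg (by positivity) (hB0 i)) (by positivity))
  refine ⟨C, hC, fun k ψ => ?_⟩
  set S := ((Finset.Iic (a + 2 * M, b)).sup
    (schwartzSeminormFamily ℂ (EuclideanSpace ℝ (Fin d)) ℂ)) ψ
  have hS : 0 ≤ S := apply_nonneg _ _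
  have hk : 0 < latSq k ^ M := pow_pos (latSq_pos k) M
  rw [mul_comm, ← le_div_iff₀ hk]
  refine SchwartzMap.seminorm_le_bound ℂ _ _ _ (by positivity) fun ξ => ?_
  rw [le_div_iff₀ hk]
  rw [SchwartzMap.smulLeftCLM_apply (latSymbol hρ hR k).hasTemperateGrowth]
  by_cases hξ : ξ ∈ tsupport (latSymbol hρ hR k)
  · have h1 := latSq_le_of_mem (tsupport_latSymbol_subset hρ hR k hξ)
    have h2 : latSq k ^ M ≤ C₀ ^ M * (1 + ‖ξ‖) ^ (2 * M) := by
      rw [pow_mul, ← mul_pow]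
      exact pow_le_pow_left₀ (latSq_pos k).le h1 M
    have h3 := norm_iteratedFDeriv_smul_le (𝕜 := ℝ) ((latSymbol hρ hR k).smooth ⊤) (ψ.smooth ⊤) ξ
      (n := b) (mod_cast le_top)
    have h4 : ∀ i ∈ Finset.range (b + 1), (1 + ‖ξ‖) ^ (a + 2 * M) *
        ‖iteratedFDeriv ℝ (b - i) ψ ξ‖ ≤ 2 ^ (a + 2 * M) * S := fun i _ =>
      SchwartzMap.one_add_le_sup_seminorm_apply (𝕜 := ℂ) (m := (a + 2 * M, b)) le_rfl
        (Nat.sub_le _ _) ψ ξ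
    calc ‖ξ‖ ^ a * ‖iteratedFDeriv ℝ b (fun x => latSymbol hρ hR k x • ψ x) ξ‖ * latSq k ^ M
        ≤ (1 + ‖ξ‖) ^ a * (∑ i ∈ Finset.range (b + 1), (b.choose i : ℝ) * B i *
            ‖iteratedFDeriv ℝ (b - i) ψ ξ‖) * (C₀ ^ M * (1 + ‖ξ‖) ^ (2 * M)) := by
          refine mul_le_mul (mul_le_mul (pow_le_pow_left₀ (norm_nonneg _) (by linarith) a)
            (h3.trans (Finset.sum_le_sum fun i _ => ?_)) (norm_nonneg _) (by positivity)) h2 hk.le ?_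
          · gcongr
            exact hB i k ξ
          · exact mul_nonneg (by positivity) (Finset.sum_nonneg fun i _ =>
              mul_nonneg (mul_nonneg (by positivity) (hB0 i)) (norm_nonneg _))
      _ = C₀ ^ M * ∑ i ∈ Finset.range (b + 1), (b.choose i : ℝ) * B i *
            ((1 + ‖ξ‖) ^ (a + 2 * M) * ‖iteratedFDeriv ℝ (b - i) ψ ξ‖) := by
          rw [Finset.mul_sum, Finset.mul_sum, Finset.sum_mul]
          refine Finset.sum_congr rfl fun i _ => ?_
          rw [pow_add]; ring
      _ ≤ C₀ ^ M * ∑ i ∈ Finset.range (b + 1), (b.choose i : ℝ) * B i * (2 ^ (a + 2 * M) * S) := by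
          exact mul_le_mul_of_nonneg_left (Finset.sum_le_sum fun i hi =>
            mul_le_mul_of_nonneg_left (h4 i hi) (mul_nonneg (by positivity) (hB0 i)))
            (by positivity)
      _ = C * S := by
          simp only [C]
          rw [mul_assoc, Finset.sum_mul]
          congr 1
          exact Finset.sum_congr rfl fun i _ => by ring
  · have h0 : (fun x => latSymbol hρ hR k x • ψ x) =ᶠ[nhds ξ] fun _ => 0 := by
      filter_upwards [notMem_tsupport_iff_eventuallyEq.1 hξ] with x hx
      rw [hx]; simp
    rw [(h0.iteratedFDeriv ℝ b).eq_of_nhds]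
    have : iteratedFDeriv ℝ b (fun _ : EuclideanSpace ℝ (Fin d) => (0 : ℂ)) ξ = 0 := by
      simp
    rw [this, norm_zero, mul_zero, zero_mul]
    positivity

/-- A continuous seminorm of `𝓢` decays rapidly along the frequency decomposition. -/
lemma exists_continuousSeminorm_le (q : Seminorm ℂ 𝓢(EuclideanSpace ℝ (Fin d), ℂ))
    (hq : Continuous q) (M : ℕ) : ∃ (s : Finset (ℕ × ℕ)) (C : ℝ≥0),
    ∀ (k : Fin d → ℤ) (φ : 𝓢(EuclideanSpace ℝ (Fin d), ℂ)),
      q (SchwartzMap.smulLeftCLM ℂ (latSymbol hρ hR k) (𝓕⁻ φ)) ≤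
        (latSq k ^ M)⁻¹ * (C * s.sup (schwartzSeminormFamily ℂ (EuclideanSpace ℝ (Fin d)) ℂ) φ) := by
  obtain ⟨s₁, C₁, _, h₁⟩ := Seminorm.bound_of_continuous (schwartz_withSeminorms ℂ _ ℂ) q hq
  choose C₂ hC₂ h₂ using fun m : ℕ × ℕ => exists_seminorm_latSymbol_le (d := d) hρ hR M m.1 m.2
  have h₃ : ∀ m : ℕ × ℕ, ∃ (s : Finset (ℕ × ℕ)) (C : ℝ≥0), ∀ φ : 𝓢(EuclideanSpace ℝ (Fin d), ℂ),
      ((Finset.Iic (m.1 + 2 * M, m.2)).sup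
        (schwartzSeminormFamily ℂ (EuclideanSpace ℝ (Fin d)) ℂ)) (𝓕⁻ φ) ≤
          C * s.sup (schwartzSeminormFamily ℂ (EuclideanSpace ℝ (Fin d)) ℂ) φ := by
    intro m
    obtain ⟨s, C, _, h⟩ := Seminorm.bound_of_continuous (schwartz_withSeminorms ℂ _ ℂ)
      ((((Finset.Iic (m.1 + 2 * M, m.2)).sup
        (schwartzSeminormFamily ℂ (EuclideanSpace ℝ (Fin d)) ℂ))).comp
        (FourierTransform.fourierInvCLM ℂ 𝓢(EuclideanSpace ℝ (Fin d), ℂ)).toLinearMap)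
      ((Seminorm.continuous_finsetSup fun i _ =>
        (schwartz_withSeminorms ℂ _ ℂ).continuous_seminorm i).comp
        (FourierTransform.fourierInvCLM ℂ 𝓢(EuclideanSpace ℝ (Fin d), ℂ)).continuous)
    exact ⟨s, C, fun φ => h φ⟩
  choose s₃ C₃ h₃ using h₃
  refine ⟨s₁.biUnion s₃, C₁ * ∑ m ∈ s₁, (C₂ m).toNNReal * C₃ m, fun k φ => ?_⟩
  set S := (s₁.biUnion s₃).sup (schwartzSeminormFamily ℂ (EuclideanSpace ℝ (Fin d)) ℂ) φ
  set χ := SchwartzMap.smulLeftCLM ℂ (latSymbol hρ hR k) (𝓕⁻ φ)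
  have hk : 0 < latSq k ^ M := pow_pos (latSq_pos k) M
  have h4 : ∀ m ∈ s₁, schwartzSeminormFamily ℂ (EuclideanSpace ℝ (Fin d)) ℂ m χ ≤
      (latSq k ^ M)⁻¹ * (((C₂ m).toNNReal * C₃ m : ℝ≥0) * S) := by
    intro m hm
    have h5 : (s₃ m).sup (schwartzSeminormFamily ℂ (EuclideanSpace ℝ (Fin d)) ℂ) φ ≤ S :=
      Seminorm.le_def.1 (Finset.sup_mono (Finset.subset_biUnion_of_mem s₃ hm)) φ
    rw [inv_mul_eq_div, le_div_iff₀ hk, mul_comm]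
    refine (h₂ m k _).trans ?_
    rw [NNReal.coe_mul, Real.coe_toNNReal _ (hC₂ m), mul_assoc]
    exact mul_le_mul_of_nonneg_left ((h₃ m φ).trans
      (mul_le_mul_of_nonneg_left h5 (C₃ m).2)) (hC₂ m)
  calc q χ ≤ C₁ * s₁.sup (schwartzSeminormFamily ℂ (EuclideanSpace ℝ (Fin d)) ℂ) χ := h₁ χ
    _ ≤ C₁ * ∑ m ∈ s₁, schwartzSeminormFamily ℂ (EuclideanSpace ℝ (Fin d)) ℂ m χ := by
        refine mul_le_mul_of_nonneg_left ?_ C₁.2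
        exact Seminorm.finset_sup_apply_le (Finset.sum_nonneg fun m _ => apply_nonneg _ _)
          fun m hm => Finset.single_le_sum (f := fun m =>
            schwartzSeminormFamily ℂ (EuclideanSpace ℝ (Fin d)) ℂ m χ)
            (fun m _ => apply_nonneg _ _) hm
    _ ≤ C₁ * ∑ m ∈ s₁, (latSq k ^ M)⁻¹ * (((C₂ m).toNNReal * C₃ m : ℝ≥0) * S) :=
        mul_le_mul_of_nonneg_left (Finset.sum_le_sum h4) C₁.2
    _ = _ := by
        rw [← Finset.mul_sum, ← Finset.sum_mul]
        push_cast
        ring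

end Decay

/-! ### Convergence of the frequency decomposition -/

section Resolution

open FourierTransform

variable {d : ℕ} {ρ : ℝ → ℝ} (hρ : ContDiff ℝ ∞ ρ) {R : ℝ} (hR : ∀ t, R ≤ |t| → ρ t = 0)

/-- The L¹ norm of the Fourier transform is a continuous seminorm on Schwartz functions. -/
lemma exists_integral_dualMul_latSymbol_le (M : ℕ) : ∃ (s : Finset (ℕ × ℕ)) (C : ℝ≥0),
    ∀ (k : Fin d → ℤ) (φ : 𝓢(EuclideanSpace ℝ (Fin d), ℂ)),
      ∫ x, ‖dualMul (latSymbol hρ hR k) φ x‖ ≤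
        (latSq k ^ M)⁻¹ * (C * s.sup (schwartzSeminormFamily ℂ (EuclideanSpace ℝ (Fin d)) ℂ) φ) := by
  set T := (SchwartzMap.toLpCLM ℂ ℂ 1 (volume : Measure (EuclideanSpace ℝ (Fin d)))).comp
    (FourierTransform.fourierCLM ℂ 𝓢(EuclideanSpace ℝ (Fin d), ℂ))
  obtain ⟨s, C, h⟩ := exists_continuousSeminorm_le (d := d) hρ hR
    ((normSeminorm ℂ _).comp T.toLinearMap) (continuous_norm.comp T.continuous) M
  refine ⟨s, C, fun k φ => le_of_eq_of_le ?_ (h k φ)⟩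
  change _ = ‖(dualMul (latSymbol hρ hR k) φ).toLp 1 volume‖
  rw [SchwartzMap.norm_toLp_one]

/-- The slices of the partition of unity converge to the identity on Schwartz functions. -/
lemma hasSum_smulLeftCLM_thin {η : ℝ → ℝ} (hη : IsBump η)
    (ψ : 𝓢(EuclideanSpace ℝ (Fin d), ℂ)) :
    HasSum (fun k : Fin d → ℤ => SchwartzMap.smulLeftCLM ℂ
      (prodSymbol fun i => thinC hη (k i)) ψ) ψ := by
  classical
  rw [HasSum, SummationFilter.unconditional_filter]
  rw [(schwartz_withSeminorms ℂ (EuclideanSpace ℝ (Fin d)) ℂ).tendsto_nhds]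
  rintro ⟨a, b⟩ ε hε
  set χ : (Fin d → ℤ) → 𝓢(EuclideanSpace ℝ (Fin d), ℂ) := fun k =>
    SchwartzMap.smulLeftCLM ℂ (prodSymbol fun i => thinC hη (k i)) ψ
  have hχ : ∀ k ξ, χ k ξ = ((∏ i, thin η (2 * Real.pi * ξ i - k i) : ℝ) : ℂ) * ψ ξ := by
    intro k ξ
    simp only [χ]
    rw [SchwartzMap.smulLeftCLM_apply_apply (SchwartzMap.hasTemperateGrowth _)]
    rfl
  obtain ⟨C, hC, hle⟩ := exists_seminorm_latSymbol_le (d := d) (contDiff_thin hη) (R := 1)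
    (fun t ht => thin_eq_zero hη ht) d a b
  have hsum : Summable fun k => SchwartzMap.seminorm ℂ a b (χ k) := by
    refine ((summable_latSq d).mul_right (C * ((Finset.Iic (a + 2 * d, b)).sup
      (schwartzSeminormFamily ℂ (EuclideanSpace ℝ (Fin d)) ℂ)) ψ)).of_nonneg_of_le
      (fun k => apply_nonneg _ _) fun k => ?_
    have hk : 0 < latSq k ^ d := pow_pos (latSq_pos k) d
    rw [inv_mul_eq_div, le_div_iff₀ hk, mul_comm]
    exact hle k ψ
  obtain ⟨S₀, hS₀⟩ := summable_iff_vanishing_norm.1 hsum (ε / 2) (half_pos hε)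
  filter_upwards [Filter.eventually_ge_atTop S₀] with S hS
  refine lt_of_le_of_lt ?_ (half_lt_self hε)
  change SchwartzMap.seminorm ℂ a b _ ≤ _
  refine SchwartzMap.seminorm_le_bound ℂ _ _ _ (half_pos hε).le fun ξ => ?_
  set P := Fintype.piFinset fun i => nearInts (2 * Real.pi * ξ i)
  -- Near ξ the finite sum over `P ∪ S` is already ψ. The error is thus a finite sum over indices
  -- outside `S`, which the Cauchy criterion for the seminorms bounds independently of ξ.
  have hnear : (fun ξ' => (∑ k ∈ S, χ k - ψ) ξ') =ᶠ[nhds ξ]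
      fun ξ' => (-∑ k ∈ (P ∪ S) \ S, χ k) ξ' := by
    have h1 : ∀ᶠ ξ' in nhds ξ, ∀ i, |2 * Real.pi * ξ' i - 2 * Real.pi * ξ i| < 1 := by
      rw [Filter.eventually_all]
      intro i
      have : Continuous fun ξ' : EuclideanSpace ℝ (Fin d) =>
        |2 * Real.pi * ξ' i - 2 * Real.pi * ξ i| := by fun_prop
      exact this.continuousAt.eventually_lt continuousAt_const (by simp)
    filter_upwards [h1] with ξ' hξ'
    have h2 : ∑ k ∈ P ∪ S, ∏ i, thin η (2 * Real.pi * ξ' i - k i) = 1 := by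
      have h3 : ∑ k ∈ P, ∏ i, thin η (2 * Real.pi * ξ' i - k i) = 1 := by
        rw [← Finset.prod_univ_sum (fun i => nearInts (2 * Real.pi * ξ i))
          (fun i j => thin η (2 * Real.pi * ξ' i - j))]
        refine Finset.prod_eq_one fun i _ => sum_thin hη fun j hj => mem_nearInts ?_
        have := abs_sub_le (2 * Real.pi * ξ i) (2 * Real.pi * ξ' i) j
        rw [abs_sub_comm (2 * Real.pi * ξ i) (2 * Real.pi * ξ' i)] at this
        linarith [hξ' i]
      rw [← h3]
      refine (Finset.sum_subset Finset.subset_union_left fun k _ hk => ?_).symm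
      simp only [P, Fintype.mem_piFinset, not_forall] at hk
      obtain ⟨i, hi⟩ := hk
      refine Finset.prod_eq_zero (Finset.mem_univ i) (thin_eq_zero hη ?_)
      by_contra! hlt
      refine hi (mem_nearInts ?_)
      have := abs_sub_le (2 * Real.pi * ξ i) (2 * Real.pi * ξ' i) (k i : ℝ)
      rw [abs_sub_comm (2 * Real.pi * ξ i) (2 * Real.pi * ξ' i)] at this
      linarith [hξ' i]
    have h4 : ∑ k ∈ P ∪ S, χ k ξ' = ψ ξ' := by
      simp only [hχ]
      rw [← Finset.sum_mul, ← Complex.ofReal_sum, h2]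
      simp
    have h5 := Finset.sum_sdiff (f := fun k => χ k ξ') (Finset.subset_union_right (s₁ := P) (s₂ := S))
    simp only [sub_apply, neg_apply, sum_apply]
    rw [← h4, ← h5]
    ring
  have h6 : iteratedFDeriv ℝ b (∑ k ∈ S, χ k - ψ) ξ =
      iteratedFDeriv ℝ b (-∑ k ∈ (P ∪ S) \ S, χ k : 𝓢(EuclideanSpace ℝ (Fin d), ℂ)) ξ :=
    (hnear.iteratedFDeriv ℝ b).eq_of_nhds
  rw [h6]
  refine (SchwartzMap.le_seminorm ℂ a b _ ξ).trans ?_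
  rw [map_neg_eq_map]
  have h7 := hS₀ ((P ∪ S) \ S) (Finset.sdiff_disjoint.mono_right hS)
  refine (Finset.le_sum_of_subadditive _ (map_zero _).le (map_add_le_add _) _ _).trans ((le_abs_self _).trans h7.le)

lemma hasSum_dualMul_thin {η : ℝ → ℝ} (hη : IsBump η) (Φ : 𝓢(EuclideanSpace ℝ (Fin d), ℂ)) :
    HasSum (fun k : Fin d → ℤ => dualMul (prodSymbol fun i => thinC hη (k i)) Φ) Φ := by
  have h := (hasSum_smulLeftCLM_thin hη (𝓕⁻ Φ)).mapL
    (FourierTransform.fourierCLM ℂ 𝓢(EuclideanSpace ℝ (Fin d), ℂ))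
  have h2 : FourierTransform.fourierCLM ℂ 𝓢(EuclideanSpace ℝ (Fin d), ℂ) (𝓕⁻ Φ) = Φ :=
    by rw [FourierTransform.fourierCLM_apply, fourier_fourierInv_eq]
  rw [h2] at h
  exact h

lemma hasSum_box_apply {η : ℝ → ℝ} (hη : IsBump η) (f : 𝓢'(EuclideanSpace ℝ (Fin d), ℂ))
    (Φ : 𝓢(EuclideanSpace ℝ (Fin d), ℂ)) : HasSum (fun k => box η k f Φ) (f Φ) := by
  simp only [box_apply hη]
  exact (hasSum_dualMul_thin hη Φ).mapL f

end Resolution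

/-! ### Sequence quasi-norms with exponent at most 1 -/

section Sequences

variable {ι : Type*}

lemma rpow_tsum_le (a : ι → ℝ≥0∞) {r : ℝ} (hr : 0 < r) (hr1 : r ≤ 1) :
    (∑' i, a i) ^ r ≤ ∑' i, a i ^ r := by
  have hfin : ∀ s : Finset ι, (∑ i ∈ s, a i) ^ r ≤ ∑ i ∈ s, a i ^ r := fun s =>
    Finset.le_sum_of_subadditive (fun x : ℝ≥0∞ => x ^ r) (by simp [hr])
      (fun x y => ENNReal.rpow_add_le_add_rpow x y hr.le hr1) s a
  have h := (ENNReal.continuous_rpow_const (y := r)).tendsto (∑' i, a i) |>.comp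
    ENNReal.summable.hasSum
  exact le_of_tendsto h (Filter.Eventually.of_forall fun s => (hfin s).trans (ENNReal.sum_le_tsum s))

variable [MeasurableSpace ι] [MeasurableSingletonClass ι]

lemma eLpNorm_count_eq_tsum {r : ℝ≥0∞} (h0 : r ≠ 0) (ht : r ≠ ⊤) (a : ι → ℝ≥0∞) :
    eLpNorm a r Measure.count = (∑' i, a i ^ r.toReal) ^ (1 / r.toReal) := by
  rw [eLpNorm_eq_lintegral_rpow_enorm_toReal h0 ht, lintegral_count]
  simp

/-- The embedding of ℓ^r in ℓ^1, which provides summability in the last frequency index. -/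
lemma tsum_le_eLpNorm_count {r : ℝ≥0∞} (h0 : r ≠ 0) (h1 : r ≤ 1) (a : ι → ℝ≥0∞) :
    ∑' i, a i ≤ eLpNorm a r Measure.count := by
  have ht : r ≠ ⊤ := (h1.trans_lt ENNReal.one_lt_top).ne
  have hr : 0 < r.toReal := ENNReal.toReal_pos h0 ht
  rw [eLpNorm_count_eq_tsum h0 ht, one_div, ENNReal.le_rpow_inv_iff hr]
  exact rpow_tsum_le a hr (by simpa using ENNReal.toReal_mono ENNReal.one_ne_top h1)

end Sequences

/-! ### Localized functions and their uniform bounds -/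

section Pieces

variable {d : ℕ} {η : ℝ → ℝ}

/-- The symbol of `□_k` as a Schwartz function. -/
noncomputable def thinSymbol (hη : IsBump η) (k : Fin d → ℤ) : 𝓢(EuclideanSpace ℝ (Fin d), ℂ) :=
  prodSymbol fun i => thinC hη (k i)

/-- A symbol equal to `1` on the support of the symbol of `□_k`. -/
noncomputable def fatSymbol (hη : IsBump η) (k : Fin d → ℤ) : 𝓢(EuclideanSpace ℝ (Fin d), ℂ) :=
  prodSymbol fun i => fatC hη (k i)

/-- `h` is a smooth function with frequencies near the lattice point `k`. -/
structure Localized (hη : IsBump η) (k : Fin d → ℤ) (h : EuclideanSpace ℝ (Fin d) → ℂ) :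
    Prop where
  continuous : Continuous h
  tempered : Tempered fun x => ‖h x‖ₑ
  reproducing : ∀ x, h x = kconv (symKernel (fatSymbol hη k)) h x

lemma box_dualMul_eq (hη : IsBump η) (k : Fin d → ℤ) (f : 𝓢'(EuclideanSpace ℝ (Fin d), ℂ))
    {M : 𝓢(EuclideanSpace ℝ (Fin d), ℂ)} (hM : ∀ ξ, thinSymbol hη k ξ * M ξ = thinSymbol hη k ξ)
    (Φ : 𝓢(EuclideanSpace ℝ (Fin d), ℂ)) : box η k f (dualMul M Φ) = box η k f Φ := by
  rw [box_apply hη, box_apply hη,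
    dualMul_dualMul (SchwartzMap.hasTemperateGrowth _) (SchwartzMap.hasTemperateGrowth _)]
  congr 2
  exact congrArg _ (funext hM)

/-- The factorized symbol `M` depends on k without control and only supplies regularity. The
reproducing formula uses the fat symbol, whose kernels are uniformly bounded. -/
lemma exists_localized (hη : IsBump η) (k : Fin d → ℤ) {f : 𝓢'(EuclideanSpace ℝ (Fin d), ℂ)}
    {p : ℝ≥0∞} (h : distLp p (box η k f) ≠ ⊤) :
    ∃ h, IsRepresentedBy (box η k f) h ∧ Localized hη k h := by
  obtain ⟨g, hg⟩ := exists_isRepresentedBy h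
  have hc : HasCompactSupport (thinSymbol hη k) :=
    (hasCompactSupport_prodCutoff fun i => thinC hη (k i)).comp_left
      (g := ((↑) : ℝ → ℂ)) Complex.ofReal_zero
  obtain ⟨R, hR0, hR⟩ := hc.isCompact.isBounded.exists_pos_norm_le
  obtain ⟨M, K₁, K₂, hM, hK⟩ := exists_factorized_symbol (V := EuclideanSpace ℝ (Fin d)) R hR0
  have hM' : ∀ ξ, thinSymbol hη k ξ * M ξ = thinSymbol hη k ξ := by
    intro ξ
    by_cases hξ : ξ ∈ tsupport (thinSymbol hη k)
    · rw [hM ξ (hR ξ hξ), mul_one]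
    · rw [image_eq_zero_of_notMem_tsupport hξ, zero_mul]
  obtain ⟨h, h1, h2, h3, h4⟩ := exists_reproducing (M' := fatSymbol hη k) hg hK
    (box_dualMul_eq hη k f hM') (box_dualMul_eq hη k f (prodSymbol_thin_mul_fat hη k))
  exact ⟨h, h1, h2, h3, h4⟩

/-- Localized functions are controlled by their weighted averages, uniformly in the position. -/
lemma exists_enorm_le_wAvg (hη : IsBump η) (d : ℕ) : ∃ A : ℕ → ℝ≥0,
    ∀ (k : Fin d → ℤ) (h : EuclideanSpace ℝ (Fin d) → ℂ), Localized hη k h →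
      ∀ (L : ℕ) y, ‖h y‖ₑ ≤ A L * wAvg L (fun x => ‖h x‖ₑ) y := by
  obtain ⟨C, hC⟩ := exists_symKernel_dilate_le (ρ := η) hη.smooth (R := 2)
    (fun t ht => hη.eq_zero t ht) d
  refine ⟨C, fun k h hh L y => ?_⟩
  conv_lhs => rw [hh.reproducing y]
  refine (enorm_integral_le_lintegral_enorm _).trans ?_
  unfold wAvg
  rw [← lintegral_const_mul' _ _ ENNReal.coe_ne_top]
  refine lintegral_mono fun z => ?_
  rw [enorm_mul, ← mul_assoc]
  exact mul_le_mul_left (hC L k _) _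

/-- The estimates of Nikolskii and of trace type for localized functions. -/
lemma exists_localized_bounds (hη : IsBump η) (d : ℕ) {p : ℝ≥0∞} (hp : 0 < p) :
    ∃ (L : ℕ) (C : ℝ≥0), ∀ (k : Fin (d + 1) → ℤ) (h : EuclideanSpace ℝ (Fin (d + 1)) → ℂ),
      Localized hη k h → eLpNorm h p volume ≠ ⊤ →
      (∀ x, ‖h x‖ₑ ≤ C * eLpNorm h p volume) ∧
      (∀ x, wAvg L (fun x => ‖h x‖ₑ) x ≤ C * eLpNorm h p volume) ∧
      ∀ t, eLpNorm (fun x => wAvg L (fun x => ‖h x‖ₑ) (joinLast t x)) p volume ≤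
        C * eLpNorm h p volume := by
  obtain ⟨A, hA⟩ := exists_enorm_le_wAvg hη (d + 1)
  obtain ⟨L, C, h⟩ := exists_wAvg_eLpNorm_le (d := d) hp A
  -- `A L * C` is for the supremum bound, obtained from |h| ≤ `A L` times its average; `C` is for
  -- the two bounds on averages.
  refine ⟨L, max C (A L * C), fun k g hg hfin => ?_⟩
  obtain ⟨h1, h2⟩ := h (fun x => ‖g x‖ₑ) hg.continuous.enorm.measurable hg.tempered
    (hA k g hg) (by rwa [eLpNorm_enorm])
  rw [eLpNorm_enorm] at h1 h2
  have hmax : (C : ℝ≥0∞) ≤ (max C (A L * C) : ℝ≥0) := by exact_mod_cast le_max_left _ _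
  refine ⟨fun x => ?_, fun x => (h1 x).trans (mul_le_mul_left hmax _),
    fun t => (h2 t).trans (mul_le_mul_left hmax _)⟩
  refine (hA k g hg L x).trans ((mul_le_mul_right (h1 x) _).trans ?_)
  rw [← mul_assoc]
  exact mul_le_mul_left (by exact_mod_cast le_max_right _ _) _

end Pieces

/-! ### Frequencies of slices -/

section Slices

variable {d : ℕ}

lemma continuous_joinLast_right (t : ℝ) : Continuous fun x : EuclideanSpace ℝ (Fin d) => joinLast t x :=
  continuous_joinLast.comp (by fun_prop : Continuous fun x => (t, x))

/-- Convolving a slice of a convolution in the slice variable multiplies the symbols. -/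
lemma kconv_slice_kconv {M₁ M : 𝓢(EuclideanSpace ℝ (Fin d), ℂ)} {ρ : Fin d → Cutoff} (σ : Cutoff)
    (hM : ∀ ξ, M₁ ξ * prodSymbol ρ ξ = M ξ) {h : EuclideanSpace ℝ (Fin (d + 1)) → ℂ}
    (hc : Continuous h) {B : ℝ} (hB : ∀ y, ‖h y‖ ≤ B)
    (t : ℝ) (x : EuclideanSpace ℝ (Fin d)) :
    kconv (symKernel M₁) (fun z => kconv (symKernel (prodSymbol
        (Fin.snoc ρ σ : Fin (d + 1) → Cutoff))) h (joinLast t z)) x =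
      ∫ y, symKernel M (x - initE y) * symKernel σ.schwartz (t - y (Fin.last d)) * h y := by
  obtain ⟨K, hKdef, hK⟩ : ∃ K : 𝓢(EuclideanSpace ℝ (Fin (d + 1)), ℂ),
      symKernel (prodSymbol (Fin.snoc ρ σ : Fin (d + 1) → Cutoff)) = K ∧ ∀ z y, K (joinLast t z - y) =
        symKernel (prodSymbol ρ) (z - initE y) * symKernel σ.schwartz (t - y (Fin.last d)) := by
    refine ⟨_, rfl, fun z y => ?_⟩
    rw [← symKernel_snoc]
    congr 1
    ext i
    refine Fin.lastCases ?_ (fun j => ?_) i <;> simp [joinLast, initE]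
  rw [hKdef]
  have hmeas : Continuous fun w : EuclideanSpace ℝ (Fin d) × EuclideanSpace ℝ (Fin (d + 1)) =>
      symKernel M₁ (x - w.1) * (K (joinLast t w.1 - w.2) * h w.2) := by
    have h1 : Continuous fun w : EuclideanSpace ℝ (Fin d) × EuclideanSpace ℝ (Fin (d + 1)) =>
        joinLast t w.1 := (continuous_joinLast_right t).comp continuous_fst
    exact ((symKernel M₁).continuous.comp (continuous_const.sub continuous_fst)).mul
      ((K.continuous.comp (h1.sub continuous_snd)).mul (hc.comp continuous_snd))
  have hKi : ∀ z, Integrable fun y => K (joinLast t z - y) := fun z =>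
    (K.integrable (μ := volume)).comp_sub_left _
  have hKh : ∀ z, Integrable fun y => K (joinLast t z - y) * h y := fun z =>
    (hKi z).mul_bdd hc.aestronglyMeasurable (Filter.Eventually.of_forall hB)
  have hI : Integrable (fun w : EuclideanSpace ℝ (Fin d) × EuclideanSpace ℝ (Fin (d + 1)) =>
      symKernel M₁ (x - w.1) * (K (joinLast t w.1 - w.2) * h w.2)) (volume.prod volume) := by
    rw [integrable_prod_iff hmeas.aestronglyMeasurable]
    refine ⟨Filter.Eventually.of_forall fun z => (hKh z).const_mul (symKernel M₁ (x - z)), ?_⟩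
    have h2 : Integrable fun z => ‖symKernel M₁ (x - z)‖ * ((∫ y, ‖K y‖) * B) :=
      (((symKernel M₁).integrable (μ := volume)).comp_sub_left x).norm.mul_const _
    refine h2.mono' ?_ (Filter.Eventually.of_forall fun z => ?_)
    · exact hmeas.norm.aestronglyMeasurable.integral_prod_right'
    · rw [Real.norm_of_nonneg (integral_nonneg fun _ => norm_nonneg _)]
      simp only [norm_mul]
      rw [integral_const_mul]
      refine mul_le_mul_of_nonneg_left ?_ (norm_nonneg _)
      rw [← integral_sub_left_eq_self (fun y => ‖K y‖) volume (joinLast t z), ← integral_mul_const]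
      refine integral_mono_of_nonneg (Filter.Eventually.of_forall fun _ => by positivity)
        ((hKi z).norm.mul_const _) (Filter.Eventually.of_forall fun y => ?_)
      exact mul_le_mul_of_nonneg_left (hB y) (norm_nonneg _)
  calc kconv (symKernel M₁) (fun z => kconv K h (joinLast t z)) x
      = ∫ z, ∫ y, symKernel M₁ (x - z) * (K (joinLast t z - y) * h y) := by
        unfold kconv
        refine integral_congr_ae (Filter.Eventually.of_forall fun z => ?_)
        simp only
        rw [integral_const_mul]
    _ = ∫ y, ∫ z, symKernel M₁ (x - z) * (K (joinLast t z - y) * h y) :=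
        integral_integral_swap hI
    _ = _ := by
        refine integral_congr_ae (Filter.Eventually.of_forall fun y => ?_)
        simp only
        rw [← integral_symKernel_mul hM, ← integral_mul_const, ← integral_mul_const]
        refine integral_congr_ae (Filter.Eventually.of_forall fun z => ?_)
        simp only [hK]
        ring

/-- Used in two ways: with `M₁` equal to 1 on the support of ρ it shows that the slice is
reproduced, and with `M = 0` that the slice has no frequencies near the cube of `M₁`. -/
lemma kconv_slice {M₁ M : 𝓢(EuclideanSpace ℝ (Fin d), ℂ)} {ρ : Fin d → Cutoff} (σ : Cutoff)
    (hM : ∀ ξ, M₁ ξ * prodSymbol ρ ξ = M ξ) {h : EuclideanSpace ℝ (Fin (d + 1)) → ℂ}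
    (hc : Continuous h) {B : ℝ} (hB : ∀ y, ‖h y‖ ≤ B)
    (hh : ∀ y, h y = kconv (symKernel (prodSymbol (Fin.snoc ρ σ : Fin (d + 1) → Cutoff))) h y)
    (t : ℝ) (x : EuclideanSpace ℝ (Fin d)) :
    kconv (symKernel M₁) (fun z => h (joinLast t z)) x =
      ∫ y, symKernel M (x - initE y) * symKernel σ.schwartz (t - y (Fin.last d)) * h y := by
  rw [← kconv_slice_kconv σ hM hc hB]
  congr 1
  exact funext fun z => hh _

end Slices

/-! ### Pairing slices with Schwartz functions -/

section SliceBounds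

variable {d : ℕ}

/-- The isometric embedding `x ↦ (x, 0)`. -/
noncomputable def joinL (d : ℕ) :
    EuclideanSpace ℝ (Fin d) →ₗᵢ[ℝ] EuclideanSpace ℝ (Fin (d + 1)) where
  toFun := joinLast 0
  map_add' x y := by
    ext i
    refine Fin.lastCases ?_ (fun j => ?_) i <;> simp [joinLast]
  map_smul' c x := by
    ext i
    refine Fin.lastCases ?_ (fun j => ?_) i <;> simp [joinLast]
  norm_map' x := by
    change ‖joinLast 0 x‖ = ‖x‖
    simp [EuclideanSpace.norm_eq, joinLast, Fin.sum_univ_castSucc]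

lemma joinLast_eq_add (t : ℝ) (x : EuclideanSpace ℝ (Fin d)) :
    joinLast t x = joinL d x + joinLast t 0 := by
  ext i
  refine Fin.lastCases ?_ (fun j => ?_) i <;> simp [joinLast, joinL]

lemma norm_le_norm_joinLast (t : ℝ) (x : EuclideanSpace ℝ (Fin d)) : ‖x‖ ≤ ‖joinLast t x‖ := by
  conv_lhs => rw [← initE_joinLast t x]
  exact norm_initE_le _

lemma norm_iteratedFDeriv_comp_joinLast_le {f : EuclideanSpace ℝ (Fin (d + 1)) → ℂ}
    (hf : ContDiff ℝ ∞ f) (b : ℕ) (t : ℝ) (x : EuclideanSpace ℝ (Fin d)) :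
    ‖iteratedFDeriv ℝ b (fun x => f (joinLast t x)) x‖ ≤
      ‖iteratedFDeriv ℝ b f (joinLast t x)‖ := by
  have h1 : (fun x => f (joinLast t x)) =
      (fun y => f (y + joinLast t 0)) ∘ (joinL d).toContinuousLinearMap := by
    funext x
    simp [joinLast_eq_add t x]
  have h2 : ContDiff ℝ ∞ fun y => f (y + joinLast t 0) := hf.comp (contDiff_id.add contDiff_const)
  rw [h1, ContinuousLinearMap.iteratedFDeriv_comp_right _ h2 _ (mod_cast le_top)]
  refine (ContinuousMultilinearMap.norm_compContinuousLinearMap_le _ _).trans ?_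
  rw [iteratedFDeriv_comp_add_right]
  have h3 : ∏ _i : Fin b, ‖(joinL d).toContinuousLinearMap‖ ≤ 1 :=
    Finset.prod_le_one (fun _ _ => norm_nonneg _) fun _ _ =>
      (joinL d).norm_toContinuousLinearMap_le
  rw [joinLast_eq_add t x]
  exact mul_le_of_le_one_right (norm_nonneg _) h3

lemma slice_apply (t : ℝ) (Φ : 𝓢(EuclideanSpace ℝ (Fin (d + 1)), ℂ))
    (x : EuclideanSpace ℝ (Fin d)) : slice t Φ x = Φ (joinLast t x) := rfl

lemma seminorm_slice_le (m : ℕ × ℕ) (t : ℝ) (Φ : 𝓢(EuclideanSpace ℝ (Fin (d + 1)), ℂ)) :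
    schwartzSeminormFamily ℂ (EuclideanSpace ℝ (Fin d)) ℂ m (slice t Φ) ≤
      schwartzSeminormFamily ℂ (EuclideanSpace ℝ (Fin (d + 1))) ℂ m Φ := by
  refine SchwartzMap.seminorm_le_bound ℂ _ _ _ (apply_nonneg _ _) fun x => ?_
  refine le_trans ?_ (SchwartzMap.le_seminorm ℂ m.1 m.2 Φ (joinLast t x))
  exact mul_le_mul (pow_le_pow_left₀ (norm_nonneg _) (norm_le_norm_joinLast t x) _)
    (norm_iteratedFDeriv_comp_joinLast_le (Φ.smooth ⊤) m.2 t x) (norm_nonneg _) (by positivity)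

lemma sup_seminorm_slice_le (s : Finset (ℕ × ℕ)) (t : ℝ)
    (Φ : 𝓢(EuclideanSpace ℝ (Fin (d + 1)), ℂ)) :
    s.sup (schwartzSeminormFamily ℂ (EuclideanSpace ℝ (Fin d)) ℂ) (slice t Φ) ≤
      s.sup (schwartzSeminormFamily ℂ (EuclideanSpace ℝ (Fin (d + 1))) ℂ) Φ :=
  Seminorm.finset_sup_apply_le (apply_nonneg _ _) fun m hm =>
    (seminorm_slice_le m t Φ).trans
      (Seminorm.le_def.1 (Finset.le_sup (f := schwartzSeminormFamily ℂ _ ℂ) hm) Φ)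

variable {η : ℝ → ℝ}

lemma contDiff_comp_half (hη : IsBump η) : ContDiff ℝ ∞ fun t => η (t / 2) :=
  hη.smooth.comp (contDiff_id.div_const 2)

lemma comp_half_eq_zero (hη : IsBump η) (t : ℝ) (ht : 4 ≤ |t|) : η (t / 2) = 0 :=
  hη.eq_zero _ (by rw [abs_div, abs_two]; linarith)

/-- η(t/2) is 1 for |t| ≤ 2, and η(t) vanishes for larger |t|. -/
lemma fat_mul (hη : IsBump η) (k : Fin d → ℤ) (ξ : EuclideanSpace ℝ (Fin d)) :
    latSymbol (contDiff_comp_half hη) (comp_half_eq_zero hη) k ξ *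
      prodSymbol (fun i => fatC hη (k i)) ξ = fatSymbol hη k ξ := by
  rw [fatSymbol, latSymbol_apply, prodSymbol_apply, ← Complex.ofReal_mul, ← Finset.prod_mul_distrib]
  congr 1
  refine Finset.prod_congr rfl fun i _ => ?_
  change η ((2 * Real.pi * ξ i - k i) / 2) * η (2 * Real.pi * ξ i - k i) =
    η (2 * Real.pi * ξ i - k i)
  by_cases h : 2 ≤ |2 * Real.pi * ξ i - k i|
  · rw [hη.eq_zero _ h, mul_zero]
  · rw [hη.eq_one, one_mul]
    rw [abs_div, abs_two]; linarith

lemma fatSymbol_eq_snoc (hη : IsBump η) (k : Fin (d + 1) → ℤ) :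
    fatSymbol hη k = prodSymbol (Fin.snoc (fun i => fatC hη (Fin.init k i))
      (fatC hη (k (Fin.last d))) : Fin (d + 1) → Cutoff) := by
  unfold fatSymbol
  congr 1
  funext i
  refine Fin.lastCases ?_ (fun j => ?_) i <;> simp [Fin.init]

/-- A slice of a localized function is localized. -/
lemma Localized.slice_reproducing {hη : IsBump η} {k : Fin (d + 1) → ℤ}
    {h : EuclideanSpace ℝ (Fin (d + 1)) → ℂ} (hh : Localized hη k h) {B : ℝ}
    (hB : ∀ y, ‖h y‖ ≤ B) (t : ℝ) (x : EuclideanSpace ℝ (Fin d)) :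
    kconv (symKernel (latSymbol (contDiff_comp_half hη) (comp_half_eq_zero hη) (Fin.init k)))
      (fun z => h (joinLast t z)) x = h (joinLast t x) := by
  have hr := hh.reproducing
  rw [fatSymbol_eq_snoc] at hr
  rw [kconv_slice _ (fat_mul hη (Fin.init k)) hh.continuous hB hr, hr (joinLast t x)]
  unfold kconv
  refine integral_congr_ae (Filter.Eventually.of_forall fun y => ?_)
  simp only
  rw [fatSymbol, ← symKernel_snoc]
  congr 2
  ext i
  refine Fin.lastCases ?_ (fun j => ?_) i <;> simp [joinLast, initE]

lemma tempered_of_norm_le {h : EuclideanSpace ℝ (Fin d) → ℂ} {B : ℝ} (hB : ∀ y, ‖h y‖ ≤ B) :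
    Tempered fun x => ‖h x‖ₑ := by
  refine ⟨B.toNNReal, 0, fun x => ?_⟩
  simp only [Nat.cast_zero, ENNReal.rpow_zero, mul_one]
  rw [← ofReal_norm]
  exact ENNReal.ofReal_le_ofReal (hB x)

/-- The reproducing multiplier of the slice is moved onto φ, where it leaves a function of L¹ norm
O(`latSq` to the power -M); the slice itself is bounded by Nikolskii's inequality. Nothing is gained
in the last index. -/
lemma exists_slice_pairing_le (hη : IsBump η) (d : ℕ) {p : ℝ≥0∞} (hp : 0 < p) (M : ℕ) :
    ∃ (s : Finset (ℕ × ℕ)) (C : ℝ≥0), ∀ (k : Fin (d + 1) → ℤ)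
      (h : EuclideanSpace ℝ (Fin (d + 1)) → ℂ), Localized hη k h → eLpNorm h p volume ≠ ⊤ →
      ∀ (t : ℝ) (φ : 𝓢(EuclideanSpace ℝ (Fin d), ℂ)),
        ‖∫ x, φ x * h (joinLast t x)‖ ≤ (latSq (Fin.init k) ^ M)⁻¹ * (eLpNorm h p volume).toReal *
          (C * s.sup (schwartzSeminormFamily ℂ (EuclideanSpace ℝ (Fin d)) ℂ) φ) := by
  obtain ⟨L, C₁, h₁⟩ := exists_localized_bounds hη d hp
  obtain ⟨s, C₂, h₂⟩ := exists_integral_dualMul_latSymbol_le (d := d) (contDiff_comp_half hη)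
    (comp_half_eq_zero hη) M
  refine ⟨s, C₁ * C₂, fun k h hh hfin t φ => ?_⟩
  set N := (eLpNorm h p volume).toReal
  have hB : ∀ y, ‖h y‖ ≤ C₁ * N := by
    intro y
    have := ENNReal.toReal_mono (ENNReal.mul_ne_top ENNReal.coe_ne_top hfin)
      ((h₁ k h hh hfin).1 y)
    simpa [N] using this
  have hc : Continuous fun x => h (joinLast t x) := hh.continuous.comp (continuous_joinLast_right t)
  have hrep := hh.slice_reproducing hB t
  set M₂ := latSymbol (contDiff_comp_half hη) (comp_half_eq_zero hη) (Fin.init k)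
  have h3 := (integral_dualMul_eq_of_integrable (M := M₂) (Φ := φ)
    (g := fun x => h (joinLast t x)) (integrable_prod_of_tempered hc.aestronglyMeasurable
      (tempered_of_norm_le fun x => hB _))).2
  simp only [hrep] at h3
  rw [← h3]
  calc ‖∫ y, dualMul M₂ φ y * h (joinLast t y)‖ ≤ ∫ y, ‖dualMul M₂ φ y‖ * (C₁ * N) := by
        refine norm_integral_le_of_norm_le
          ((SchwartzMap.integrable (μ := volume) (dualMul M₂ φ)).norm.mul_const _)
          (Filter.Eventually.of_forall fun y => ?_)
        rw [norm_mul]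
        exact mul_le_mul_of_nonneg_left (hB _) (norm_nonneg _)
    _ ≤ (latSq (Fin.init k) ^ M)⁻¹ *
          (C₂ * s.sup (schwartzSeminormFamily ℂ (EuclideanSpace ℝ (Fin d)) ℂ) φ) * (C₁ * N) := by
        rw [integral_mul_const]
        exact mul_le_mul_of_nonneg_right (h₂ _ φ) (mul_nonneg C₁.2 ENNReal.toReal_nonneg)
    _ = _ := by push_cast; ring

end SliceBounds

/-! ### The weakly continuous family of slices -/

section Family

variable {d : ℕ} {η : ℝ → ℝ}

/-- The functions `h k` represent `□_k f`, are localized, and are summable in the sense of an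
anisotropic modulation space. -/
structure Pieces (hη : IsBump η) (s : ℝ) (p : ℝ≥0∞) (f : 𝓢'(EuclideanSpace ℝ (Fin (d + 1)), ℂ))
    (h : (Fin (d + 1) → ℤ) → EuclideanSpace ℝ (Fin (d + 1)) → ℂ) (b : ℤ → ℝ≥0∞) : Prop where
  rep : ∀ k, IsRepresentedBy (box η k f) (h k)
  loc : ∀ k, Localized hη k (h k)
  bound : ∀ k, weight s (Fin.init k) * eLpNorm (h k) p volume ≤ b (k (Fin.last d))
  summable : ∑' j, b j ≠ ⊤

lemma weight_eq (s : ℝ) (k : Fin d → ℤ) : weight s k = ENNReal.ofReal (latSq k ^ (s / 2)) := rfl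

lemma weight_ne_zero (s : ℝ) (k : Fin d → ℤ) : weight s k ≠ 0 := by
  rw [weight_eq, Ne, ENNReal.ofReal_eq_zero, not_le]
  exact Real.rpow_pos_of_pos (latSq_pos k) _

lemma weight_ne_top (s : ℝ) (k : Fin d → ℤ) : weight s k ≠ ⊤ := ENNReal.ofReal_ne_top

lemma exists_pieces (hη : IsBump η) {s : ℝ} {p q r : ℝ≥0∞} (hq : q ≠ 0) (hr : r ≠ 0) (hr1 : r ≤ 1)
    {f : 𝓢'(EuclideanSpace ℝ (Fin (d + 1)), ℂ)} (hf : anisoNorm η s p q r f < ⊤) :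
    ∃ h b, Pieces hη s p f h b := by
  set b : ℤ → ℝ≥0∞ := fun j => eLpNorm (fun kbar : Fin d → ℤ =>
    weight s kbar * distLp p (box η (Fin.snoc kbar j : Fin (d + 1) → ℤ) f)) q Measure.count
  have hb : ∑' j, b j < ⊤ := (tsum_le_eLpNorm_count hr hr1 b).trans_lt hf
  have h1 : ∀ k : Fin (d + 1) → ℤ,
      weight s (Fin.init k) * distLp p (box η k f) ≤ b (k (Fin.last d)) := by
    intro k
    have := enorm_le_eLpNorm_count (fun kbar : Fin d → ℤ => weight s kbar *
      distLp p (box η (Fin.snoc kbar (k (Fin.last d)) : Fin (d + 1) → ℤ) f)) (Fin.init k) hq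
    simpa only [Fin.snoc_init_self, enorm_eq_self] using this
  have h2 : ∀ k, distLp p (box η k f) ≠ ⊤ := by
    intro k hk
    have h3 := (h1 k).trans (ENNReal.le_tsum _)
    rw [hk, ENNReal.mul_top (weight_ne_zero _ _)] at h3
    exact (hb.trans_le h3).false
  choose h h3 h4 using fun k => exists_localized hη k (h2 k)
  refine ⟨h, b, h3, h4, fun k => ?_, hb.ne⟩
  rw [← distLp_eq (h3 k)]
  exact h1 k

variable {hη : IsBump η} {s : ℝ} {p : ℝ≥0∞} {f : 𝓢'(EuclideanSpace ℝ (Fin (d + 1)), ℂ)}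
  {h : (Fin (d + 1) → ℤ) → EuclideanSpace ℝ (Fin (d + 1)) → ℂ} {b : ℤ → ℝ≥0∞}

lemma Pieces.ne_top (P : Pieces hη s p f h b) (j : ℤ) : b j ≠ ⊤ :=
  ((ENNReal.le_tsum j).trans_lt P.summable.lt_top).ne

lemma Pieces.eLpNorm_ne_top (P : Pieces hη s p f h b) (k : Fin (d + 1) → ℤ) :
    eLpNorm (h k) p volume ≠ ⊤ := by
  intro hk
  have := P.bound k
  rw [hk, ENNReal.mul_top (weight_ne_zero _ _), top_le_iff] at this
  exact P.ne_top _ this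

lemma Pieces.exists_pairing_le (P : Pieces hη s p f h b) (hp : 0 < p) :
    ∃ (S : Finset (ℕ × ℕ)) (D : (Fin (d + 1) → ℤ) → ℝ), Summable D ∧ (∀ k, 0 ≤ D k) ∧
      ∀ k t (φ : 𝓢(EuclideanSpace ℝ (Fin d), ℂ)), ‖∫ x, φ x * h k (joinLast t x)‖ ≤
        D k * S.sup (schwartzSeminormFamily ℂ (EuclideanSpace ℝ (Fin d)) ℂ) φ := by
  set N := ⌈|s|⌉₊
  -- The power d makes the sum over k̄ converge, and the power `N ≥ |s|` is at least as small as the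
  -- weight, whatever the sign of s. The sum over k_n converges because b is summable.
  obtain ⟨S, C, hC⟩ := exists_slice_pairing_le hη d hp (d + N)
  refine ⟨S, fun k => (latSq (Fin.init k) ^ d)⁻¹ * (b (k (Fin.last d))).toReal * C, ?_, fun k => ?_,
    fun k t φ => (hC k (h k) (P.loc k) (P.eLpNorm_ne_top k) t φ).trans ?_⟩
  · refine Summable.mul_right _ ?_
    rw [← (Fin.snocEquiv fun _ => ℤ).summable_iff]
    have := (ENNReal.summable_toReal P.summable).mul_of_nonneg (summable_latSq d)
      (fun _ => ENNReal.toReal_nonneg) fun k => inv_nonneg.2 (pow_nonneg (latSq_pos k).le _)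
    refine this.congr fun z => ?_
    simp [Fin.snocEquiv, mul_comm]
  · have := (latSq_pos (Fin.init k : Fin d → ℤ)).le
    positivity
  · rw [← mul_assoc]
    refine mul_le_mul_of_nonneg_right (mul_le_mul_of_nonneg_right ?_ C.2) (apply_nonneg _ _)
    set l := latSq (Fin.init k : Fin d → ℤ)
    have hl : 0 < l := latSq_pos _
    have h1 : (l ^ N)⁻¹ ≤ l ^ (s / 2) := by
      rw [← Real.rpow_natCast, ← Real.rpow_neg hl.le]
      refine Real.rpow_le_rpow_of_exponent_le (one_le_latSq _) ?_
      have := Nat.le_ceil |s|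
      linarith [neg_abs_le s, abs_nonneg s]
    have h2 := ENNReal.toReal_mono (P.ne_top _) (P.bound k)
    rw [ENNReal.toReal_mul, weight_eq, ENNReal.toReal_ofReal (by positivity)] at h2
    rw [pow_add, mul_inv, mul_assoc]
    exact mul_le_mul_of_nonneg_left
      ((mul_le_mul_of_nonneg_right h1 ENNReal.toReal_nonneg).trans h2) (by positivity)

lemma Pieces.exists_norm_le (P : Pieces hη s p f h b) (hp : 0 < p) (k : Fin (d + 1) → ℤ) :
    ∃ B : ℝ, ∀ y, ‖h k y‖ ≤ B := by
  obtain ⟨L, C, h₁⟩ := exists_localized_bounds hη d hp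
  refine ⟨C * (eLpNorm (h k) p volume).toReal, fun y => ?_⟩
  have := ENNReal.toReal_mono (ENNReal.mul_ne_top ENNReal.coe_ne_top (P.eLpNorm_ne_top k))
      ((h₁ k (h k) (P.loc k) (P.eLpNorm_ne_top k)).1 y)
  simpa using this

lemma Pieces.integrable_slice (P : Pieces hη s p f h b) (hp : 0 < p) (k : Fin (d + 1) → ℤ)
    (t : ℝ) (φ : 𝓢(EuclideanSpace ℝ (Fin d), ℂ)) :
    Integrable fun x => φ x * h k (joinLast t x) := by
  obtain ⟨B, hB⟩ := P.exists_norm_le hp k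
  exact integrable_of_tempered
    ((P.loc k).continuous.comp (continuous_joinLast_right t)).aestronglyMeasurable
    (tempered_of_norm_le fun x => hB _)

/-- The slices of `f` as tempered distributions. -/
lemma Pieces.exists_family (P : Pieces hη s p f h b) (hp : 0 < p) :
    ∃ F : ℝ → 𝓢'(EuclideanSpace ℝ (Fin d), ℂ),
      (∀ t φ, HasSum (fun k => ∫ x, φ x * h k (joinLast t x)) (F t φ)) ∧
      (∀ φ, Continuous fun t => F t φ) ∧
      ∀ Φ : 𝓢(EuclideanSpace ℝ (Fin (d + 1)), ℂ),
        (∃ R : ℝ, ∀ x, R < |x (Fin.last d)| → Φ x = 0) → f Φ = ∫ t, F t (slice t Φ) := by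
  obtain ⟨S, D, hD, hD0, hle⟩ := P.exists_pairing_le hp
  have hsum : ∀ t (φ : 𝓢(EuclideanSpace ℝ (Fin d), ℂ)),
      Summable fun k => ∫ x, φ x * h k (joinLast t x) := fun t φ =>
    Summable.of_norm_bounded (hD.mul_right _) fun k => hle k t φ
  have hint := P.integrable_slice hp
  let F : ℝ → 𝓢'(EuclideanSpace ℝ (Fin d), ℂ) := fun t =>
    ContinuousLinearMap.toPointwiseConvergenceCLM _ _ _ _ <|
      SchwartzMap.mkCLMtoNormedSpace (𝕜 := ℂ) (σ := RingHom.id ℂ)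
        (fun φ : 𝓢(EuclideanSpace ℝ (Fin d), ℂ) => ∑' k, ∫ x, φ x * h k (joinLast t x))
        (fun φ ψ => by
          rw [← (hsum t φ).tsum_add (hsum t ψ)]
          refine tsum_congr fun k => ?_
          rw [← integral_add (hint k t φ) (hint k t ψ)]
          simp only [add_apply, add_mul])
        (fun c φ => by
          rw [RingHom.id_apply, smul_eq_mul, ← tsum_mul_left]
          refine tsum_congr fun k => ?_
          rw [← integral_const_mul]
          simp only [smul_apply, smul_eq_mul, mul_assoc])
        ⟨S, ∑' k, D k, tsum_nonneg hD0, fun φ => by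
          rw [← tsum_mul_right]
          exact tsum_of_norm_bounded (hD.mul_right _).hasSum fun k => hle k t φ⟩
  have hF : ∀ t φ, F t φ = ∑' k, ∫ x, φ x * h k (joinLast t x) := fun t φ => rfl
  refine ⟨F, fun t φ => by rw [hF]; exact (hsum t φ).hasSum, fun φ => ?_, ?_⟩
  · simp only [hF]
    refine continuous_tsum (fun k => ?_) (hD.mul_right _) fun k t => hle k t φ
    obtain ⟨B, hB⟩ := P.exists_norm_le hp k
    refine continuous_of_dominated (bound := fun x => ‖φ x‖ * B)
      (fun t => (hint k t φ).aestronglyMeasurable)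
      (fun t => Filter.Eventually.of_forall fun x => ?_)
      ((SchwartzMap.integrable (μ := volume) φ).norm.mul_const _)
      (Filter.Eventually.of_forall fun x => ?_)
    · rw [norm_mul]
      exact mul_le_mul_of_nonneg_left (hB _) (norm_nonneg _)
    · exact continuous_const.mul ((P.loc k).continuous.comp
        (continuous_joinLast.comp (by fun_prop : Continuous fun t : ℝ => (t, x))))
  · rintro Φ ⟨R, hR⟩
    have hzero : ∀ t, R < |t| → slice t Φ = 0 := by
      intro t ht
      ext x
      rw [slice_apply, hR]
      · rfl
      · rwa [joinLast_last]
    have hI : ∀ k, Integrable (fun z : EuclideanSpace ℝ (Fin d) × ℝ =>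
        Φ (joinLast z.2 z.1) * h k (joinLast z.2 z.1)) (volume.prod volume) := fun k =>
      (integrable_joinLast_iff (f := fun y => Φ y * h k y)).2 ((P.rep k).2 Φ).1
    have hk : ∀ k, ∫ t, ∫ x, slice t Φ x * h k (joinLast t x) = box η k f Φ := by
      intro k
      rw [((P.rep k).2 Φ).2, integral_joinLast]
      exact (integral_prod_symm _ (hI k)).symm
    -- The pairing bound is uniform in t but does not decay, so integrability in t comes from the
    -- bounded support of Φ in the last variable.
    have hbd : ∀ k t, ‖∫ x, slice t Φ x * h k (joinLast t x)‖ ≤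
        (Set.Icc (-R) R).indicator (fun _ => D k *
          S.sup (schwartzSeminormFamily ℂ (EuclideanSpace ℝ (Fin (d + 1))) ℂ) Φ) t := by
      intro k t
      by_cases ht : t ∈ Set.Icc (-R) R
      · rw [Set.indicator_of_mem ht]
        exact (hle k t _).trans (mul_le_mul_of_nonneg_left (sup_seminorm_slice_le S t Φ) (hD0 k))
      · rw [Set.indicator_of_notMem ht, hzero t]
        · simp
        · by_contra! hc
          exact ht (abs_le.1 hc)
    have hmeas : ∀ k, Integrable fun t => ∫ x, slice t Φ x * h k (joinLast t x) := fun k =>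
      (hI k).integral_prod_right
    have hbi : ∀ c : ℝ, Integrable ((Set.Icc (-R) R).indicator fun _ => c) := fun c =>
      (integrable_indicator_iff measurableSet_Icc).2 (integrableOn_const (by simp))
    have h5 := hasSum_integral_of_summable_integral_norm (μ := volume)
      (F := fun k t => ∫ x, slice t Φ x * h k (joinLast t x)) hmeas (by
        refine (hD.mul_right (S.sup (schwartzSeminormFamily ℂ _ ℂ) Φ * (2 * |R|))).of_nonneg_of_le
          (fun k => integral_nonneg fun t => norm_nonneg _) fun k => ?_
        refine (integral_mono_of_nonneg (Filter.Eventually.of_forall fun t => norm_nonneg _)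
          (hbi _) (Filter.Eventually.of_forall (hbd k))).trans ?_
        rw [integral_indicator measurableSet_Icc, setIntegral_const, smul_eq_mul, mul_comm,
          ← mul_assoc]
        refine mul_le_mul_of_nonneg_left ?_ (mul_nonneg (hD0 k) (apply_nonneg _ _))
        rw [measureReal_def, Real.volume_Icc, ENNReal.toReal_ofReal']
        refine max_le ?_ (by positivity)
        linarith [le_abs_self R])
    simp only [hk] at h5
    have h6 := h5.unique (hasSum_box_apply hη f Φ)
    rw [← h6]
    rfl

end Family

/-! ### Uniqueness of the restriction -/

section Uniqueness

variable {d : ℕ}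

lemma hasCompactSupport_tensor {φ : EuclideanSpace ℝ (Fin d) → ℂ} {χ : ℝ → ℝ}
    (hφ : HasCompactSupport φ) (hχ : HasCompactSupport χ) :
    HasCompactSupport fun y : EuclideanSpace ℝ (Fin (d + 1)) =>
      φ (initE y) * (χ (y (Fin.last d)) : ℂ) := by
  refine HasCompactSupport.of_support_subset_isCompact
    ((hχ.isCompact.prod hφ.isCompact).image continuous_joinLast) fun y hy => ?_
  rw [Function.mem_support] at hy
  refine ⟨(y (Fin.last d), initE y), ⟨subset_tsupport _ ?_, subset_tsupport _ ?_⟩,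
    joinLast_initE y⟩
  · exact fun h => hy (by simp only at h; rw [h]; simp)
  · exact fun h => hy (by simp only at h; rw [h]; simp)

lemma contDiff_initE : ContDiff ℝ ∞ (initE : EuclideanSpace ℝ (Fin (d + 1)) → _) := by
  rw [contDiff_euclidean]
  intro i
  simp only [initE_apply]
  fun_prop

/-- The partition of unity is applied here to ψ itself, in physical space, to exhaust it by
compactly supported functions. -/
lemma eq_of_forall_compactSupport {η : ℝ → ℝ} (hη : IsBump η)
    {u v : 𝓢'(EuclideanSpace ℝ (Fin d), ℂ)}
    (h : ∀ φ : 𝓢(EuclideanSpace ℝ (Fin d), ℂ), HasCompactSupport φ → u φ = v φ) : u = v := by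
  ext ψ
  have h1 := hasSum_smulLeftCLM_thin hη ψ
  refine (h1.mapL u).unique ?_
  refine (h1.mapL v).congr_fun fun k => h _ ?_
  have hc : HasCompactSupport (thinSymbol hη k) :=
    (hasCompactSupport_prodCutoff fun i => thinC hη (k i)).comp_left
      (g := ((↑) : ℝ → ℂ)) Complex.ofReal_zero
  rw [SchwartzMap.smulLeftCLM_apply (SchwartzMap.hasTemperateGrowth _)]
  exact hc.smul_right

/-- The restriction to the hyperplane is unique. -/
lemma hasTrace_unique {η : ℝ → ℝ} (hη : IsBump η) {f : 𝓢'(EuclideanSpace ℝ (Fin (d + 1)), ℂ)}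
    {g₁ g₂ : 𝓢'(EuclideanSpace ℝ (Fin d), ℂ)} (h₁ : HasTrace f g₁) (h₂ : HasTrace f g₂) :
    g₁ = g₂ := by
  obtain ⟨F, hFc, hF, rfl⟩ := h₁
  obtain ⟨G, hGc, hG, rfl⟩ := h₂
  refine eq_of_forall_compactSupport hη fun φ hφ => ?_
  -- Both functions of t are continuous, so equality almost everywhere suffices, and this is tested
  -- by the functions φ ⊗ χ.
  suffices h : (fun t => F t φ) = fun t => G t φ from congrFun h 0
  rw [← (hFc φ).ae_eq_iff_eq volume (hGc φ)]
  refine ae_eq_of_integral_contDiff_smul_eq ((hFc φ).locallyIntegrable) ((hGc φ).locallyIntegrable)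
    fun χ hχ hχc => ?_
  let Φ : 𝓢(EuclideanSpace ℝ (Fin (d + 1)), ℂ) :=
    (hasCompactSupport_tensor hφ hχc).toSchwartzMap (((φ.smooth ⊤).comp contDiff_initE).mul
      (Complex.ofRealCLM.contDiff.comp (hχ.comp (by fun_prop))))
  have hslice : ∀ t, slice t Φ = (χ t : ℂ) • φ := by
    intro t
    ext x
    change φ (initE (joinLast t x)) * (χ (joinLast t x (Fin.last d)) : ℂ) = χ t * φ x
    rw [initE_joinLast, joinLast_last, mul_comm]
  obtain ⟨R, hR⟩ := hχc.isCompact.isBounded.exists_norm_le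
  have hΦ : ∃ R : ℝ, ∀ x, R < |x (Fin.last d)| → Φ x = 0 := by
    refine ⟨R, fun x hx => ?_⟩
    change φ (initE x) * (χ (x (Fin.last d)) : ℂ) = 0
    have h0 : χ (x (Fin.last d)) = 0 :=
      image_eq_zero_of_notMem_tsupport fun h => (hR _ h).not_gt hx
    rw [h0, Complex.ofReal_zero, mul_zero]
  have h3 := (hF Φ hΦ).symm.trans (hG Φ hΦ)
  simp only [hslice, map_smul, smul_eq_mul] at h3
  simpa only [Complex.real_smul] using h3

end Uniqueness

/-! ### Triangle inequalities for quasi-norms -/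

section Minkowski

variable {α ι : Type*} [MeasurableSpace α] {μ : Measure α} [Countable ι]

/-- Minkowski's inequality for finite sums, followed by monotone convergence along finite subsets.
-/
lemma eLpNorm_tsum_le {p : ℝ≥0∞} (hp : 1 ≤ p) {u : ι → α → ℝ≥0∞} (hu : ∀ i, Measurable (u i)) :
    eLpNorm (fun x => ∑' i, u i x) p μ ≤ ∑' i, eLpNorm (u i) p μ := by
  have hfin : ∀ s : Finset ι, eLpNorm (∑ i ∈ s, u i) p μ ≤ ∑' i, eLpNorm (u i) p μ := fun s =>
    (eLpNorm_sum_le (fun i _ => (hu i).aestronglyMeasurable) hp).trans (ENNReal.sum_le_tsum s)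
  by_cases ht : p = ⊤
  · subst ht
    simp only [eLpNorm_exponent_top] at hfin ⊢
    refine essSup_le_of_ae_le _ ?_
    have h1 : ∀ᵐ x ∂μ, ∀ i, ‖u i x‖ₑ ≤ eLpNormEssSup (u i) μ :=
      ae_all_iff.2 fun i => ae_le_eLpNormEssSup
    filter_upwards [h1] with x hx
    exact ENNReal.tsum_le_tsum hx
  have h0 : p ≠ 0 := (zero_lt_one.trans_le hp).ne'
  have hpos : 0 < p.toReal := ENNReal.toReal_pos h0 ht
  rw [eLpNorm_eq_lintegral_rpow_enorm_toReal h0 ht, one_div, ENNReal.rpow_inv_le_iff hpos]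
  have h2 : ∀ x, ‖∑' i, u i x‖ₑ ^ p.toReal = ⨆ s : Finset ι, (∑ i ∈ s, u i x) ^ p.toReal := by
    intro x
    rw [enorm_eq_self, ENNReal.tsum_eq_iSup_sum]
    exact (ENNReal.orderIsoRpow p.toReal hpos).map_iSup _
  simp only [h2]
  rw [lintegral_iSup_directed]
  · refine iSup_le fun s => ?_
    have := hfin s
    rw [eLpNorm_eq_lintegral_rpow_enorm_toReal h0 ht, one_div, ENNReal.rpow_inv_le_iff hpos] at this
    simpa using this
  · exact fun s => ((Finset.measurable_sum s fun i _ => hu i).pow_const _).aemeasurable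
  · classical
    intro s t
    refine ⟨s ∪ t, fun x => ?_, fun x => ?_⟩
    · exact ENNReal.rpow_le_rpow (Finset.sum_le_sum_of_subset Finset.subset_union_left) hpos.le
    · exact ENNReal.rpow_le_rpow (Finset.sum_le_sum_of_subset Finset.subset_union_right) hpos.le

/-- The `r`-triangle inequality in `L^p` for `r ≤ p`. -/
lemma eLpNorm_rpow_tsum_le {p : ℝ≥0∞} {r : ℝ} (hr : 0 < r) (hrp : ENNReal.ofReal r ≤ p)
    {u : ι → α → ℝ≥0∞} (hu : ∀ i, Measurable (u i)) :
    eLpNorm (fun x => (∑' i, u i x ^ r) ^ r⁻¹) p μ ≤ (∑' i, eLpNorm (u i) p μ ^ r) ^ r⁻¹ := by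
  have hr0 : ENNReal.ofReal r ≠ 0 := by simpa using hr
  have h1 := eLpNorm_enorm_rpow (p := p) (μ := μ) (fun x => ∑' i, u i x ^ r) (inv_pos.2 hr)
  simp only [enorm_eq_self] at h1
  rw [h1]
  refine ENNReal.rpow_le_rpow ?_ (inv_pos.2 hr).le
  -- Passing to r-th powers replaces L^p by L^{p/r}, where Minkowski's inequality holds.
  have h2 : 1 ≤ p * ENNReal.ofReal r⁻¹ := by
    rw [ENNReal.ofReal_inv_of_pos hr]
    exact (ENNReal.mul_inv_cancel hr0 ENNReal.ofReal_ne_top).symm.le.trans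
      (mul_le_mul_left hrp _)
  refine (eLpNorm_tsum_le h2 fun i => (hu i).pow_const r).trans
    (ENNReal.tsum_le_tsum fun i => le_of_eq ?_)
  have h3 := eLpNorm_enorm_rpow (p := p * ENNReal.ofReal r⁻¹) (μ := μ) (u i) hr
  simp only [enorm_eq_self] at h3
  rw [h3, mul_assoc, ENNReal.ofReal_inv_of_pos hr,
    ENNReal.inv_mul_cancel hr0 ENNReal.ofReal_ne_top, mul_one]

lemma eLpNorm_tsum_le_rpow {p : ℝ≥0∞} {r : ℝ} (hr : 0 < r) (hr1 : r ≤ 1)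
    (hrp : ENNReal.ofReal r ≤ p) {u : ι → α → ℝ≥0∞} (hu : ∀ i, Measurable (u i)) :
    eLpNorm (fun x => ∑' i, u i x) p μ ≤ (∑' i, eLpNorm (u i) p μ ^ r) ^ r⁻¹ := by
  refine le_trans (eLpNorm_mono_enorm fun x => ?_) (eLpNorm_rpow_tsum_le hr hrp hu)
  rw [enorm_eq_self, enorm_eq_self, ENNReal.le_rpow_inv_iff hr]
  exact rpow_tsum_le _ hr hr1

lemma eLpNorm_count_comp_equiv {β : Type*} [MeasurableSpace β] [MeasurableSingletonClass β]
    (e : β ≃ β) (a : β → ℝ≥0∞) (q : ℝ≥0∞) :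
    eLpNorm (fun k => a (e k)) q Measure.count = eLpNorm a q Measure.count := by
  by_cases h0 : q = 0
  · simp [h0]
  by_cases ht : q = ⊤
  · subst ht
    simp only [eLpNorm_exponent_top, eLpNormEssSup_count]
    exact e.iSup_comp (g := fun k => ‖a k‖ₑ)
  · rw [eLpNorm_count_eq_tsum h0 ht, eLpNorm_count_eq_tsum h0 ht]
    congr 1
    exact e.tsum_eq fun k => a k ^ q.toReal

end Minkowski

/-! ### Comparison of weights at neighbouring lattice points -/

section Weights

variable {d : ℕ}

/-- Comparability in both directions is needed because σ may have either sign. -/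
lemma rpow_le_rpow_abs_mul {a b K : ℝ} (ha : 0 < a) (hb : 0 < b) (hK : 1 ≤ K) (h₁ : a ≤ K * b)
    (h₂ : b ≤ K * a) (σ : ℝ) : a ^ σ ≤ K ^ |σ| * b ^ σ := by
  have hK0 : 0 < K := by linarith
  rcases le_total 0 σ with hσ | hσ
  · rw [abs_of_nonneg hσ, ← Real.mul_rpow hK0.le hb.le]
    exact Real.rpow_le_rpow ha.le h₁ hσ
  · rw [abs_of_nonpos hσ]
    have h3 : (K * a) ^ σ ≤ b ^ σ := Real.rpow_le_rpow_of_nonpos hb h₂ hσ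
    rw [Real.mul_rpow hK0.le ha.le] at h3
    calc a ^ σ = K ^ (-σ) * (K ^ σ * a ^ σ) := by
          rw [← mul_assoc, ← Real.rpow_add hK0, neg_add_cancel, Real.rpow_zero, one_mul]
      _ ≤ _ := mul_le_mul_of_nonneg_left h3 (by positivity)

lemma latSq_le_of_near {k l : Fin d → ℤ} (h : ∀ i, |k i - l i| ≤ 2) :
    latSq k ≤ (2 + 8 * d) * latSq l := by
  have h1 : ∀ i, (k i : ℝ) ^ 2 ≤ 2 * (l i : ℝ) ^ 2 + 8 := by
    intro i
    have h2 : |((k i : ℝ) - l i)| ≤ 2 := by exact_mod_cast h i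
    have h3 : ((k i : ℝ) - l i) ^ 2 ≤ 4 := by
      rw [← sq_abs]; nlinarith [abs_nonneg ((k i : ℝ) - l i)]
    nlinarith [sq_nonneg ((k i : ℝ) - 2 * l i)]
  have h5 := Finset.sum_le_sum fun i (_ : i ∈ Finset.univ) => h1 i
  rw [Finset.sum_add_distrib, ← Finset.mul_sum, Finset.sum_const, Finset.card_univ,
    Fintype.card_fin, nsmul_eq_mul] at h5
  have h6 := one_le_latSq l
  have h7 : latSq l = 1 + ∑ i, (l i : ℝ) ^ 2 := rfl
  have h8 : latSq k = 1 + ∑ i, (k i : ℝ) ^ 2 := rfl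
  have h9 : (0 : ℝ) ≤ d := Nat.cast_nonneg d
  nlinarith

lemma exists_weight_le (s : ℝ) (d : ℕ) : ∃ C : ℝ≥0, ∀ k l : Fin d → ℤ, (∀ i, |k i - l i| ≤ 2) →
    weight s k ≤ C * weight s l := by
  refine ⟨(((2 + 8 * d : ℝ)) ^ |s / 2|).toNNReal, fun k l h => ?_⟩
  rw [weight_eq, weight_eq, ← ENNReal.ofReal, ← ENNReal.ofReal_mul (by positivity)]
  refine ENNReal.ofReal_le_ofReal (rpow_le_rpow_abs_mul (latSq_pos k) (latSq_pos l) ?_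
    (latSq_le_of_near h) (latSq_le_of_near fun i => ?_) _)
  · have : (0 : ℝ) ≤ d := Nat.cast_nonneg d
    linarith
  · rw [abs_sub_comm]; exact h i

end Weights

/-! ### The trace estimate -/

section TraceEstimate

variable {d : ℕ} {η : ℝ → ℝ}

lemma isRepresentedBy_tsum {ι : Type*} [Countable ι] {u : 𝓢'(EuclideanSpace ℝ (Fin d), ℂ)}
    {w : ι → EuclideanSpace ℝ (Fin d) → ℂ} {e : ι → ℝ} (he : Summable e)
    (hw : ∀ i, Continuous (w i)) (hle : ∀ i x, ‖w i x‖ ≤ e i)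
    (hu : ∀ φ : 𝓢(EuclideanSpace ℝ (Fin d), ℂ), HasSum (fun i => ∫ x, φ x * w i x) (u φ)) :
    IsRepresentedBy u fun x => ∑' i, w i x := by
  have hc : Continuous fun x => ∑' i, w i x := continuous_tsum hw he hle
  have hb : ∀ x, ‖∑' i, w i x‖ ≤ ∑' i, e i := fun x =>
    tsum_of_norm_bounded he.hasSum fun i => hle i x
  refine ⟨hc.aestronglyMeasurable, fun φ => ⟨integrable_of_tempered hc.aestronglyMeasurable
    (tempered_of_norm_le hb), ?_⟩⟩
  have hI : ∀ i, Integrable fun x => φ x * w i x := fun i =>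
    integrable_of_tempered (hw i).aestronglyMeasurable (tempered_of_norm_le (hle i))
  have h := hasSum_integral_of_summable_integral_norm hI (by
    refine (he.mul_left (∫ x, ‖φ x‖)).of_nonneg_of_le
      (fun i => integral_nonneg fun x => norm_nonneg _) fun i => ?_
    rw [← integral_mul_const]
    refine integral_mono_of_nonneg (Filter.Eventually.of_forall fun x => norm_nonneg _)
      ((SchwartzMap.integrable (μ := volume) φ).norm.mul_const _)
      (Filter.Eventually.of_forall fun x => ?_)
    simp only [norm_mul]
    exact mul_le_mul_of_nonneg_left (hle i x) (norm_nonneg _))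
  rw [(hu φ).unique h]
  simp only [tsum_mul_left]

lemma measurable_wAvg {L : ℝ} {H : EuclideanSpace ℝ (Fin d) → ℝ≥0∞} (hH : Measurable H) :
    Measurable (wAvg L H) := by
  refine Measurable.lintegral_prod_right' (f := fun z : EuclideanSpace ℝ (Fin d) ×
    EuclideanSpace ℝ (Fin d) => jb (z.1 - z.2) ^ (-L) * H z.2) ?_
  exact ((measurable_jb.comp (measurable_fst.sub measurable_snd)).pow_const _).mul
    (hH.comp measurable_snd)

lemma jb_joinLast_sub (t : ℝ) (x y : EuclideanSpace ℝ (Fin d)) :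
    jb (joinLast t x - joinLast t y) = jb (x - y) := by
  unfold jb
  rw [← dist_eq_norm, ← dist_eq_norm, (joinLast_isometry t).dist_eq]

/-- Of the decay `L + (d + 1)` of the thin kernel, `L` orders pay for moving the average from z to x
and `d + 1` orders remain integrable. This pointwise bound replaces Young's inequality, which is not
available for p < 1. -/
lemma exists_kconv_slice_le (hη : IsBump η) (d L : ℕ) : ∃ C : ℝ≥0, ∀ (k : Fin (d + 1) → ℤ)
    (h : EuclideanSpace ℝ (Fin (d + 1)) → ℂ), Localized hη k h → ∀ (l : Fin d → ℤ) t x,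
      ‖kconv (symKernel (thinSymbol hη l)) (fun z => h (joinLast t z)) x‖ₑ ≤
        C * wAvg L (fun y => ‖h y‖ₑ) (joinLast t x) := by
  obtain ⟨A, hA⟩ := exists_enorm_le_wAvg hη (d + 1)
  obtain ⟨C, hC⟩ := exists_symKernel_dilate_le (contDiff_thin hη) (R := 1)
    (fun t ht => thin_eq_zero hη ht) d
  have hI : ∫⁻ x : EuclideanSpace ℝ (Fin d), jb x ^ (-((d + 1 : ℕ) : ℝ)) < ⊤ :=
    lintegral_jb_lt_top (by simp)
  refine ⟨C (L + (d + 1)) * A L *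
    (∫⁻ x : EuclideanSpace ℝ (Fin d), jb x ^ (-((d + 1 : ℕ) : ℝ))).toNNReal,
    fun k h hh l t x => ?_⟩
  rw [ENNReal.coe_mul, ENNReal.coe_toNNReal hI.ne, ENNReal.coe_mul]
  set W := wAvg L (fun y => ‖h y‖ₑ)
  calc ‖kconv (symKernel (thinSymbol hη l)) (fun z => h (joinLast t z)) x‖ₑ
      ≤ ∫⁻ z, ‖symKernel (thinSymbol hη l) (x - z) * h (joinLast t z)‖ₑ :=
        enorm_integral_le_lintegral_enorm _
    _ ≤ ∫⁻ z, (C (L + (d + 1)) * A L * W (joinLast t x)) *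
          jb (x - z) ^ (-((d + 1 : ℕ) : ℝ)) := by
        refine lintegral_mono fun z => ?_
        rw [enorm_mul]
        have h1 := hC (L + (d + 1)) l (x - z)
        have h2 : ‖h (joinLast t z)‖ₑ ≤ A L * (jb (x - z) ^ (L : ℝ) * W (joinLast t x)) := by
          refine (hA k h hh L _).trans (mul_le_mul_right ?_ _)
          have := wAvg_le_mul (L : ℝ) (Nat.cast_nonneg L) (fun y => ‖h y‖ₑ) (joinLast t x)
            (joinLast t z)
          rwa [jb_joinLast_sub] at this
        refine (mul_le_mul' h1 h2).trans (le_of_eq ?_)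
        have h3 : jb (x - z) ^ (-((L + (d + 1) : ℕ) : ℝ)) * jb (x - z) ^ (L : ℝ) =
            jb (x - z) ^ (-((d + 1 : ℕ) : ℝ)) := by
          rw [← ENNReal.rpow_add _ _ (jb_ne_zero _) (jb_ne_top _)]
          congr 1
          push_cast
          ring
        rw [← h3]
        ring
    _ = _ := by
        rw [lintegral_const_mul _ (by fun_prop), lintegral_jb_sub]
        ring

lemma symKernel_zero {V : Type*} [NormedAddCommGroup V] [InnerProductSpace ℝ V]
    [FiniteDimensional ℝ V] [MeasurableSpace V] [BorelSpace V] : symKernel (0 : 𝓢(V, ℂ)) = 0 := by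
  ext y
  rw [symKernel_eq_integral]
  simp

lemma kconv_slice_eq_zero {hη : IsBump η} {k : Fin (d + 1) → ℤ}
    {h : EuclideanSpace ℝ (Fin (d + 1)) → ℂ} (hh : Localized hη k h) {B : ℝ}
    (hB : ∀ y, ‖h y‖ ≤ B) {l : Fin d → ℤ} (hl : ∃ i, 3 ≤ |l i - Fin.init k i|) (t : ℝ)
    (x : EuclideanSpace ℝ (Fin d)) :
    kconv (symKernel (thinSymbol hη l)) (fun z => h (joinLast t z)) x = 0 := by
  have hr := hh.reproducing
  rw [fatSymbol_eq_snoc] at hr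
  rw [kconv_slice (M₁ := thinSymbol hη l) (M := 0) _ (prodSymbol_thin_mul_fat_eq_zero hη hl) hh.continuous hB hr]
  simp [symKernel_zero]

/-- The lattice points `δ` with `|δ_i| ≤ 2`. -/
noncomputable def nearBox (d : ℕ) : Finset (Fin d → ℤ) := Fintype.piFinset fun _ => Finset.Icc (-2) 2

/-- The lattice point `(l + δ, j)`. -/
noncomputable def nearPt (l : Fin d → ℤ) (z : nearBox d × ℤ) : Fin (d + 1) → ℤ :=
  Fin.snoc (l + z.1.1) z.2

lemma nearPt_injective (l : Fin d → ℤ) : Function.Injective (nearPt l) := by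
  intro z w hzw
  have h1 := congrArg Fin.init hzw
  have h2 := congrFun hzw (Fin.last d)
  simp only [nearPt, Fin.init_snoc, Fin.snoc_last, add_right_inj] at h1 h2
  exact Prod.ext (Subtype.ext h1) h2

lemma exists_far_of_notMem_range {l : Fin d → ℤ} {k : Fin (d + 1) → ℤ}
    (hk : k ∉ Set.range (nearPt l)) : ∃ i, 3 ≤ |l i - Fin.init k i| := by
  by_contra! hc
  refine hk ⟨(⟨Fin.init k - l, ?_⟩, k (Fin.last d)), ?_⟩
  · refine Fintype.mem_piFinset.2 fun i => Finset.mem_Icc.2 ?_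
    have := abs_lt.1 (hc i)
    simp only [Pi.sub_apply]
    omega
  · simp [nearPt]

lemma abs_nearBox_le (l : Fin d → ℤ) (δ : nearBox d) (i : Fin d) : |l i - (l + δ.1) i| ≤ 2 := by
  have := Finset.mem_Icc.1 (Fintype.mem_piFinset.1 δ.2 i)
  simp only [Pi.add_apply]
  rw [abs_le]
  omega

variable {hη : IsBump η} {s : ℝ} {p : ℝ≥0∞} {f : 𝓢'(EuclideanSpace ℝ (Fin (d + 1)), ℂ)}
  {h : (Fin (d + 1) → ℤ) → EuclideanSpace ℝ (Fin (d + 1)) → ℂ} {b : ℤ → ℝ≥0∞}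

lemma Pieces.tsum_near_ne_top (P : Pieces hη s p f h b) (l : Fin d → ℤ) :
    ∑' z, eLpNorm (h (nearPt l z)) p volume ≠ ⊤ := by
  have h1 : ∀ z, eLpNorm (h (nearPt l z)) p volume ≤ (weight s (l + z.1.1))⁻¹ * b z.2 := by
    intro z
    have := P.bound (nearPt l z)
    simp only [nearPt, Fin.init_snoc, Fin.snoc_last] at this ⊢
    rwa [← ENNReal.div_eq_inv_mul, ENNReal.le_div_iff_mul_le (Or.inl (weight_ne_zero _ _))
      (Or.inl (weight_ne_top _ _)), mul_comm]
  refine ne_top_of_le_ne_top ?_ (ENNReal.tsum_le_tsum h1)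
  rw [ENNReal.tsum_prod (f := fun (δ : nearBox d) j => (weight s (l + δ.1))⁻¹ * b j)]
  simp only [ENNReal.tsum_mul_left, tsum_fintype]
  refine ENNReal.sum_ne_top.2 fun δ _ => ENNReal.mul_ne_top ?_ P.summable
  exact ENNReal.inv_ne_top.2 (weight_ne_zero _ _)

/-- The function representing `□_l` of the trace. -/
lemma Pieces.isRepresentedBy_box_trace (P : Pieces hη s p f h b) (hp : 0 < p) {t : ℝ}
    {F : 𝓢'(EuclideanSpace ℝ (Fin d), ℂ)}
    (hF : ∀ φ, HasSum (fun k => ∫ x, φ x * h k (joinLast t x)) (F φ)) (l : Fin d → ℤ) :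
    IsRepresentedBy (box η l F) fun x => ∑' z, kconv (symKernel (thinSymbol hη l))
      (fun y => h (nearPt l z) (joinLast t y)) x := by
  choose B hB using P.exists_norm_le hp
  have hc : ∀ k, Continuous fun x => h k (joinLast t x) := fun k =>
    (P.loc k).continuous.comp (continuous_joinLast_right t)
  have ht : ∀ k, Tempered fun x => ‖h k (joinLast t x)‖ₑ := fun k =>
    tempered_of_norm_le fun x => hB k _
  obtain ⟨L, C₁, h₁⟩ := exists_localized_bounds hη d hp
  obtain ⟨C₂, h₂⟩ := exists_kconv_slice_le hη d L
  refine isRepresentedBy_tsum (e := fun z => C₂ * (C₁ * (eLpNorm (h (nearPt l z)) p volume).toReal))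
    (((ENNReal.summable_toReal (P.tsum_near_ne_top l)).mul_left _).mul_left _)
    (fun z => continuous_kconv _ (hc _).aestronglyMeasurable (ht _)) (fun z x => ?_) fun φ => ?_
  · have h3 := ((h₂ _ _ (P.loc (nearPt l z)) l t x).trans (mul_le_mul_right
      ((h₁ _ _ (P.loc (nearPt l z)) (P.eLpNorm_ne_top _)).2.1 _) _))
    have := ENNReal.toReal_mono (ENNReal.mul_ne_top ENNReal.coe_ne_top
      (ENNReal.mul_ne_top ENNReal.coe_ne_top (P.eLpNorm_ne_top _))) h3
    simpa using this
  · have h4 := hF (dualMul (thinSymbol hη l) φ)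
    rw [box_apply hη]
    have h5 : ∀ k, ∫ x, dualMul (thinSymbol hη l) φ x * h k (joinLast t x) =
        ∫ x, φ x * kconv (symKernel (thinSymbol hη l)) (fun y => h k (joinLast t y)) x := fun k =>
      (integral_dualMul_eq_of_integrable (integrable_prod_of_tempered
        (hc k).aestronglyMeasurable (ht k))).2
    simp only [h5] at h4
    -- Lattice points off the neighbouring columns contribute 0, since the frequency supports are
    -- disjoint.
    refine ((nearPt_injective l).hasSum_iff fun k hk => ?_).2 h4
    simp only [kconv_slice_eq_zero (P.loc k) (hB k) (exists_far_of_notMem_range hk), mul_zero,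
      integral_zero]

/-- The trace estimate. -/
lemma exists_modNorm_trace_le (hη : IsBump η) (d : ℕ) (s : ℝ) {p q : ℝ≥0∞} (hp : 0 < p)
    (hq : 0 < q) : ∃ C : ℝ≥0, ∀ {f : 𝓢'(EuclideanSpace ℝ (Fin (d + 1)), ℂ)}
      {h : (Fin (d + 1) → ℤ) → EuclideanSpace ℝ (Fin (d + 1)) → ℂ} {b : ℤ → ℝ≥0∞},
      Pieces hη s p f h b → ∀ (t : ℝ) {F : 𝓢'(EuclideanSpace ℝ (Fin d), ℂ)},
      (∀ φ, HasSum (fun k => ∫ x, φ x * h k (joinLast t x)) (F φ)) →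
      modNorm η s p q F ≤ C * anisoNorm η s p q (p ⊓ q ⊓ 1) f := by
  set R : ℝ≥0∞ := p ⊓ q ⊓ 1
  have hR0 : R ≠ 0 := (lt_min (lt_min hp hq) one_pos).ne'
  have hR1 : R ≤ 1 := min_le_right _ _
  have hRt : R ≠ ⊤ := (hR1.trans_lt ENNReal.one_lt_top).ne
  set r := R.toReal
  have hr : 0 < r := ENNReal.toReal_pos hR0 hRt
  have hrR : ENNReal.ofReal r = R := ENNReal.ofReal_toReal hRt
  have hr1 : r ≤ 1 := by simpa using ENNReal.toReal_mono ENNReal.one_ne_top hR1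
  have hrp : ENNReal.ofReal r ≤ p := hrR.trans_le ((min_le_left _ _).trans (min_le_left _ _))
  have hrq : ENNReal.ofReal r ≤ q := hrR.trans_le ((min_le_left _ _).trans (min_le_right _ _))
  obtain ⟨L, C₁, h₁⟩ := exists_localized_bounds hη d hp
  obtain ⟨C₂, h₂⟩ := exists_kconv_slice_le hη d L
  obtain ⟨C₃, h₃⟩ := exists_weight_le s d
  set K : ℝ≥0 := C₃ * (C₂ * C₁)
  have hcard : ((nearBox d).card : ℝ≥0∞) ^ r⁻¹ ≠ ⊤ :=
    ENNReal.rpow_ne_top_of_nonneg (inv_pos.2 hr).le (ENNReal.natCast_ne_top _)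
  refine ⟨K * (((nearBox d).card : ℝ≥0∞) ^ r⁻¹).toNNReal, fun {f h b} P t F hF => ?_⟩
  set a : ℤ → (Fin d → ℤ) → ℝ≥0∞ := fun j k =>
    weight s k * distLp p (box η (Fin.snoc k j : Fin (d + 1) → ℤ) f)
  have key : ∀ l : Fin d → ℤ, weight s l * distLp p (box η l F) ≤
      (∑' z : nearBox d × ℤ, (K * a z.2 (l + z.1.1)) ^ r) ^ r⁻¹ := by
    intro l
    have hrep := P.isRepresentedBy_box_trace hp hF l
    set W : nearBox d × ℤ → EuclideanSpace ℝ (Fin d) → ℝ≥0∞ := fun z x =>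
      C₂ * wAvg L (fun y => ‖h (nearPt l z) y‖ₑ) (joinLast t x)
    have hW : ∀ z, Measurable (W z) := fun z =>
      ((measurable_wAvg (P.loc _).continuous.enorm.measurable).comp
        (continuous_joinLast_right t).measurable).const_mul _
    -- First use of the r-triangle inequality, in L^p.
    have h5 : distLp p (box η l F) ≤ (∑' z, eLpNorm (W z) p volume ^ r) ^ r⁻¹ := by
      refine ((distLp_le hrep).trans (eLpNorm_mono_enorm fun x => ?_)).trans
        (eLpNorm_tsum_le_rpow hr hr1 hrp hW)
      rw [enorm_eq_self]
      refine (enorm_tsum_le_tsum_enorm).trans (ENNReal.tsum_le_tsum fun z => ?_)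
      exact h₂ _ _ (P.loc (nearPt l z)) l t x
    have h6 : ∀ z, weight s l * eLpNorm (W z) p volume ≤ K * a z.2 (l + z.1.1) := by
      intro z
      have h7 : eLpNorm (W z) p volume ≤ C₂ * (C₁ * eLpNorm (h (nearPt l z)) p volume) := by
        refine (eLpNorm_le_nnreal_smul_eLpNorm_of_ae_le_mul' (c := C₂)
          (g := fun x => wAvg L (fun y => ‖h (nearPt l z) y‖ₑ) (joinLast t x))
          (Filter.Eventually.of_forall fun x => by simp [W]) p).trans ?_
        exact mul_le_mul_right ((h₁ _ _ (P.loc (nearPt l z)) (P.eLpNorm_ne_top _)).2.2 t) _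
      have h8 : eLpNorm (h (nearPt l z)) p volume =
          distLp p (box η (Fin.snoc (l + z.1.1) z.2 : Fin (d + 1) → ℤ) f) :=
        (distLp_eq (P.rep _) p).symm
      rw [h8] at h7
      refine (mul_le_mul' (h₃ l (l + z.1.1) (abs_nearBox_le l z.1)) h7).trans (le_of_eq ?_)
      simp only [a, K]
      push_cast
      ring
    calc weight s l * distLp p (box η l F)
        ≤ weight s l * (∑' z, eLpNorm (W z) p volume ^ r) ^ r⁻¹ := mul_le_mul_right h5 _
      _ = (∑' z, (weight s l * eLpNorm (W z) p volume) ^ r) ^ r⁻¹ := by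
          simp only [ENNReal.mul_rpow_of_nonneg _ _ hr.le]
          rw [ENNReal.tsum_mul_left, ENNReal.mul_rpow_of_nonneg _ _ (inv_pos.2 hr).le,
            ENNReal.rpow_rpow_inv hr.ne']
      _ ≤ _ := ENNReal.rpow_le_rpow
          (ENNReal.tsum_le_tsum fun z => ENNReal.rpow_le_rpow (h6 z) hr.le) (inv_pos.2 hr).le
  -- Second use of the r-triangle inequality, in ℓ^q. The shift by δ disappears by translation
  -- invariance, so the sum over δ just counts `nearBox d`, and the sum over j is the outer ℓ^r
  -- quasi-norm.
  calc modNorm η s p q F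
      ≤ eLpNorm (fun l : Fin d → ℤ =>
          (∑' z : nearBox d × ℤ, (K * a z.2 (l + z.1.1)) ^ r) ^ r⁻¹) q Measure.count :=
        eLpNorm_mono_enorm fun l => by simpa only [enorm_eq_self] using key l
    _ ≤ (∑' z : nearBox d × ℤ,
          eLpNorm (fun l => K * a z.2 (l + z.1.1)) q Measure.count ^ r) ^ r⁻¹ :=
        eLpNorm_rpow_tsum_le hr hrq (u := fun (z : nearBox d × ℤ) l => K * a z.2 (l + z.1.1))
          fun z => Measurable.of_discrete
    _ ≤ (∑' z : nearBox d × ℤ, (K * eLpNorm (a z.2) q Measure.count) ^ r) ^ r⁻¹ := by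
        refine ENNReal.rpow_le_rpow (ENNReal.tsum_le_tsum fun z =>
          ENNReal.rpow_le_rpow ?_ hr.le) (inv_pos.2 hr).le
        refine (seqNorm_le_of_le_mul q K ENNReal.coe_ne_top (b := fun l => a z.2 (l + z.1.1))
          fun l => le_rfl).trans (le_of_eq ?_)
        exact congrArg _ (eLpNorm_count_comp_equiv (Equiv.addRight z.1.1) (a z.2) q)
    _ = _ := by
        simp only [ENNReal.mul_rpow_of_nonneg _ _ hr.le]
        rw [ENNReal.tsum_mul_left, ENNReal.tsum_prod
          (f := fun (_ : nearBox d) j => eLpNorm (a j) q Measure.count ^ r)]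
        simp only [tsum_fintype, Finset.sum_const, Finset.card_univ, Fintype.card_coe, nsmul_eq_mul]
        rw [ENNReal.mul_rpow_of_nonneg _ _ (inv_pos.2 hr).le, ENNReal.rpow_rpow_inv hr.ne',
          ENNReal.mul_rpow_of_nonneg _ _ (inv_pos.2 hr).le, anisoNorm,
          eLpNorm_count_eq_tsum hR0 hRt, ENNReal.coe_mul K, ENNReal.coe_toNNReal hcard, mul_assoc,
          one_div]

end TraceEstimate

/-! ### Continuous dependence of slices on the height -/

section SliceContinuity

variable {d : ℕ}

lemma joinLast_affine (t u c : ℝ) (x : EuclideanSpace ℝ (Fin d)) :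
    joinLast t x + c • (joinLast u x - joinLast t x) = joinLast (t + c * (u - t)) x := by
  ext i
  refine Fin.lastCases ?_ (fun j => ?_) i <;> simp [joinLast]

lemma norm_joinLast_sub_joinLast (t u : ℝ) (x : EuclideanSpace ℝ (Fin d)) :
    ‖joinLast t x - joinLast u x‖ = |t - u| := by
  simp [EuclideanSpace.norm_eq, joinLast, Fin.sum_univ_castSucc, Real.sqrt_sq_eq_abs]

/-- The mean value inequality along the vertical segment over x, at the cost of one derivative. Each
point of the segment has norm at least ‖x‖, so the polynomial weight of the seminorm is kept. -/
lemma seminorm_slice_sub_le (m : ℕ × ℕ) (t u : ℝ)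
    (Φ : 𝓢(EuclideanSpace ℝ (Fin (d + 1)), ℂ)) :
    schwartzSeminormFamily ℂ (EuclideanSpace ℝ (Fin d)) ℂ m (slice t Φ - slice u Φ) ≤
      schwartzSeminormFamily ℂ (EuclideanSpace ℝ (Fin (d + 1))) ℂ (m.1, m.2 + 1) Φ * |t - u| := by
  set S := schwartzSeminormFamily ℂ (EuclideanSpace ℝ (Fin (d + 1))) ℂ (m.1, m.2 + 1) Φ
  refine SchwartzMap.seminorm_le_bound ℂ _ _ _ (mul_nonneg (apply_nonneg _ _) (abs_nonneg _))
    fun x => ?_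
  set v : EuclideanSpace ℝ (Fin (d + 1)) := joinLast u 0 - joinLast t 0
  have hv : joinLast u x = joinLast t x + v := by
    rw [joinLast_eq_add u x, joinLast_eq_add t x]
    simp only [v]
    abel
  have hΦ : ContDiff ℝ ∞ Φ := Φ.smooth ⊤
  have hΦv : ContDiff ℝ ∞ fun y => Φ (y + v) := hΦ.comp (contDiff_id.add contDiff_const)
  have h1 : (⇑(slice t Φ - slice u Φ)) = fun x => Φ (joinLast t x) - Φ (joinLast t x + v) := by
    funext z
    simp only [sub_apply, slice_apply]
    rw [joinLast_eq_add u z, joinLast_eq_add t z]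
    congr 2
    simp only [v]
    abel
  have h2 := norm_iteratedFDeriv_comp_joinLast_le (hΦ.sub hΦv) m.2 t x
  have h4 : (fun y => Φ y - Φ (y + v)) = ⇑Φ - fun y => Φ (y + v) := rfl
  rw [← h1, h4, iteratedFDeriv_sub (hΦ.of_le (mod_cast le_top)) (hΦv.of_le (mod_cast le_top)),
    Pi.sub_apply, iteratedFDeriv_comp_add_right, ← hv] at h2
  rcases eq_or_ne (‖x‖ ^ m.1) 0 with h0 | h0
  · rw [h0, zero_mul]
    exact mul_nonneg (apply_nonneg _ _) (abs_nonneg _)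
  have hpos : 0 < ‖x‖ ^ m.1 := lt_of_le_of_ne (by positivity) h0.symm
  have h3 : ‖iteratedFDeriv ℝ m.2 Φ (joinLast t x) - iteratedFDeriv ℝ m.2 Φ (joinLast u x)‖ ≤
      S / ‖x‖ ^ m.1 * ‖joinLast t x - joinLast u x‖ := by
    refine (convex_segment (joinLast u x) (joinLast t x)).norm_image_sub_le_of_norm_fderiv_le
      (𝕜 := ℝ) (fun y _ => ?_) (fun y hy => ?_) (left_mem_segment ..) (right_mem_segment ..)
    · exact (hΦ.differentiable_iteratedFDeriv (by exact_mod_cast ENat.natCast_lt_top _)) y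
    · rw [norm_fderiv_iteratedFDeriv, le_div_iff₀ hpos]
      rw [segment_eq_image'] at hy
      obtain ⟨c, -, rfl⟩ := hy
      simp only [joinLast_affine]
      rw [mul_comm]
      refine le_trans ?_ (SchwartzMap.le_seminorm ℂ m.1 (m.2 + 1) Φ (joinLast (u + c * (t - u)) x))
      exact mul_le_mul_of_nonneg_right
        (pow_le_pow_left₀ (norm_nonneg _) (norm_le_norm_joinLast _ x) _) (norm_nonneg _)
  rw [norm_joinLast_sub_joinLast] at h3
  calc ‖x‖ ^ m.1 * ‖iteratedFDeriv ℝ m.2 (slice t Φ - slice u Φ) x‖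
      ≤ ‖x‖ ^ m.1 * (S / ‖x‖ ^ m.1 * |t - u|) :=
        mul_le_mul_of_nonneg_left (h2.trans h3) hpos.le
    _ = S * |t - u| := by field_simp

lemma continuous_slice (Φ : 𝓢(EuclideanSpace ℝ (Fin (d + 1)), ℂ)) :
    Continuous fun t => slice t Φ := by
  rw [continuous_iff_continuousAt]
  intro u
  refine ((schwartz_withSeminorms ℂ (EuclideanSpace ℝ (Fin d)) ℂ).tendsto_nhds _ _).2
    fun m ε hε => ?_
  have h1 : Filter.Tendsto (fun t =>
      schwartzSeminormFamily ℂ (EuclideanSpace ℝ (Fin (d + 1))) ℂ (m.1, m.2 + 1) Φ * |t - u|)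
      (nhds u) (nhds 0) := by
    have : Continuous fun t =>
      schwartzSeminormFamily ℂ (EuclideanSpace ℝ (Fin (d + 1))) ℂ (m.1, m.2 + 1) Φ * |t - u| := by
      fun_prop
    simpa using this.tendsto u
  filter_upwards [h1.eventually_lt_const hε] with t ht
  exact (seminorm_slice_sub_le m t u Φ).trans_lt ht

lemma exists_norm_slice_le (g : 𝓢'(EuclideanSpace ℝ (Fin d), ℂ)) :
    ∃ (S : Finset (ℕ × ℕ)) (C : ℝ≥0), ∀ (Φ : 𝓢(EuclideanSpace ℝ (Fin (d + 1)), ℂ)) t,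
      ‖g (slice t Φ)‖ ≤
        C * S.sup (schwartzSeminormFamily ℂ (EuclideanSpace ℝ (Fin (d + 1))) ℂ) Φ := by
  obtain ⟨S, C, h⟩ := exists_bound_distribution g
  exact ⟨S, C, fun Φ t => (h _).trans (mul_le_mul_of_nonneg_left (sup_seminorm_slice_le S t Φ) C.2)⟩

end SliceContinuity

/-! ### Tensor products with a function of the last variable -/

section Tensor

variable {d : ℕ} (a : 𝓢(ℝ, ℂ)) (g : 𝓢'(EuclideanSpace ℝ (Fin d), ℂ))

lemma integrable_mul_slice (Φ : 𝓢(EuclideanSpace ℝ (Fin (d + 1)), ℂ)) :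
    Integrable fun t => a t * g (slice t Φ) := by
  obtain ⟨S, C, h⟩ := exists_norm_slice_le g
  exact (a.integrable (μ := volume)).mul_bdd
    (g.continuous.comp (continuous_slice Φ)).aestronglyMeasurable
    (Filter.Eventually.of_forall fun t => h Φ t)

/-- The tensor product `a(x_n) g(x̄)`. -/
noncomputable def tensorDist : 𝓢'(EuclideanSpace ℝ (Fin (d + 1)), ℂ) :=
  ContinuousLinearMap.toPointwiseConvergenceCLM _ _ _ _ <|
    SchwartzMap.mkCLMtoNormedSpace (𝕜 := ℂ) (σ := RingHom.id ℂ)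
      (fun Φ : 𝓢(EuclideanSpace ℝ (Fin (d + 1)), ℂ) => ∫ t, a t * g (slice t Φ))
      (fun Φ Ψ => by
        rw [← integral_add (integrable_mul_slice a g Φ) (integrable_mul_slice a g Ψ)]
        simp only [slice, map_add, mul_add])
      (fun c Φ => by
        rw [RingHom.id_apply, smul_eq_mul, ← integral_const_mul]
        simp only [slice, map_smul, smul_eq_mul]
        exact integral_congr_ae (Filter.Eventually.of_forall fun t => by simp only; ring))
      (by
        obtain ⟨S, C, h⟩ := exists_norm_slice_le g
        refine ⟨S, (∫ t, ‖a t‖) * C, mul_nonneg (integral_nonneg fun _ => norm_nonneg _) C.2,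
          fun Φ => ?_⟩
        rw [mul_assoc, ← integral_mul_const]
        refine norm_integral_le_of_norm_le ((a.integrable (μ := volume)).norm.mul_const _)
          (Filter.Eventually.of_forall fun t => ?_)
        rw [norm_mul]
        exact mul_le_mul_of_nonneg_left (h Φ t) (norm_nonneg _))

lemma tensorDist_apply (Φ : 𝓢(EuclideanSpace ℝ (Fin (d + 1)), ℂ)) :
    tensorDist a g Φ = ∫ t, a t * g (slice t Φ) := rfl

/-- Tensoring with `a` as a linear map. -/
noncomputable def tensorLM :
    𝓢'(EuclideanSpace ℝ (Fin d), ℂ) →ₗ[ℂ] 𝓢'(EuclideanSpace ℝ (Fin (d + 1)), ℂ) where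
  toFun g := tensorDist a g
  map_add' g g' := by
    ext Φ
    change tensorDist a (g + g') Φ = tensorDist a g Φ + tensorDist a g' Φ
    simp only [tensorDist_apply]
    rw [← integral_add (integrable_mul_slice a g Φ) (integrable_mul_slice a g' Φ)]
    exact integral_congr_ae (Filter.Eventually.of_forall fun t => mul_add _ _ _)
  map_smul' c g := by
    ext Φ
    change tensorDist a (c • g) Φ = c * tensorDist a g Φ
    simp only [tensorDist_apply]
    rw [← integral_const_mul]
    exact integral_congr_ae (Filter.Eventually.of_forall fun t => mul_left_comm _ _ _)

variable {a}

lemma hasTrace_tensorDist (h : a 0 = 1) : HasTrace (tensorDist a g) g := by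
  refine ⟨fun t => a t • g, fun φ => a.continuous.mul continuous_const, fun Φ _ => rfl, ?_⟩
  simp only [h, one_smul]

end Tensor

/-! ### Frequency decomposition of tensor products -/

section TensorBox

variable {d : ℕ} {η : ℝ → ℝ}

lemma dualMul_eq_kconv {V : Type*} [NormedAddCommGroup V] [InnerProductSpace ℝ V]
    [FiniteDimensional ℝ V] [MeasurableSpace V] [BorelSpace V] (M Φ : 𝓢(V, ℂ)) (y : V) :
    dualMul M Φ y = kconv (symKernel M) (fun x => Φ (-x)) (-y) := by
  rw [dualMul_apply, kconv, ← integral_neg_eq_self]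
  refine integral_congr_ae (Filter.Eventually.of_forall fun x => ?_)
  simp only [sub_eq_add_neg, add_comm (-y)]

lemma neg_joinLast (t : ℝ) (x : EuclideanSpace ℝ (Fin d)) :
    -joinLast t x = joinLast (-t) (-x) := by
  ext i
  refine Fin.lastCases ?_ (fun j => ?_) i <;> simp [joinLast]

/-- Slices of a dual multiplier factor through the multiplier in the slice variable. -/
lemma slice_dualMul {M₁ : 𝓢(EuclideanSpace ℝ (Fin d), ℂ)} {ρ ρ' : Fin d → Cutoff} (σ : Cutoff)
    (hM : ∀ ξ, M₁ ξ * prodSymbol ρ ξ = prodSymbol ρ' ξ) (t : ℝ)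
    (Φ : 𝓢(EuclideanSpace ℝ (Fin (d + 1)), ℂ)) :
    slice t (dualMul (prodSymbol (Fin.snoc ρ' σ : Fin (d + 1) → Cutoff)) Φ) =
      dualMul M₁ (slice t (dualMul (prodSymbol (Fin.snoc ρ σ : Fin (d + 1) → Cutoff)) Φ)) := by
  ext x
  obtain ⟨B, -, hB⟩ := Φ.decay 0 0
  have hB' : ∀ y, ‖Φ (-y)‖ ≤ B := fun y => by simpa using hB (-y)
  rw [dualMul_eq_kconv M₁]
  simp only [slice_apply, dualMul_eq_kconv, neg_joinLast, neg_neg]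
  rw [kconv_slice_kconv (h := fun y => Φ (-y)) σ hM (Φ.continuous.comp continuous_neg) hB', kconv]
  refine integral_congr_ae (Filter.Eventually.of_forall fun y => ?_)
  simp only
  rw [← symKernel_snoc]
  congr 2
  ext i
  refine Fin.lastCases ?_ (fun j => ?_) i <;> simp [joinLast, initE]

lemma kconv_tensor (ρ : Fin d → Cutoff) (σ : Cutoff) (a : ℝ → ℂ)
    (h : EuclideanSpace ℝ (Fin d) → ℂ) (t : ℝ) (x : EuclideanSpace ℝ (Fin d)) :
    kconv (symKernel (prodSymbol (Fin.snoc ρ σ : Fin (d + 1) → Cutoff)))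
      (fun y => a (y (Fin.last d)) * h (initE y)) (joinLast t x) =
      kconv (symKernel σ.schwartz) a t * kconv (symKernel (prodSymbol ρ)) h x := by
  rw [kconv, integral_joinLast, mul_comm, kconv, kconv, ← integral_prod_mul]
  refine integral_congr_ae (Filter.Eventually.of_forall fun z => ?_)
  simp only
  have h1 : joinLast t x - joinLast z.2 z.1 = joinLast (t - z.2) (x - z.1) := by
    ext i
    refine Fin.lastCases ?_ (fun j => ?_) i <;> simp [joinLast]
  rw [h1, symKernel_snoc, joinLast_last, initE_joinLast]
  ring

lemma thinSymbol_eq_snoc (hη : IsBump η) (k : Fin d → ℤ) (j : ℤ) :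
    thinSymbol hη (Fin.snoc k j : Fin (d + 1) → ℤ) =
      prodSymbol (Fin.snoc (fun i => thinC hη (k i)) (thinC hη j) : Fin (d + 1) → Cutoff) := by
  unfold thinSymbol
  congr 1
  funext i
  refine Fin.lastCases ?_ (fun j => ?_) i <;> simp

/-- Only `□_k g`, not g, is known to be a function. The thin symbol in k̄ is therefore split into
thin times fat: the thin factor turns g into `□_k g`, while the fat factor stays in the kernel and
reproduces h. -/
lemma isRepresentedBy_box_tensor (hη : IsBump η) (a : 𝓢(ℝ, ℂ))
    {g : 𝓢'(EuclideanSpace ℝ (Fin d), ℂ)} {k : Fin d → ℤ} {h : EuclideanSpace ℝ (Fin d) → ℂ}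
    (hg : IsRepresentedBy (box η k g) h) (hh : Localized hη k h) (j : ℤ) :
    IsRepresentedBy (box η (Fin.snoc k j : Fin (d + 1) → ℤ) (tensorDist a g)) fun y =>
      kconv (symKernel (thinC hη j).schwartz) a (y (Fin.last d)) * h (initE y) := by
  set M' : 𝓢(EuclideanSpace ℝ (Fin (d + 1)), ℂ) := prodSymbol
    (Fin.snoc (fun i => fatC hη (k i)) (thinC hη j) : Fin (d + 1) → Cutoff)
  set u : EuclideanSpace ℝ (Fin (d + 1)) → ℂ := fun y => a (y (Fin.last d)) * h (initE y)
  have huc : Continuous u :=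
    (a.continuous.comp (by fun_prop)).mul (hh.continuous.comp continuous_initE)
  have hut : Tempered fun y => ‖u y‖ₑ := by
    obtain ⟨C, N, hC⟩ := hh.tempered
    obtain ⟨B, hB0, hB⟩ := a.decay 0 0
    refine ⟨B.toNNReal * C, N, fun y => ?_⟩
    have h1 : ‖a (y (Fin.last d))‖ₑ ≤ B.toNNReal := by
      rw [← ofReal_norm]
      exact ENNReal.ofReal_le_ofReal (by simpa using hB (y (Fin.last d)))
    simp only [u]
    rw [enorm_mul, ENNReal.coe_mul, mul_assoc]
    refine mul_le_mul' h1 ((hC _).trans (mul_le_mul_right ?_ _))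
    exact ENNReal.rpow_le_rpow (jb_initE_le y) (Nat.cast_nonneg N)
  have hkc : (fun y => kconv (symKernel (thinC hη j).schwartz) a (y (Fin.last d)) * h (initE y)) =
      kconv (symKernel M') u := by
    funext y
    conv_rhs => rw [← joinLast_initE y]
    rw [kconv_tensor, hh.reproducing (initE y)]
    rfl
  rw [hkc]
  refine ⟨(continuous_kconv _ huc.aestronglyMeasurable hut).aestronglyMeasurable, fun Φ => ?_⟩
  have h2 := integral_dualMul_eq_of_integrable (M := M') (Φ := Φ) (g := u)
    (integrable_prod_of_tempered huc.aestronglyMeasurable hut)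
  refine ⟨h2.1, ?_⟩
  have hI : Integrable fun y => dualMul M' Φ y * u y :=
    integrable_of_tempered huc.aestronglyMeasurable hut
  rw [← h2.2, box_apply hη, tensorDist_apply, integral_joinLast]
  refine Eq.trans ?_ (integral_prod_symm _ (integrable_joinLast_iff.2 hI)).symm
  refine integral_congr_ae (Filter.Eventually.of_forall fun t => ?_)
  have h3 : slice t (dualMul (prodSymbol fun i => thinC hη ((Fin.snoc k j : Fin (d + 1) → ℤ) i)) Φ) =
      dualMul (thinSymbol hη k) (slice t (dualMul M' Φ)) := by
    have h5 := slice_dualMul (ρ' := fun i => thinC hη (k i)) (thinC hη j)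
      (prodSymbol_thin_mul_fat hη k) t Φ
    rw [← thinSymbol_eq_snoc] at h5
    exact h5
  simp only
  have h4 := (hg.2 (slice t (dualMul M' Φ))).2
  rw [box_apply hη] at h4
  rw [h3]
  change a t * g (dualMul (prodSymbol fun i => thinC hη (k i)) _) = _
  rw [h4, ← integral_const_mul]
  refine integral_congr_ae (Filter.Eventually.of_forall fun x => ?_)
  simp only [u, joinLast_last, initE_joinLast, slice_apply]
  ring

lemma eLpNorm_tensor_le {α : ℝ → ℂ} {h : EuclideanSpace ℝ (Fin d) → ℂ} (hα : Continuous α)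
    (hh : Continuous h) (p : ℝ≥0∞) :
    eLpNorm (fun y : EuclideanSpace ℝ (Fin (d + 1)) => α (y (Fin.last d)) * h (initE y)) p volume ≤
      eLpNorm α p volume * eLpNorm h p volume := by
  by_cases h0 : p = 0
  · simp [h0]
  have h1 : eLpNorm (fun y : EuclideanSpace ℝ (Fin (d + 1)) =>
      α (y (Fin.last d)) * h (initE y)) p volume =
      eLpNorm (fun z : EuclideanSpace ℝ (Fin d) × ℝ => h z.1 * α z.2) p
        (volume.prod volume) := by
    rw [← (measurePreserving_joinEquiv d).map_eq,
      (joinEquiv d).measurableEmbedding.eLpNorm_map_measure]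
    congr 1
    funext z
    simp [mul_comm]
  rw [h1, mul_comm]
  by_cases ht : p = ⊤
  · subst ht
    simp only [eLpNorm_exponent_top]
    refine essSup_le_of_ae_le _ ?_
    filter_upwards [Measure.quasiMeasurePreserving_fst.ae (ae_le_eLpNormEssSup (f := h)),
      Measure.quasiMeasurePreserving_snd.ae (ae_le_eLpNormEssSup (f := α))] with z hz1 hz2
    rw [enorm_mul]
    exact mul_le_mul' hz1 hz2
  · rw [eLpNorm_eq_lintegral_rpow_enorm_toReal h0 ht, eLpNorm_eq_lintegral_rpow_enorm_toReal h0 ht,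
      eLpNorm_eq_lintegral_rpow_enorm_toReal h0 ht]
    simp only [enorm_mul, ENNReal.mul_rpow_of_nonneg _ _ ENNReal.toReal_nonneg]
    rw [lintegral_prod_mul (hh.enorm.measurable.pow_const _).aemeasurable
      (hα.enorm.measurable.pow_const _).aemeasurable,
      ENNReal.mul_rpow_of_nonneg _ _ (by positivity)]

lemma kconv_symKernel {V : Type*} [NormedAddCommGroup V] [InnerProductSpace ℝ V]
    [FiniteDimensional ℝ V] [MeasurableSpace V] [BorelSpace V] {M₁ M₂ M : 𝓢(V, ℂ)}
    (h : ∀ ξ, M₁ ξ * M₂ ξ = M ξ) : kconv (symKernel M₁) (symKernel M₂) = symKernel M := by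
  funext x
  have := integral_symKernel_mul h x 0
  simp only [sub_zero] at this
  exact this

/-- The one-dimensional frequency pieces of a band-limited function. -/
lemma exists_pieces_bandLimited (hη : IsBump η) {T : 𝓢(ℝ, ℂ)} {R : ℝ}
    (hT : ∀ τ, R ≤ |τ| → T τ = 0) : ∃ (M : ℤ → 𝓢(ℝ, ℂ)) (N : ℤ),
      (∀ j, kconv (symKernel (thinC hη j).schwartz) (symKernel T) = symKernel (M j)) ∧
      ∀ j, N < |j| → M j = 0 := by
  -- The j-th symbol lives where 2πτ is within 1 of j, so it misses the band |τ| < R once |j|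
  -- exceeds 2π|R| + 1.
  refine ⟨fun j => SchwartzMap.smulLeftCLM ℂ (thinC hη j).schwartz T, ⌈2 * Real.pi * |R| + 1⌉,
    fun j => kconv_symKernel fun τ => ?_, fun j hc => ?_⟩
  · rw [SchwartzMap.smulLeftCLM_apply_apply (SchwartzMap.hasTemperateGrowth _), smul_eq_mul]
  · ext τ
    rw [SchwartzMap.smulLeftCLM_apply_apply (SchwartzMap.hasTemperateGrowth _), smul_eq_mul]
    by_cases hτ : R ≤ |τ|
    · rw [hT τ hτ, mul_zero]
      rfl
    · have h1 : (thinC hη j).schwartz τ = 0 := by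
        change ((thin η (2 * Real.pi * τ - j) : ℝ) : ℂ) = 0
        rw [thin_eq_zero hη ?_, Complex.ofReal_zero]
        have h2 : 2 * Real.pi * |R| + 1 < |(j : ℝ)| := by
          refine (Int.le_ceil _).trans_lt ?_
          exact_mod_cast hc
        have h3 : |2 * Real.pi * τ| ≤ 2 * Real.pi * |R| := by
          rw [abs_mul, abs_of_pos (by positivity : 0 < 2 * Real.pi)]
          exact mul_le_mul_of_nonneg_left ((not_le.1 hτ).le.trans (le_abs_self R))
            (by positivity)
        have h4 := abs_sub_abs_le_abs_sub (j : ℝ) (2 * Real.pi * τ)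
        rw [abs_sub_comm] at h4
        linarith
      rw [h1, zero_mul]
      rfl

/-- The tensor product with a band-limited function is bounded between modulation spaces. -/
lemma exists_anisoNorm_tensor_le (hη : IsBump η) (d : ℕ) {T : 𝓢(ℝ, ℂ)} {R : ℝ}
    (hT : ∀ τ, R ≤ |τ| → T τ = 0) (s : ℝ) {p q r : ℝ≥0∞} (hq : q ≠ 0) (hr : r ≠ 0) (hrt : r ≠ ⊤) :
    ∃ C : ℝ≥0, ∀ g : 𝓢'(EuclideanSpace ℝ (Fin d), ℂ), modNorm η s p q g < ⊤ →
      anisoNorm η s p q r (tensorDist (symKernel T) g) ≤ C * modNorm η s p q g := by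
  obtain ⟨M, N, hM, hMN⟩ := exists_pieces_bandLimited hη hT
  obtain ⟨A, hAdef⟩ : ∃ A : ℤ → ℝ≥0∞, ∀ j, A j = eLpNorm (symKernel (M j)) p volume :=
    ⟨_, fun _ => rfl⟩
  have hA : ∀ j, A j ≠ ⊤ := fun j => by
    rw [hAdef]
    exact (SchwartzMap.eLpNorm_lt_top (symKernel (M j)) p volume).ne
  -- The anisotropic norm of the tensor product is bounded by the ℓ^r quasi-norm of `A` times the
  -- norm of g; finite support makes the former finite for every r.
  have hfin : {j | A j ≠ 0}.Finite := by
    refine (Set.finite_Icc (-N) N).subset fun j hj => ?_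
    rw [Set.mem_Icc, ← abs_le]
    by_contra! hc
    refine hj ?_
    rw [hAdef, hMN j hc, symKernel_zero]
    exact eLpNorm_zero
  have hrA : eLpNorm A r Measure.count ≠ ⊤ := by
    rw [eLpNorm_count_eq_tsum hr hrt]
    refine ENNReal.rpow_ne_top_of_nonneg (by positivity) ?_
    rw [tsum_eq_sum (s := hfin.toFinset) fun j hj => ?_]
    · exact ENNReal.sum_ne_top.2 fun j _ =>
        ENNReal.rpow_ne_top_of_nonneg ENNReal.toReal_nonneg (hA j)
    · simp only [Set.Finite.mem_toFinset, Set.mem_ofPred_eq, not_not] at hj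
      rw [hj, ENNReal.zero_rpow_of_pos (ENNReal.toReal_pos hr hrt)]
  refine ⟨(eLpNorm A r Measure.count).toNNReal, fun g hg => ?_⟩
  rw [ENNReal.coe_toNNReal hrA, mul_comm]
  refine seqNorm_le_of_le_mul r _ hg.ne fun j => ?_
  rw [mul_comm]
  refine seqNorm_le_of_le_mul q _ (hA j) (b := fun k => weight s k * distLp p (box η k g))
    fun k => ?_
  have h1 : distLp p (box η k g) ≠ ⊤ := by
    intro h
    have := enorm_le_eLpNorm_count (fun k => weight s k * distLp p (box η k g)) k hq
    rw [h, ENNReal.mul_top (weight_ne_zero _ _), enorm_eq_self] at this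
    exact (hg.trans_le this).false
  obtain ⟨h, h2, h3⟩ := exists_localized hη k h1
  rw [mul_left_comm]
  refine mul_le_mul_right ?_ _
  rw [distLp_eq h2]
  refine (distLp_le (isRepresentedBy_box_tensor hη _ h2 h3 j)).trans
    ?_
  rw [hM, hAdef]
  exact eLpNorm_tensor_le (symKernel (M j)).continuous h3.continuous p

end TensorBox

/-! ### Existence and linearity of the trace -/

section Trace

variable {d : ℕ} {η : ℝ → ℝ} {hη : IsBump η} {s : ℝ} {p q r : ℝ≥0∞}

/-- `g` is the sum of the slices at height `0` of the pieces of `f`. -/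
def IsPieceTrace (hη : IsBump η) (s : ℝ) (p : ℝ≥0∞)
    (f : 𝓢'(EuclideanSpace ℝ (Fin (d + 1)), ℂ)) (g : 𝓢'(EuclideanSpace ℝ (Fin d), ℂ)) : Prop :=
  ∃ h b, Pieces hη s p f h b ∧
    ∀ φ : 𝓢(EuclideanSpace ℝ (Fin d), ℂ), HasSum (fun k => ∫ x, φ x * h k (joinLast 0 x)) (g φ)

lemma exists_hasTrace (hη : IsBump η) (hp : 0 < p) (hq : q ≠ 0) (hr : r ≠ 0) (hr1 : r ≤ 1)
    {f : 𝓢'(EuclideanSpace ℝ (Fin (d + 1)), ℂ)} (hf : anisoNorm η s p q r f < ⊤) :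
    ∃ g, HasTrace f g ∧ IsPieceTrace hη s p f g := by
  obtain ⟨h, b, P⟩ := exists_pieces hη hq hr hr1 hf
  obtain ⟨F, h1, h2, h3⟩ := P.exists_family hp
  exact ⟨F 0, ⟨F, h2, h3, rfl⟩, h, b, P, h1 0⟩

/-- The continuous representatives of the pieces are unique, so they add at every point and hence on
the hyperplane, which is a null set. -/
lemma IsPieceTrace.add {f₁ f₂ : 𝓢'(EuclideanSpace ℝ (Fin (d + 1)), ℂ)}
    {g₁ g₂ g : 𝓢'(EuclideanSpace ℝ (Fin d), ℂ)} (hp : 0 < p) (H₁ : IsPieceTrace hη s p f₁ g₁)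
    (H₂ : IsPieceTrace hη s p f₂ g₂) (H : IsPieceTrace hη s p (f₁ + f₂) g) : g = g₁ + g₂ := by
  obtain ⟨h₁, b₁, P₁, S₁⟩ := H₁
  obtain ⟨h₂, b₂, P₂, S₂⟩ := H₂
  obtain ⟨h, b, P, S⟩ := H
  have hk : ∀ k, h k = h₁ k + h₂ k := by
    intro k
    have hr := P.rep k
    rw [map_add] at hr
    exact ((P.loc k).continuous.ae_eq_iff_eq volume
      ((P₁.loc k).continuous.add (P₂.loc k).continuous)).1
      (hr.ae_unique ((P₁.rep k).add (P₂.rep k)))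
  ext φ
  refine (S φ).unique (((S₁ φ).add (S₂ φ)).congr_fun fun k => ?_)
  rw [← integral_add (P₁.integrable_slice hp k 0 φ) (P₂.integrable_slice hp k 0 φ), hk]
  simp only [Pi.add_apply, mul_add]

lemma IsPieceTrace.smul {f₁ : 𝓢'(EuclideanSpace ℝ (Fin (d + 1)), ℂ)}
    {g₁ g : 𝓢'(EuclideanSpace ℝ (Fin d), ℂ)} (c : ℂ) (H₁ : IsPieceTrace hη s p f₁ g₁)
    (H : IsPieceTrace hη s p (c • f₁) g) : g = c • g₁ := by
  obtain ⟨h₁, b₁, P₁, S₁⟩ := H₁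
  obtain ⟨h, b, P, S⟩ := H
  have hk : ∀ k, h k = c • h₁ k := by
    intro k
    have hr := P.rep k
    rw [map_smul] at hr
    exact ((P.loc k).continuous.ae_eq_iff_eq volume ((P₁.loc k).continuous.const_smul c)).1
      (hr.ae_unique ((P₁.rep k).smul c))
  ext φ
  refine (S φ).unique (((S₁ φ).mul_left c).congr_fun fun k => ?_)
  rw [← integral_const_mul, hk]
  simp only [Pi.smul_apply, smul_eq_mul, mul_left_comm]

end Trace

/-! ### The extension operator -/

section Extension

variable {d : ℕ} {η : ℝ → ℝ} {s : ℝ} {p q r : ℝ≥0∞}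

/-- Tensoring with a band-limited function of value `1` at the origin extends functions from the
hyperplane. -/
lemma exists_extension (hη : IsBump η) {T : 𝓢(ℝ, ℂ)} {R : ℝ} (hT : ∀ τ, R ≤ |τ| → T τ = 0)
    (hT1 : symKernel T 0 = 1) (hq : q ≠ 0) (hr : r ≠ 0) (hrt : r ≠ ⊤) :
    ∃ E : modSpace d η s p q →ₗ[ℂ] anisoSpace d η s p q r,
      (∀ g, IsTensor (E g).1 (symKernel T) g.1) ∧
      IsQuasiBounded (fun g => modNorm η s p q g.1) (fun f => anisoNorm η s p q r f.1) E ∧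
      ∀ g, HasTrace (E g).1 g.1 := by
  obtain ⟨C, hC⟩ := exists_anisoNorm_tensor_le (p := p) hη d hT s hq hr hrt
  refine ⟨(tensorLM (symKernel T)).restrict fun g hg =>
    (hC g hg).trans_lt (ENNReal.mul_lt_top ENNReal.coe_lt_top hg), fun g Φ => rfl,
    ⟨C, fun g => hC g.1 g.2⟩, fun g => hasTrace_tensorDist g.1 hT1⟩

lemma symKernel_smul_apply (c : ℂ) (M : 𝓢(ℝ, ℂ)) (t : ℝ) :
    symKernel (c • M) t = c * symKernel M t := by
  rw [symKernel_eq_integral, symKernel_eq_integral, ← integral_const_mul]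
  refine integral_congr_ae (Filter.Eventually.of_forall fun ξ => ?_)
  simp only [smul_apply, smul_eq_mul, mul_left_comm]

/-- A kernel at the origin is the integral of its symbol, so a nonnegative nonzero cutoff can be
normalized. -/
lemma exists_bandLimited (hη : IsBump η) : ∃ (T : 𝓢(ℝ, ℂ)) (R : ℝ),
    (∀ τ, R ≤ |τ| → T τ = 0) ∧ symKernel T 0 = 1 := by
  set ρ := fatC hη 0
  have hρ : ∀ τ, ρ.toFun τ = η (2 * Real.pi * τ) := fun τ => by
    change η (2 * Real.pi * τ - ((0 : ℤ) : ℝ)) = _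
    simp
  have hpos : 0 < ∫ τ, ρ.toFun τ :=
    ρ.smooth.continuous.integral_pos_of_hasCompactSupport_nonneg_nonzero ρ.compact
      (fun τ => by rw [hρ]; exact hη.nonneg _) (x := 0)
      (by rw [hρ, hη.eq_one _ (by simp)]; exact one_ne_zero)
  have h0 : symKernel ρ.schwartz 0 = ((∫ τ, ρ.toFun τ : ℝ) : ℂ) := by
    rw [symKernel_eq_integral, ← integral_complex_ofReal]
    refine integral_congr_ae (Filter.Eventually.of_forall fun ξ => ?_)
    simp only [inner_zero_right, AddChar.map_zero_eq_one, Circle.coe_one, one_mul]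
    rfl
  refine ⟨((∫ τ, ρ.toFun τ : ℝ) : ℂ)⁻¹ • ρ.schwartz, 2, fun τ hτ => ?_, ?_⟩
  · rw [smul_apply]
    change _ • ((ρ.toFun τ : ℝ) : ℂ) = 0
    rw [hρ, hη.eq_zero, Complex.ofReal_zero, smul_zero]
    rw [abs_mul, abs_of_pos (by positivity : 0 < 2 * Real.pi)]
    nlinarith [Real.pi_gt_three]
  · rw [symKernel_smul_apply, h0, inv_mul_cancel₀]
    exact_mod_cast hpos.ne'

lemma exists_symKernel_eq_invFourier {θ : ℝ → ℝ} (hθ : IsBump θ) : ∃ (T : 𝓢(ℝ, ℂ)) (R : ℝ),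
    (∀ τ, R ≤ |τ| → T τ = 0) ∧ ⇑(symKernel T) = invFourier θ := by
  set ρ := fatC hθ 0
  have hρ : ∀ τ, ρ.toFun τ = θ (2 * Real.pi * τ) := fun τ => by
    change θ (2 * Real.pi * τ - ((0 : ℤ) : ℝ)) = _
    simp
  -- The substitution ξ = 2πτ turns the constant (2π)^{-1/2} into 2π (2π)^{-1/2}, the square root of
  -- 2π.
  refine ⟨((Real.sqrt (2 * Real.pi) : ℝ) : ℂ) • ρ.schwartz, 2, fun τ hτ => ?_, ?_⟩
  · rw [smul_apply]
    change _ • ((ρ.toFun τ : ℝ) : ℂ) = 0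
    rw [hρ, hθ.eq_zero, Complex.ofReal_zero, smul_zero]
    rw [abs_mul, abs_of_pos (by positivity : 0 < 2 * Real.pi)]
    nlinarith [Real.pi_gt_three]
  · funext t
    rw [symKernel_smul_apply, symKernel_eq_integral, invFourier]
    have h1 : ∫ ξ, (Real.fourierChar (inner ℝ ξ t) : ℂ) * ρ.schwartz ξ =
        ∫ ξ : ℝ, Complex.exp (Complex.I * t * (2 * Real.pi * ξ : ℝ)) *
          (θ (2 * Real.pi * ξ) : ℂ) := by
      refine integral_congr_ae (Filter.Eventually.of_forall fun ξ => ?_)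
      simp only
      have h2 : ρ.schwartz ξ = (θ (2 * Real.pi * ξ) : ℂ) := by rw [← hρ]; rfl
      rw [h2, Real.fourierChar_apply]
      have h3 : inner ℝ ξ t = t * ξ := by simp
      rw [h3]
      congr 2
      push_cast
      ring
    rw [h1, Measure.integral_comp_mul_left (fun ξ : ℝ => Complex.exp (Complex.I * t * ξ) * (θ ξ : ℂ))
      (2 * Real.pi), abs_of_pos (by positivity), Complex.real_smul, ← mul_assoc]
    congr 1
    have h3 : (0 : ℝ) < Real.sqrt (2 * Real.pi) := Real.sqrt_pos.2 (by positivity)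
    have h4 : Real.sqrt (2 * Real.pi) * (2 * Real.pi)⁻¹ = (Real.sqrt (2 * Real.pi))⁻¹ := by
      nth_rewrite 2 [← Real.mul_self_sqrt (by positivity : 0 ≤ 2 * Real.pi)]
      field_simp
    exact_mod_cast h4

end Extension

end ModTrace

/-! ### The trace theorem -/

open ModTrace

theorem mainTheorem1 (d : ℕ) (hd : 1 ≤ d) (p q : ℝ≥0∞) (hp : 0 < p) (hq : 0 < q) (s : ℝ)
    (η : ℝ → ℝ) (hη : IsBump η) :
    ∃ T : anisoSpace d η s p q (p ⊓ q ⊓ 1) →ₗ[ℂ] modSpace d η s p q,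
      (∀ (f : anisoSpace d η s p q (p ⊓ q ⊓ 1)) (g : 𝓢'(EuclideanSpace ℝ (Fin d), ℂ)),
        HasTrace f.1 g ↔ g = (T f).1) ∧
      IsRetraction (fun f => anisoNorm η s p q (p ⊓ q ⊓ 1) f.1)
        (fun g => modNorm η s p q g.1) T ∧
      ∀ θ : ℝ → ℝ, IsBump θ → invFourier θ 0 = 1 →
        ∃ E : modSpace d η s p q →ₗ[ℂ] anisoSpace d η s p q (p ⊓ q ⊓ 1),
          (∀ g : modSpace d η s p q, IsTensor (E g).1 (invFourier θ) g.1) ∧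
          IsQuasiBounded (fun g => modNorm η s p q g.1)
            (fun f => anisoNorm η s p q (p ⊓ q ⊓ 1) f.1) E ∧
          ∀ g, T (E g) = g := by
  have hr : p ⊓ q ⊓ 1 ≠ 0 := (lt_min (lt_min hp hq) one_pos).ne'
  have hr1 : p ⊓ q ⊓ 1 ≤ 1 := min_le_right _ _
  have hrt : p ⊓ q ⊓ 1 ≠ ⊤ := (hr1.trans_lt ENNReal.one_lt_top).ne
  choose Tr hTr hPiece using fun f : anisoSpace d η s p q (p ⊓ q ⊓ 1) =>
    exists_hasTrace hη hp hq.ne' hr hr1 f.2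
  obtain ⟨C, hC⟩ := exists_modNorm_trace_le hη d s hp hq
  have hbound : ∀ f, modNorm η s p q (Tr f) ≤ C * anisoNorm η s p q (p ⊓ q ⊓ 1) f.1 := by
    intro f
    obtain ⟨h, b, P, S⟩ := hPiece f
    exact hC P 0 S
  let T : anisoSpace d η s p q (p ⊓ q ⊓ 1) →ₗ[ℂ] modSpace d η s p q :=
    { toFun := fun f => ⟨Tr f, (hbound f).trans_lt (ENNReal.mul_lt_top ENNReal.coe_lt_top f.2)⟩
      map_add' := fun f f' => Subtype.ext ((hPiece f).add hp (hPiece f') (hPiece (f + f')))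
      map_smul' := fun c f => Subtype.ext ((hPiece f).smul c (hPiece (c • f))) }
  have hT : ∀ f g, HasTrace f.1 g ↔ g = (T f).1 := fun f g =>
    ⟨fun h => hasTrace_unique hη h (hTr f), fun h => h ▸ hTr f⟩
  -- By uniqueness of the restriction, any extension whose restriction is g is a right inverse of
  -- the trace.
  have hinv : ∀ {E : modSpace d η s p q →ₗ[ℂ] anisoSpace d η s p q (p ⊓ q ⊓ 1)},
      (∀ g, HasTrace (E g).1 g.1) → ∀ g, T (E g) = g := fun h g =>
    Subtype.ext ((hT _ _).1 (h g)).symm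
  refine ⟨T, hT, ⟨⟨C, hbound⟩, ?_⟩, fun θ hθ hθ1 => ?_⟩
  · obtain ⟨K, R, hK, hK1⟩ := exists_bandLimited hη
    obtain ⟨E, -, hE, hE'⟩ := exists_extension (d := d) (s := s) (p := p) hη hK hK1 hq.ne' hr hrt
    exact ⟨E, hE, hinv hE'⟩
  · obtain ⟨K, R, hK, hKθ⟩ := exists_symKernel_eq_invFourier hθ
    obtain ⟨E, hEt, hE, hE'⟩ := exists_extension (d := d) (s := s) (p := p) hη hK
      (by rw [hKθ, hθ1]) hq.ne' hr hrt
    exact ⟨E, fun g => hKθ ▸ hEt g, hE, hinv hE'⟩
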